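/- Let $d\in(-\tfrac12,\tfrac12)\setminus\{0\}$, let $\mathbb R_+=[0,\infty)$, $D=\{z\in\mathbb C:|z|<1\}$, and let $$Q(z)=\frac1{4\pi}\,(z^{-1}-2+z)\big(\mathrm{Li}_{-2d-1}(z)+\mathrm{Li}_{-2d-1}(z^{-1})\big),\qquad z\in\mathbb C\setminus\mathbb R_+,$$ where $\mathrm{Li}_s$ is the polylogarithm, i.e. the holomorphic extension of $\sum_{k\ge1}k^{-s}z^k$ from $D$ to $\mathbb C\setminus[1,\infty)$. For $t\in(0,1)$ let $Q^+(t)$ be the limit of $Q(z)$ as $z\to t$ from the open upper half-plane. Put $$X_0(z)=\exp\Big(\frac1\pi\int_0^1\frac{\arg Q^+(\tau)}{\tau-z}\,d\tau\Big),\quad z\in\mathbb C\setminus[0,1],\qquad \psi(z)=\exp\Big(-\frac1{2\pi i}\oint_{|\zeta|=1}\frac{\log Q(\zeta)}{\zeta-z}\,d\zeta\Big),\quad |z|\ne1,$$ with $\arg\in(-\pi,\pi]$, the principal branch of $\log$ and the circle oriented counterclockwise. These objects are well defined: for every $t\in(0,1)$ the limit $Q^+(t)$ exists and is nonzero, and both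 integrands are integrable. Moreover: 1. If $d\in(0,\tfrac12)$, there is $s_0\in(-1,0)$ such that the zeros of $Q$ in $\mathbb C\setminus\mathbb R_+$ are exactly $s_0$ and $s_0^{-1}$, the zero $s_0$ is simple, and $$X_0(z)=\psi(z)\,Q(z)\,\frac{z}{z-s_0},\qquad z\in D\setminus[0,1),$$ where at $z=s_0$ the right-hand side is understood as its limit. 2. If $d\in(-\tfrac12,0)$, then $Q$ does not vanish in $\mathbb C\setminus\mathbb R_+$, and $X_0(z)=\psi(z)\,Q(z)$ for all $z\in D\setminus[0,1)$. -/

import Mathlib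

open Filter Topology MeasureTheory

/-- The polylogarithm `Li_s(z)`, for real order `s > -2` and `z ∈ ℂ \ [1, ∞)`.  It is written
through the integral
`Li_s(z) = Γ(s+2)⁻¹ ∫₀^∞ t^(s+1) z e⁻ᵗ (1 + z e⁻ᵗ) / (1 - z e⁻ᵗ)³ dt`,
obtained from `k^(-s) = k² k^(-(s+2))` and `∑ k² rᵏ = r (1 + r) / (1 - r)³`.
The two theorems below show that this is the polylogarithm: it is holomorphic in
`ℂ \ [1, ∞)` and equal to `∑_{k ≥ 1} k^(-s) zᵏ` in the unit disk. -/
noncomputable def polylog (s : ℝ) (z : ℂ) : ℂ :=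
  ((Real.Gamma (s + 2) : ℝ) : ℂ)⁻¹ *
    ∫ t in Set.Ioi (0 : ℝ), ((t ^ (s + 1) : ℝ) : ℂ) *
      ((z * (Real.exp (-t) : ℂ)) * (1 + z * (Real.exp (-t) : ℂ)) /
        (1 - z * (Real.exp (-t) : ℂ)) ^ 3)

theorem hasSum_sq_mul_geometric {w : ℂ} (hw : ‖w‖ < 1) :
    HasSum (fun n : ℕ => ((n : ℂ) + 1) ^ 2 * w ^ (n + 1)) (w * (1 + w) / (1 - w) ^ 3) := by
  have h2 := hasSum_choose_mul_geometric_of_norm_lt_one 2 hw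
  have h1 := hasSum_choose_mul_geometric_of_norm_lt_one 1 hw
  have h := ((h2.mul_left 2).sub h1).mul_left w
  have hne : (1 - w) ≠ 0 := by
    intro h0
    have : w = 1 := (sub_eq_zero.mp h0).symm
    simp [this] at hw
  have e1 : (fun n : ℕ => ((n : ℂ) + 1) ^ 2 * w ^ (n + 1)) = fun n : ℕ =>
      w * (2 * (((n + 2).choose 2 : ℕ) * w ^ n) - ((n + 1).choose 1 : ℕ) * w ^ n) := by
    funext n
    have hc : (((n + 2).choose 2 : ℕ) : ℂ) = ((n : ℂ) + 2) * ((n : ℂ) + 1) / 2 := by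
      rw [Nat.cast_choose_two]; push_cast; ring
    rw [hc, Nat.choose_one_right]
    push_cast
    ring
  have e2 : w * (1 + w) / (1 - w) ^ 3 =
      w * (2 * (1 / (1 - w) ^ (2 + 1)) - 1 / (1 - w) ^ (1 + 1)) := by
    field_simp
    ring
  rw [e1, e2]
  exact h

/-- In the unit disk `polylog s` is the usual series. -/
theorem hasSum_polylog {s : ℝ} (hs : -2 < s) {z : ℂ} (hz : ‖z‖ < 1) :
    HasSum (fun n : ℕ => ((((n : ℝ) + 1) ^ (-s) : ℝ) : ℂ) * z ^ (n + 1)) (polylog s z) := by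
  have hG : 0 < Real.Gamma (s + 2) := Real.Gamma_pos_of_pos (by linarith)
  have key : ∀ n : ℕ, ∫ t in Set.Ioi (0 : ℝ), t ^ (s + 1) * Real.exp (-(((n : ℝ) + 1) * t)) =
      ((n : ℝ) + 1) ^ (-(s + 2)) * Real.Gamma (s + 2) := by
    intro n
    have h := Real.integral_rpow_mul_exp_neg_mul_Ioi (a := s + 2) (r := (n : ℝ) + 1)
      (by linarith) (by positivity)
    rw [show s + 2 - 1 = s + 1 by ring] at h
    rw [h, one_div, Real.inv_rpow (by positivity), Real.rpow_neg (by positivity)]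
  have hint : ∀ n : ℕ, IntegrableOn
      (fun t : ℝ => t ^ (s + 1) * Real.exp (-(((n : ℝ) + 1) * t))) (Set.Ioi 0) := by
    intro n
    by_contra hcon
    have h0 := integral_undef hcon
    rw [key n] at h0
    have : 0 < ((n : ℝ) + 1) ^ (-(s + 2)) * Real.Gamma (s + 2) := by positivity
    linarith
  let F : ℕ → ℝ → ℂ := fun n t =>
    (((n : ℂ) + 1) ^ 2 * z ^ (n + 1)) *
      ((t ^ (s + 1) * Real.exp (-(((n : ℝ) + 1) * t)) : ℝ) : ℂ)
  have hpow : ∀ n : ℕ, ((n : ℝ) + 1) ^ 2 * ((n : ℝ) + 1) ^ (-(s + 2)) =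
      ((n : ℝ) + 1) ^ (-s) := by
    intro n
    have hp : (0 : ℝ) < (n : ℝ) + 1 := by positivity
    rw [← Real.rpow_natCast, ← Real.rpow_add hp]
    congr 1
    push_cast
    ring
  have hFint : ∀ n, Integrable (F n) (volume.restrict (Set.Ioi (0 : ℝ))) := fun n =>
    (Integrable.ofReal (hint n)).const_mul _
  have hFval : ∀ n, ∫ t in Set.Ioi (0 : ℝ), F n t =
      (Real.Gamma (s + 2) : ℂ) * (((((n : ℝ) + 1) ^ (-s) : ℝ) : ℂ) * z ^ (n + 1)) := by
    intro n
    simp only [F]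
    rw [integral_const_mul, integral_complex_ofReal, key n, ← hpow n]
    push_cast
    ring
  have hFnorm : ∀ n, ∫ t in Set.Ioi (0 : ℝ), ‖F n t‖ =
      Real.Gamma (s + 2) * (((n : ℝ) + 1) ^ (-s) * ‖z‖ ^ (n + 1)) := by
    intro n
    have : ∀ t ∈ Set.Ioi (0 : ℝ), ‖F n t‖ = (((n : ℝ) + 1) ^ 2 * ‖z‖ ^ (n + 1)) *
        (t ^ (s + 1) * Real.exp (-(((n : ℝ) + 1) * t))) := by
      intro t ht
      have ht' : (0 : ℝ) < t := ht
      simp only [F, norm_mul, norm_pow, Complex.norm_real]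
      have h1 : ‖(n : ℂ) + 1‖ = (n : ℝ) + 1 := by
        rw [show (n : ℂ) + 1 = (((n : ℝ) + 1 : ℝ) : ℂ) by push_cast; rfl, Complex.norm_real,
          Real.norm_of_nonneg (by positivity)]
      rw [h1, Real.norm_of_nonneg (Real.rpow_nonneg ht'.le _),
        Real.norm_of_nonneg (Real.exp_pos _).le]
    rw [setIntegral_congr_fun measurableSet_Ioi this, integral_const_mul, key n, ← hpow n]
    ring
  have hsum : Summable fun n : ℕ => ∫ t in Set.Ioi (0 : ℝ), ‖F n t‖ := by
    simp_rw [hFnorm]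
    refine Summable.mul_left _ ?_
    have hg := summable_nat_add_iff (f := fun n : ℕ => (n : ℝ) ^ 2 * ‖z‖ ^ n) 1 |>.mpr
      (summable_pow_mul_geometric_of_norm_lt_one 2 (by simpa using hz))
    refine Summable.of_nonneg_of_le (fun n => by positivity) (fun n => ?_) hg
    have h1 : (1 : ℝ) ≤ (n : ℝ) + 1 := by
      have : (0 : ℝ) ≤ n := Nat.cast_nonneg n
      linarith
    have : ((n : ℝ) + 1) ^ (-s) ≤ ((n : ℝ) + 1) ^ (2 : ℕ) := by
      rw [← Real.rpow_natCast]
      exact Real.rpow_le_rpow_of_exponent_le h1 (by push_cast; linarith)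
    push_cast
    gcongr
  have hmain := hasSum_integral_of_summable_integral_norm hFint hsum
  simp_rw [hFval] at hmain
  have hcong : ∫ t in Set.Ioi (0 : ℝ), ∑' n, F n t =
      ∫ t in Set.Ioi (0 : ℝ), ((t ^ (s + 1) : ℝ) : ℂ) *
        ((z * (Real.exp (-t) : ℂ)) * (1 + z * (Real.exp (-t) : ℂ)) /
          (1 - z * (Real.exp (-t) : ℂ)) ^ 3) := by
    refine setIntegral_congr_fun measurableSet_Ioi fun t ht => ?_
    have ht' : (0 : ℝ) < t := ht
    have hw : ‖z * (Real.exp (-t) : ℂ)‖ < 1 := by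
      rw [norm_mul, Complex.norm_real, Real.norm_of_nonneg (Real.exp_pos _).le]
      have : Real.exp (-t) ≤ 1 := Real.exp_le_one_iff.mpr (by linarith)
      nlinarith [norm_nonneg z, Real.exp_pos (-t)]
    have h := ((hasSum_sq_mul_geometric hw).mul_left ((t ^ (s + 1) : ℝ) : ℂ)).tsum_eq
    refine Eq.trans (tsum_congr fun n => ?_) h
    have he : Real.exp (-(((n : ℝ) + 1) * t)) = Real.exp (-t) ^ (n + 1) := by
      rw [← Real.exp_nat_mul]; congr 1; push_cast; ring
    simp only [F]
    rw [he]
    push_cast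
    ring
  rw [hcong] at hmain
  have hG' : (Real.Gamma (s + 2) : ℂ) ≠ 0 := by exact_mod_cast hG.ne'
  have := hmain.mul_left ((Real.Gamma (s + 2) : ℂ)⁻¹)
  simp only [inv_mul_cancel_left₀ hG'] at this
  exact this

/-- `polylog s` is holomorphic in the plane cut along `[1, ∞)`. -/
theorem differentiableAt_polylog {s : ℝ} (hs : -2 < s) {z : ℂ} (hz : z.im ≠ 0 ∨ z.re < 1) :
    DifferentiableAt ℂ (polylog s) z := by
  have hopen : IsOpen {w : ℂ | w.im ≠ 0 ∨ w.re < 1} :=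
    (isOpen_ne_fun Complex.continuous_im continuous_const).union
      (isOpen_lt Complex.continuous_re continuous_const)
  obtain ⟨ε, hε, hball⟩ := Metric.nhds_basis_closedBall.mem_iff.mp (hopen.mem_nhds hz)
  have hne : ∀ w : ℂ, (w.im ≠ 0 ∨ w.re < 1) → ∀ r ∈ Set.Icc (0 : ℝ) 1, 1 - w * (r : ℂ) ≠ 0 := by
    intro w hw r hr h0
    have hre := congrArg Complex.re h0
    have him := congrArg Complex.im h0
    simp at hre him
    rcases hw with hw | hw
    · rcases him with h | h
      · exact hw h
      · simp [h] at hre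
    · have h1 : w.re * r ≤ 1 * r := mul_le_mul_of_nonneg_right hw.le hr.1
      have h2 : r = 1 := by linarith [hr.2]
      rw [h2] at hre
      linarith
  obtain ⟨c, hc, hcb⟩ : ∃ c > 0, ∀ w ∈ Metric.closedBall z ε, ∀ r ∈ Set.Icc (0 : ℝ) 1,
      c ≤ ‖1 - w * (r : ℂ)‖ := by
    have hK : IsCompact (Metric.closedBall z ε ×ˢ Set.Icc (0 : ℝ) 1) :=
      (isCompact_closedBall z ε).prod isCompact_Icc
    have hcont : ContinuousOn (fun p : ℂ × ℝ => ‖1 - p.1 * (p.2 : ℂ)‖)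
        (Metric.closedBall z ε ×ˢ Set.Icc (0 : ℝ) 1) := by fun_prop
    obtain ⟨p, hp, hmin⟩ := hK.exists_isMinOn
      ⟨(z, 0), by simp [hε.le]⟩ hcont
    refine ⟨_, norm_pos_iff.mpr (hne p.1 (hball hp.1) p.2 hp.2), fun w hw r hr => ?_⟩
    exact hmin (a := (w, r)) ⟨hw, hr⟩
  have hexp : ∀ t ∈ Set.Ioi (0 : ℝ), Real.exp (-t) ∈ Set.Icc (0 : ℝ) 1 := fun t ht =>
    ⟨(Real.exp_pos _).le, Real.exp_le_one_iff.mpr (by simpa using (le_of_lt ht))⟩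
  have hbase : IntegrableOn (fun t : ℝ => t ^ (s + 1) * Real.exp (-t)) (Set.Ioi 0) := by
    have := Real.GammaIntegral_convergent (s := s + 2) (by linarith)
    rw [show s + 2 - 1 = s + 1 by ring] at this
    simpa [mul_comm] using this
  set M : ℝ := ‖z‖ + ε with hM
  have hwM : ∀ w ∈ Metric.closedBall z ε, ‖w‖ ≤ M := by
    intro w hw
    have h1 : ‖w - z‖ ≤ ε := by simpa [dist_eq_norm] using hw
    have h2 : ‖w‖ ≤ ‖z‖ + ‖w - z‖ := by
      simpa using norm_add_le z (w - z)
    linarith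
  have hM0 : 0 ≤ M := by positivity
  let F : ℂ → ℝ → ℂ := fun w t => ((t ^ (s + 1) : ℝ) : ℂ) *
      ((w * (Real.exp (-t) : ℂ)) * (1 + w * (Real.exp (-t) : ℂ)) /
        (1 - w * (Real.exp (-t) : ℂ)) ^ 3)
  let F' : ℂ → ℝ → ℂ := fun w t => ((t ^ (s + 1) : ℝ) : ℂ) *
      ((Real.exp (-t) : ℂ) * (1 + 4 * (w * (Real.exp (-t) : ℂ)) + (w * (Real.exp (-t) : ℂ)) ^ 2) /
        (1 - w * (Real.exp (-t) : ℂ)) ^ 4)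
  have hmeasF : ∀ w, Measurable (F w) := by intro w; simp only [F]; fun_prop
  have hmeasF' : ∀ w, Measurable (F' w) := by intro w; simp only [F']; fun_prop
  have hwr : ∀ w ∈ Metric.closedBall z ε, ∀ t ∈ Set.Ioi (0 : ℝ),
      ‖w * (Real.exp (-t) : ℂ)‖ ≤ M := by
    intro w hw t ht
    rw [norm_mul, Complex.norm_real, Real.norm_of_nonneg (Real.exp_pos _).le]
    have := (hexp t ht).2
    nlinarith [hwM w hw, norm_nonneg w, (hexp t ht).1]
  have hd := hasDerivAt_integral_of_dominated_loc_of_deriv_le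
    (μ := volume.restrict (Set.Ioi (0 : ℝ))) (𝕜 := ℂ) (F := F) (F' := F') (x₀ := z)
    (s := Metric.closedBall z ε)
    (bound := fun t => (1 + 4 * M + M ^ 2) / c ^ 4 * (t ^ (s + 1) * Real.exp (-t)))
    (Metric.closedBall_mem_nhds z hε)
    (Eventually.of_forall fun w => (hmeasF w).aestronglyMeasurable) ?_
    (hmeasF' z).aestronglyMeasurable ?_ (hbase.const_mul _) ?_
  · exact (hd.2.const_mul _).differentiableAt
  · refine Integrable.mono' (hbase.const_mul (M * (1 + M) / c ^ 3))
      (hmeasF z).aestronglyMeasurable ?_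
    filter_upwards [ae_restrict_mem measurableSet_Ioi] with t ht
    have hzb : z ∈ Metric.closedBall z ε := Metric.mem_closedBall_self hε.le
    have ht' : (0 : ℝ) < t := ht
    have hcz := hcb z hzb _ (hexp t ht)
    have e1 : ‖z * (Real.exp (-t) : ℂ)‖ ≤ M * Real.exp (-t) := by
      rw [norm_mul, Complex.norm_real, Real.norm_of_nonneg (Real.exp_pos _).le]
      have := hwM z hzb
      gcongr
    have e2 : ‖1 + z * (Real.exp (-t) : ℂ)‖ ≤ 1 + M := by
      refine (norm_add_le _ _).trans ?_
      have := hwr z hzb t ht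
      simp only [norm_one]
      linarith
    simp only [F]
    rw [norm_mul, norm_div, norm_mul, norm_pow, Complex.norm_real,
      Real.norm_of_nonneg (Real.rpow_nonneg ht'.le _)]
    have hr : 0 ≤ t ^ (s + 1) := Real.rpow_nonneg ht'.le _
    calc _ ≤ t ^ (s + 1) * ((M * Real.exp (-t)) * (1 + M) / c ^ 3) := by gcongr
      _ = _ := by ring
  · filter_upwards [ae_restrict_mem measurableSet_Ioi] with t ht w hw
    have ht' : (0 : ℝ) < t := ht
    have hcw := hcb w hw _ (hexp t ht)
    have e1 := hwr w hw t ht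
    have e2 : ‖1 + 4 * (w * (Real.exp (-t) : ℂ)) + (w * (Real.exp (-t) : ℂ)) ^ 2‖
        ≤ 1 + 4 * M + M ^ 2 := by
      refine (norm_add₃_le).trans ?_
      rw [norm_pow, norm_mul (4 : ℂ), norm_one]
      have : ‖(4 : ℂ)‖ = 4 := by simp
      rw [this]
      gcongr
    simp only [F']
    rw [norm_mul, norm_div, norm_mul, norm_pow, Complex.norm_real, Complex.norm_real,
      Real.norm_of_nonneg (Real.rpow_nonneg ht'.le _), Real.norm_of_nonneg (Real.exp_pos _).le]
    have hr : 0 ≤ t ^ (s + 1) := Real.rpow_nonneg ht'.le _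
    calc _ ≤ t ^ (s + 1) * (Real.exp (-t) * (1 + 4 * M + M ^ 2) / c ^ 4) := by gcongr
      _ = _ := by ring
  · filter_upwards [ae_restrict_mem measurableSet_Ioi] with t ht w hw
    have hn := hne w (hball hw) _ (hexp t ht)
    set r : ℂ := (Real.exp (-t) : ℂ) with hr
    have h1 : HasDerivAt (fun w : ℂ => w * r) r w := by
      simpa using (hasDerivAt_id w).mul_const r
    have h2 := (h1.mul (h1.const_add 1)).div ((h1.const_sub 1).pow 3) (pow_ne_zero 3 hn)
    have h3 := h2.const_mul ((t ^ (s + 1) : ℝ) : ℂ)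
    refine h3.congr_deriv ?_
    simp only [F', Pi.mul_apply, Pi.pow_apply, ← hr]
    refine congrArg _ ?_
    rw [div_eq_div_iff (pow_ne_zero _ (pow_ne_zero _ hn)) (pow_ne_zero _ hn)]
    norm_num
    ring

/-- The plane cut along the half-line `ℝ₊ = [0, ∞)`. -/
def cutPlane : Set ℂ := {z | z.re < 0 ∨ z.im ≠ 0}

/-- The sectionally holomorphic extension of the spectral density of fractional Gaussian noise,
`Q(z) = (4π)⁻¹ (z⁻¹ - 2 + z) (Li_{-2d-1}(z) + Li_{-2d-1}(z⁻¹))`, used for `z ∈ ℂ \ ℝ₊`. -/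
noncomputable def fgnQ (d : ℝ) (z : ℂ) : ℂ :=
  1 / (4 * (Real.pi : ℂ)) * (z⁻¹ - 2 + z) * (polylog (-2 * d - 1) z + polylog (-2 * d - 1) z⁻¹)

/-- The limit `Q⁺(t)` of `Q(z)` as `z → t` from the open upper half-plane. -/
noncomputable def fgnQPlus (d : ℝ) (t : ℝ) : ℂ :=
  limUnder (𝓝[{z : ℂ | 0 < z.im}] (t : ℂ)) (fgnQ d)

/-- `X₀(z) = exp (π⁻¹ ∫₀¹ arg(Q⁺(τ)) / (τ - z) dτ)`, `z ∈ ℂ \ [0, 1]`, where `arg` takes values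
in `(-π, π]`. -/
noncomputable def fgnX0 (d : ℝ) (z : ℂ) : ℂ :=
  Complex.exp (1 / (Real.pi : ℂ) *
    ∫ τ in (0 : ℝ)..1, ((fgnQPlus d τ).arg : ℂ) / ((τ : ℂ) - z))

/-- `ψ(z) = exp (-(2πi)⁻¹ ∮_{|ζ|=1} log Q(ζ) / (ζ - z) dζ)`, `z` off the unit circle. -/
noncomputable def fgnPsi (d : ℝ) (z : ℂ) : ℂ :=
  Complex.exp (-(1 / (2 * (Real.pi : ℂ) * Complex.I)) *
    ∮ ζ in C(0, 1), Complex.log (fgnQ d ζ) / (ζ - z))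

open scoped ComplexConjugate

/-! Everything rests on the substitution `v = z⁻¹ - 2 + z`, under which `Q` becomes a function of
`v` off `[0, ∞)` with a Stieltjes-type representation. With `y(t) = 2 cosh t - 2`, the sum over `k`
of `(zᵏ + z⁻ᵏ) e⁻ᵏᵗ` (suitably continued) is `-1 + 2 sinh t / (y(t) - v)`. Integrating by parts
twice in the integral that defines the polylogarithm turns `Q(z) - Q(w)` into `c (v - u) ∫ ω(t) /
((y - v)(y - u)) dt`, where `u` belongs to `w`, the weight `ω` is positive and `c` has the sign of
`d` (`fgnQ_sub_fgnQ`). Hence `Q / c` is a Pick function of `v`: `Im Q` has the sign of `c Im v`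
(`im_fgnQ`), and on the real axis `Q / c` is strictly increasing in `v`.

The zeros follow. A zero needs real `v < 0`, and by monotonicity there is at most one such `v`. For
`d < 0` there is also an undifferenced representation which makes `Q` positive for all real `v < 0`.
For `d > 0`, `Q` is positive at `v = -4`, that is at `z = -1`, and becomes negative as `v → -∞`, so
there is one zero `v < -4`. It corresponds to the pair `s₀, s₀⁻¹`, and strict monotonicity makes it
simple.

For the factorisation put `N = Q` if `d < 0` and `N = z Q / (z - s₀)` if `d > 0`. On the closed unit
disk cut along `[0, 1]` the function `N` avoids the half-line `(-∞, 0]`, so `log N` (principal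
branch) is holomorphic there and symmetric under conjugation. Cauchy's formula in the slit disk
(`slit_disc_cauchy`) expresses `log N(z)` by an integral over the circle and an integral of the jump
`2i Im log N⁺ = 2i arg Q⁺` over the slit. The slit integral is the exponent of `X₀`; the circle
integral is minus the exponent of `ψ`, since `log (ζ / (ζ - s₀))` contributes nothing to it.
Exponentiating gives `X₀ = ψ N`.

Two analytic inputs justify the limits. The boundary value `Q⁺` exists by a contour deformation and
has nonzero imaginary part because `Im Q` behaves like a Poisson integral of a positive weight. The
logarithm of `|Q|` grows at most logarithmically at the boundary, again by the integral
representation (`exists_log_norm_fgnQ_bound`). -/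

theorem integrableOn_rpow_mul_exp_neg {a : ℝ} (ha : -1 < a) :
    IntegrableOn (fun t : ℝ => t ^ a * Real.exp (-t)) (Set.Ioi 0) := by
  have := Real.GammaIntegral_convergent (s := a + 1) (by linarith)
  simpa [mul_comm] using this

/-! ### Powers on the half-line: integrability and integration by parts. -/

theorem integrableOn_rpow_mul_of_bound {a : ℝ} (k : ℕ) (hk : -1 - k < a) (ha : a < -1)
    {M : ℝ → ℂ} (hM : Continuous M) {C : ℝ} (h0 : ∀ t, 0 ≤ t → ‖M t‖ ≤ C * t ^ k)
    (hb : ∀ t, 0 ≤ t → ‖M t‖ ≤ C) :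
    IntegrableOn (fun t : ℝ => ((t ^ a : ℝ) : ℂ) * M t) (Set.Ioi 0) := by
  have hmeas : Measurable fun t : ℝ => ((t ^ a : ℝ) : ℂ) * M t := by
    have := hM.measurable
    fun_prop
  rw [← Set.Ioc_union_Ioi_eq_Ioi zero_le_one]
  refine IntegrableOn.union ?_ ?_
  · have h1 : IntegrableOn (fun t : ℝ => C * t ^ (a + k)) (Set.Ioc 0 1) := by
      refine Integrable.const_mul ?_ C
      have := intervalIntegral.intervalIntegrable_rpow' (a := 0) (b := 1) (r := a + k) (by linarith)
      rwa [intervalIntegrable_iff_integrableOn_Ioc_of_le zero_le_one] at this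
    refine Integrable.mono' h1 hmeas.aestronglyMeasurable ?_
    filter_upwards [ae_restrict_mem measurableSet_Ioc] with t ht
    rw [norm_mul, Complex.norm_real, Real.norm_of_nonneg (Real.rpow_nonneg ht.1.le _),
      Real.rpow_add ht.1, Real.rpow_natCast]
    have := mul_le_mul_of_nonneg_left (h0 t ht.1.le) (Real.rpow_nonneg ht.1.le a)
    linarith
  · have h1 : IntegrableOn (fun t : ℝ => C * t ^ a) (Set.Ioi 1) :=
      (integrableOn_Ioi_rpow_of_lt ha zero_lt_one).const_mul C
    refine Integrable.mono' h1 hmeas.aestronglyMeasurable ?_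
    filter_upwards [ae_restrict_mem measurableSet_Ioi] with t ht
    have ht0 : (0 : ℝ) < t := zero_lt_one.trans ht
    rw [norm_mul, Complex.norm_real, Real.norm_of_nonneg (Real.rpow_nonneg ht0.le _)]
    have := mul_le_mul_of_nonneg_left (hb t ht0.le) (Real.rpow_nonneg ht0.le a)
    linarith

/-- Integration by parts, twice, on the half-line against a power. -/
theorem integral_rpow_mul_second_deriv {s : ℝ} (k : ℕ) (hk : -1 - k < s) (hs : s < 0)
    {M M' M'' : ℝ → ℂ} (h1 : ∀ t, HasDerivAt M (M' t) t) (h2 : ∀ t, HasDerivAt M' (M'' t) t)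
    {C : ℝ} (hM0 : ∀ t, 0 ≤ t → ‖M t‖ ≤ C * t ^ (k + 1)) (hMb : ∀ t, 0 ≤ t → ‖M t‖ ≤ C)
    (hM'0 : ∀ t, 0 ≤ t → ‖M' t‖ ≤ C * t ^ k)
    (hM'e : ∀ t, 0 ≤ t → ‖M' t‖ ≤ C * Real.exp (-t))
    (hint : IntegrableOn (fun t : ℝ => ((t ^ (s + 1) : ℝ) : ℂ) * M'' t) (Set.Ioi 0)) :
    ∫ t in Set.Ioi (0 : ℝ), ((t ^ (s + 1) : ℝ) : ℂ) * M'' t =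
      ((s + 1) * s : ℝ) * ∫ t in Set.Ioi (0 : ℝ), ((t ^ (s - 1) : ℝ) : ℂ) * M t := by
  have hMc : Continuous M := continuous_iff_continuousAt.mpr fun t => (h1 t).continuousAt
  have hint2 : IntegrableOn (fun t : ℝ => ((t ^ (s - 1) : ℝ) : ℂ) * M t) (Set.Ioi 0) :=
    integrableOn_rpow_mul_of_bound (k + 1) (by push_cast; linarith) (by linarith) hMc hM0 hMb
  -- The two boundary terms of the successive integrations by parts, taken together: the terms with
  -- `M'` cancel in the derivative of `f`, so a single use of the fundamental theorem suffices. Near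
  -- `0` both terms are of order `t ^ (s + 1 + k)`, a positive power; at infinity `M'` decays
  -- exponentially and `t ^ s → 0`.
  let f : ℝ → ℂ := fun t => ((t ^ (s + 1) : ℝ) : ℂ) * M' t - ((s + 1) * t ^ s : ℝ) * M t
  have hf0 : f 0 = 0 := by
    have hM00 : M 0 = 0 := by simpa using hM0 0 le_rfl
    simp only [f, hM00, mul_zero, sub_zero]
    -- For `k = 0` the bound on `M'` does not make it vanish at `0`; then `s + 1 > 0` and the power
    -- itself vanishes.
    rcases Nat.eq_zero_or_pos k with rfl | hk'
    · rw [Real.zero_rpow (by norm_num at hk; linarith)]; simp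
    · have : M' 0 = 0 := by simpa [hk'.ne'] using hM'0 0 le_rfl
      simp [this]
  have hbound : ∀ t, 0 < t → ∀ A B, ‖M' t‖ ≤ A → ‖M t‖ ≤ B →
      ‖f t‖ ≤ t ^ (s + 1) * A + |s + 1| * (t ^ s * B) := by
    intro t ht A B hA hB
    refine (norm_sub_le _ _).trans ?_
    rw [norm_mul, norm_mul, Complex.norm_real, Complex.norm_real, Real.norm_eq_abs,
      Real.norm_eq_abs, abs_mul, abs_of_nonneg (Real.rpow_nonneg ht.le _),
      abs_of_nonneg (Real.rpow_nonneg ht.le _), mul_assoc]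
    have := Real.rpow_nonneg ht.le s
    have := Real.rpow_nonneg ht.le (s + 1)
    gcongr
  have hsplit : ∀ t, 0 < t → t ^ (s + 1) * (C * t ^ k) + |s + 1| * (t ^ s * (C * t ^ (k + 1))) =
      (C + |s + 1| * C) * t ^ (s + 1 + k) := by
    intro t ht
    rw [Real.rpow_add ht (s + 1), Real.rpow_add ht s 1, Real.rpow_natCast, Real.rpow_one]
    ring
  have hcont : ContinuousWithinAt f (Set.Ici 0) 0 := by
    rw [ContinuousWithinAt, hf0]
    refine squeeze_zero_norm' (a := fun t => (C + |s + 1| * C) * t ^ (s + 1 + k)) ?_ ?_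
    · filter_upwards [self_mem_nhdsWithin] with t ht
      rcases (Set.mem_Ici.mp ht).eq_or_lt with rfl | ht
      · rw [hf0, Real.zero_rpow (by linarith)]; simp
      · exact (hbound t ht _ _ (hM'0 t ht.le) (hM0 t ht.le)).trans (hsplit t ht).le
    · have : Continuous fun t : ℝ => (C + |s + 1| * C) * t ^ (s + 1 + k) :=
        (Real.continuous_rpow_const (by linarith)).const_mul _
      have h := this.tendsto 0
      rw [Real.zero_rpow (by linarith), mul_zero] at h
      exact h.mono_left nhdsWithin_le_nhds
  have hderiv : ∀ t ∈ Set.Ioi (0 : ℝ), HasDerivAt f (((t ^ (s + 1) : ℝ) : ℂ) * M'' t -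
      ((s + 1) * s : ℝ) * (((t ^ (s - 1) : ℝ) : ℂ) * M t)) t := by
    intro t ht
    have ht0 : t ≠ 0 := (Set.mem_Ioi.mp ht).ne'
    have e1 := (Real.hasDerivAt_rpow_const (p := s + 1) (Or.inl ht0)).ofReal_comp
    have e2 := ((Real.hasDerivAt_rpow_const (p := s) (Or.inl ht0)).const_mul (s + 1)).ofReal_comp
    refine ((e1.mul (h2 t)).sub (e2.mul (h1 t))).congr_deriv ?_
    rw [show s + 1 - 1 = s by ring]
    push_cast
    ring
  have hinf : Tendsto f atTop (𝓝 0) := by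
    refine squeeze_zero_norm'
      (a := fun t => t ^ (s + 1) * (C * Real.exp (-t)) + |s + 1| * (t ^ s * C)) ?_ ?_
    · filter_upwards [eventually_gt_atTop 0] with t ht
      exact hbound t ht _ _ (hM'e t ht.le) (hMb t ht.le)
    · have a1 : Tendsto (fun t : ℝ => t ^ (s + 1) * Real.exp (-t)) atTop (𝓝 0) := by
        simpa using tendsto_rpow_mul_exp_neg_mul_atTop_nhds_zero (s + 1) 1 one_pos
      have a2 : Tendsto (fun t : ℝ => t ^ s) atTop (𝓝 0) := by
        simpa using tendsto_rpow_neg_atTop (y := -s) (by linarith)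
      have := (a1.mul_const C).add ((a2.mul_const C).const_mul |s + 1|)
      simp only [zero_mul, mul_zero, add_zero] at this
      refine this.congr fun t => by ring
  have hmain := integral_Ioi_of_hasDerivAt_of_tendsto hcont hderiv
    (hint.sub (hint2.const_mul _)) hinf
  rw [integral_sub hint (hint2.const_mul _), integral_const_mul, hf0, sub_zero] at hmain
  exact sub_eq_zero.mp hmain

/-! ### The cut plane and the geometric kernel. -/

theorem one_sub_mul_ne_zero {z : ℂ} (hz : z ∈ cutPlane) {x : ℝ} (hx : 0 ≤ x) :
    1 - z * (x : ℂ) ≠ 0 := by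
  intro h0
  have hre := congrArg Complex.re h0
  have him := congrArg Complex.im h0
  simp at hre him
  rcases hz with hz | hz
  · nlinarith
  · rcases him with h | h
    · exact hz h
    · simp [h] at hre

theorem ne_zero_of_mem_cutPlane {z : ℂ} (hz : z ∈ cutPlane) : z ≠ 0 := by
  rintro rfl
  simp [cutPlane] at hz

theorem inv_mem_cutPlane {z : ℂ} (hz : z ∈ cutPlane) : z⁻¹ ∈ cutPlane := by
  have hn : 0 < Complex.normSq z := Complex.normSq_pos.mpr (ne_zero_of_mem_cutPlane hz)
  rcases hz with h | h
  · left
    rw [Complex.inv_re]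
    exact div_neg_of_neg_of_pos h hn
  · right
    rw [Complex.inv_im]
    exact div_ne_zero (neg_ne_zero.mpr h) hn.ne'

theorem isOpen_cutPlane : IsOpen cutPlane :=
  (isOpen_lt Complex.continuous_re continuous_const).union
    (isOpen_ne_fun Complex.continuous_im continuous_const)

theorem exists_pos_le_norm_one_sub_mul {z : ℂ} (hz : z ∈ cutPlane) :
    ∃ c > 0, ∀ x ∈ Set.Icc (0 : ℝ) 1, c ≤ ‖1 - z * (x : ℂ)‖ := by
  have hcont : ContinuousOn (fun x : ℝ => ‖1 - z * (x : ℂ)‖) (Set.Icc 0 1) := by fun_prop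
  obtain ⟨x, hx, hmin⟩ := isCompact_Icc.exists_isMinOn ⟨(0 : ℝ), by simp⟩ hcont
  exact ⟨_, norm_pos_iff.mpr (one_sub_mul_ne_zero hz hx.1), fun y hy => hmin hy⟩

/-- `∑_{k ≥ 1} zᵏ e⁻ᵏᵗ`. -/
noncomputable def geom (z : ℂ) (t : ℝ) : ℂ := z * Real.exp (-t) / (1 - z * Real.exp (-t))

noncomputable def geom' (z : ℂ) (t : ℝ) : ℂ := -(z * Real.exp (-t) / (1 - z * Real.exp (-t)) ^ 2)

noncomputable def geom'' (z : ℂ) (t : ℝ) : ℂ :=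
  (z * (Real.exp (-t) : ℂ)) * (1 + z * (Real.exp (-t) : ℂ)) / (1 - z * (Real.exp (-t) : ℂ)) ^ 3

theorem hasDerivAt_mul_exp_neg (z : ℂ) (t : ℝ) :
    HasDerivAt (fun t : ℝ => z * (Real.exp (-t) : ℂ)) (-(z * (Real.exp (-t) : ℂ))) t := by
  have h := ((Real.hasDerivAt_exp (-t)).comp t (hasDerivAt_neg t)).ofReal_comp.const_mul z
  refine h.congr_deriv ?_
  push_cast
  ring

theorem hasDerivAt_geom {z : ℂ} (hz : z ∈ cutPlane) (t : ℝ) :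
    HasDerivAt (geom z) (geom' z t) t := by
  have h := hasDerivAt_mul_exp_neg z t
  have hn := one_sub_mul_ne_zero hz (Real.exp_pos (-t)).le
  refine (h.div (h.const_sub 1) hn).congr_deriv ?_
  rw [geom']
  field_simp
  ring

theorem hasDerivAt_geom' {z : ℂ} (hz : z ∈ cutPlane) (t : ℝ) :
    HasDerivAt (geom' z) (geom'' z t) t := by
  have h := hasDerivAt_mul_exp_neg z t
  have hn := one_sub_mul_ne_zero hz (Real.exp_pos (-t)).le
  refine ((h.div ((h.const_sub 1).pow 2) (pow_ne_zero 2 hn)).neg).congr_deriv ?_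
  rw [geom'']
  simp only [Pi.pow_apply]
  field_simp
  push_cast
  ring

theorem exists_geom_bounds {z : ℂ} (hz : z ∈ cutPlane) : ∃ C, 0 ≤ C ∧ ∀ t, 0 ≤ t →
    ‖geom z t‖ ≤ C * Real.exp (-t) ∧ ‖geom' z t‖ ≤ C * Real.exp (-t) ∧
      ‖geom'' z t‖ ≤ C * Real.exp (-t) := by
  obtain ⟨c, hc, hcb⟩ := exists_pos_le_norm_one_sub_mul hz
  set A := ‖z‖ with hA
  have hA0 : 0 ≤ A := norm_nonneg z
  refine ⟨A / c + A / c ^ 2 + A * (1 + A) / c ^ 3, by positivity, fun t ht => ?_⟩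
  have he0 := (Real.exp_pos (-t)).le
  have he1 : Real.exp (-t) ≤ 1 := Real.exp_le_one_iff.mpr (by linarith)
  have hcz := hcb _ ⟨he0, he1⟩
  have e1 : ‖z * (Real.exp (-t) : ℂ)‖ = A * Real.exp (-t) := by
    rw [norm_mul, Complex.norm_real, Real.norm_of_nonneg he0]
  have e2 : ‖1 + z * (Real.exp (-t) : ℂ)‖ ≤ 1 + A := by
    refine (norm_add_le _ _).trans ?_
    rw [e1, norm_one]
    nlinarith
  have b1 : ‖geom z t‖ ≤ A / c * Real.exp (-t) := by
    rw [geom, norm_div, e1, div_mul_eq_mul_div]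
    gcongr
  have b2 : ‖geom' z t‖ ≤ A / c ^ 2 * Real.exp (-t) := by
    rw [geom', norm_neg, norm_div, e1, norm_pow, div_mul_eq_mul_div]
    gcongr
  have b3 : ‖geom'' z t‖ ≤ A * (1 + A) / c ^ 3 * Real.exp (-t) := by
    rw [geom'', norm_div, norm_mul, e1, norm_pow, div_mul_eq_mul_div, mul_right_comm]
    gcongr
  have p1 : 0 ≤ A / c * Real.exp (-t) := by positivity
  have p2 : 0 ≤ A / c ^ 2 * Real.exp (-t) := by positivity
  have p3 : 0 ≤ A * (1 + A) / c ^ 3 * Real.exp (-t) := by positivity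
  rw [add_mul, add_mul]
  exact ⟨by linarith, by linarith, by linarith⟩

theorem integrableOn_rpow_mul_geom'' {s : ℝ} (hs : -2 < s) {z : ℂ} (hz : z ∈ cutPlane) :
    IntegrableOn (fun t : ℝ => ((t ^ (s + 1) : ℝ) : ℂ) * geom'' z t) (Set.Ioi 0) := by
  obtain ⟨C, -, hC⟩ := exists_geom_bounds hz
  have hm : Measurable fun t : ℝ => ((t ^ (s + 1) : ℝ) : ℂ) * geom'' z t := by
    unfold geom''
    fun_prop
  refine Integrable.mono' ((integrableOn_rpow_mul_exp_neg (a := s + 1) (by linarith)).const_mul C)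
    hm.aestronglyMeasurable ?_
  filter_upwards [ae_restrict_mem measurableSet_Ioi] with t ht
  have ht0 : (0 : ℝ) ≤ t := (Set.mem_Ioi.mp ht).le
  rw [norm_mul, Complex.norm_real, Real.norm_of_nonneg (Real.rpow_nonneg ht0 _)]
  have := mul_le_mul_of_nonneg_left (hC t ht0).2.2 (Real.rpow_nonneg ht0 (s + 1))
  linarith

/-! ### The variable `v` and the kernel in terms of it. -/

/-- The variable `v = z⁻¹ - 2 + z`, in which `fgnQ` is a function on the plane cut along `[0, ∞)`. -/
noncomputable def jouk (z : ℂ) : ℂ := z⁻¹ - 2 + z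

/-- The value of `jouk` at `eᵗ`. -/
noncomputable def yval (t : ℝ) : ℝ := 2 * Real.cosh t - 2

/-- For given `t`, the equation `jouk z = yval t` is quadratic in `z` with roots `e ^ t` and `e ^
(-t)`. Neither lies in the cut plane, which is why `jouk` maps the cut plane off `[0, ∞)`. -/
theorem yval_sub_jouk {z : ℂ} (hz : z ≠ 0) (t : ℝ) :
    (yval t : ℂ) - jouk z =
      Real.exp t * ((1 - z * Real.exp (-t)) * (1 - z⁻¹ * Real.exp (-t))) := by
  have h : (Real.exp t : ℂ) * Real.exp (-t) = 1 := by
    rw [← Complex.ofReal_mul, ← Real.exp_add]; simp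
  rw [yval, jouk, Real.cosh_eq]
  push_cast at h ⊢
  have hzz : z * z⁻¹ = 1 := mul_inv_cancel₀ hz
  linear_combination (z + z⁻¹) * h - (Complex.exp t * Complex.exp (-t) ^ 2) * hzz -
    Complex.exp (-t) * h

theorem yval_sub_jouk_ne_zero {z : ℂ} (hz : z ∈ cutPlane) (t : ℝ) :
    (yval t : ℂ) - jouk z ≠ 0 := by
  rw [yval_sub_jouk (ne_zero_of_mem_cutPlane hz)]
  refine mul_ne_zero (by exact_mod_cast (Real.exp_pos t).ne') (mul_ne_zero ?_ ?_)
  · exact one_sub_mul_ne_zero hz (Real.exp_pos _).le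
  · exact one_sub_mul_ne_zero (inv_mem_cutPlane hz) (Real.exp_pos _).le

/-- The sum is invariant under `z ↦ z⁻¹`, hence a function of `jouk z`. The numerator `2 sinh t` is
the derivative of `yval`; the constant `-1` is what the corrections `+ 1` and `+ (v - u)` later
compensate. -/
theorem geom_add_geom_inv {z : ℂ} (hz : z ∈ cutPlane) (t : ℝ) :
    geom z t + geom z⁻¹ t = -1 + 2 * Real.sinh t / ((yval t : ℂ) - jouk z) := by
  have hz0 := ne_zero_of_mem_cutPlane hz
  have h1 := one_sub_mul_ne_zero hz (Real.exp_pos (-t)).le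
  have h2 := one_sub_mul_ne_zero (inv_mem_cutPlane hz) (Real.exp_pos (-t)).le
  have h3 : (Real.exp t : ℂ) ≠ 0 := by exact_mod_cast (Real.exp_pos t).ne'
  have h : (Real.exp t : ℂ) * Real.exp (-t) = 1 := by
    rw [← Complex.ofReal_mul, ← Real.exp_add]; simp
  have hs : (2 : ℂ) * Real.sinh t = Real.exp t - Real.exp (-t) := by
    rw [Real.sinh_eq]; push_cast; ring
  have hzz : z * z⁻¹ = 1 := mul_inv_cancel₀ hz0
  rw [yval_sub_jouk hz0, geom, geom, hs]
  generalize (Real.exp t : ℂ) = E at *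
  generalize (Real.exp (-t) : ℂ) = e at *
  generalize z⁻¹ = w at *
  rw [div_add_div _ _ h1 h2, neg_add_eq_sub, eq_sub_iff_add_eq, div_add_one (mul_ne_zero h1 h2),
    div_eq_div_iff (mul_ne_zero h1 h2) (mul_ne_zero h3 (mul_ne_zero h1 h2))]
  linear_combination (E * (1 - z * e) * (1 - w * e)) * (-e^2 * hzz) + (1 - z * e) * (1 - w * e) * (-e) * h

theorem yval_eq_exp_mul (t : ℝ) : yval t = Real.exp t * (1 - Real.exp (-t)) ^ 2 := by
  have h : Real.exp t * Real.exp (-t) = 1 := by rw [← Real.exp_add]; simp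
  rw [yval, Real.cosh_eq]
  linear_combination (2 - Real.exp (-t)) * h

theorem yval_nonneg (t : ℝ) : 0 ≤ yval t := by
  rw [yval]
  linarith [Real.one_le_cosh t]

theorem yval_pos {t : ℝ} (ht : 0 < t) : 0 < yval t := by
  rw [yval]
  linarith [Real.one_lt_cosh.mpr ht.ne']

theorem one_sub_exp_neg_mem {t : ℝ} (ht : 0 ≤ t) :
    0 ≤ 1 - Real.exp (-t) ∧ 1 - Real.exp (-t) ≤ t ∧ 1 - Real.exp (-t) ≤ 1 := by
  have h1 := Real.add_one_le_exp (-t)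
  have h2 : Real.exp (-t) ≤ 1 := Real.exp_le_one_iff.mpr (by linarith)
  exact ⟨by linarith, by linarith, by linarith [Real.exp_pos (-t)]⟩

theorem two_mul_sinh_le {t : ℝ} (ht : 0 ≤ t) :
    2 * Real.sinh t ≤ Real.exp t * (2 * (1 - Real.exp (-t))) ∧ 2 * Real.sinh t ≤ Real.exp t := by
  have h : Real.exp t * Real.exp (-t) = 1 := by rw [← Real.exp_add]; simp
  rw [Real.sinh_eq]
  have h2 : 1 ≤ Real.exp t := Real.one_le_exp ht
  constructor <;> nlinarith [Real.exp_pos (-t), sq_nonneg (Real.exp t - 1)]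

theorem exists_exp_le_norm_yval_sub {z : ℂ} (hz : z ∈ cutPlane) :
    ∃ c > 0, ∀ t : ℝ, 0 ≤ t → c * Real.exp t ≤ ‖(yval t : ℂ) - jouk z‖ := by
  obtain ⟨c, hc, h⟩ := exists_pos_le_norm_one_sub_mul hz
  obtain ⟨c', hc', h'⟩ := exists_pos_le_norm_one_sub_mul (inv_mem_cutPlane hz)
  refine ⟨c * c', by positivity, fun t ht => ?_⟩
  have he : Real.exp (-t) ∈ Set.Icc (0 : ℝ) 1 :=
    ⟨(Real.exp_pos _).le, Real.exp_le_one_iff.mpr (by linarith)⟩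
  rw [yval_sub_jouk (ne_zero_of_mem_cutPlane hz), norm_mul, norm_mul, Complex.norm_real,
    Real.norm_of_nonneg (Real.exp_pos t).le, mul_comm]
  have := h _ he
  have := h' _ he
  gcongr

theorem continuous_yval : Continuous yval := by
  unfold yval
  fun_prop

/-- The kernel of the difference quotient of `fgnQ` in the variable `jouk`. -/
noncomputable def diffKernel (z w : ℂ) (t : ℝ) : ℂ :=
  ((2 * Real.sinh t * yval t : ℝ) : ℂ) / (((yval t : ℂ) - jouk z) * ((yval t : ℂ) - jouk w))

theorem continuous_diffKernel {z w : ℂ} (hz : z ∈ cutPlane) (hw : w ∈ cutPlane) :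
    Continuous (diffKernel z w) := by
  have := continuous_yval
  unfold diffKernel
  refine Continuous.div (by fun_prop) (by fun_prop) fun t => ?_
  exact mul_ne_zero (yval_sub_jouk_ne_zero hz t) (yval_sub_jouk_ne_zero hw t)

/-- The numerator is at most `e ^ (2t) (1 - e ^ (-t)) ^ 2` and the denominator at least a multiple
of `e ^ (2t)`; then `1 - e ^ (-t) ≤ min t 1`. -/
theorem exists_diffKernel_bound {z w : ℂ} (hz : z ∈ cutPlane) (hw : w ∈ cutPlane) :
    ∃ C, 0 ≤ C ∧ ∀ t, 0 ≤ t → ‖diffKernel z w t‖ ≤ C * t ^ 2 ∧ ‖diffKernel z w t‖ ≤ C := by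
  obtain ⟨c, hc, h⟩ := exists_exp_le_norm_yval_sub hz
  obtain ⟨c', hc', h'⟩ := exists_exp_le_norm_yval_sub hw
  refine ⟨1 / (c * c'), by positivity, fun t ht => ?_⟩
  have e := one_sub_exp_neg_mem ht
  have hs := (two_mul_sinh_le ht).2
  have hs0 := Real.sinh_nonneg_iff.mpr ht
  have hy := yval_nonneg t
  have hE := Real.exp_pos t
  have key : ‖diffKernel z w t‖ ≤ 1 / (c * c') * (1 - Real.exp (-t)) ^ 2 := by
    rw [diffKernel, norm_div, norm_mul, Complex.norm_real, Real.norm_of_nonneg (by positivity)]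
    calc 2 * Real.sinh t * yval t / (‖(yval t : ℂ) - jouk z‖ * ‖(yval t : ℂ) - jouk w‖)
        ≤ Real.exp t * (Real.exp t * (1 - Real.exp (-t)) ^ 2) /
          ((c * Real.exp t) * (c' * Real.exp t)) := by
          rw [yval_eq_exp_mul] at hy ⊢
          have := h t ht
          have := h' t ht
          rw [yval_eq_exp_mul] at *
          gcongr
      _ = _ := by field_simp
  have hp : 0 ≤ 1 / (c * c') := by positivity
  refine ⟨key.trans ?_, key.trans ?_⟩
  · have := e.1
    have := e.2.1
    gcongr
  · have : (1 - Real.exp (-t)) ^ 2 ≤ 1 := pow_le_one₀ e.1 e.2.2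
    nlinarith

/-- The two ends of the range of `d` appear here: second-order vanishing at `0` needs `d < 1/2`, and
boundedness at infinity needs `d > -1/2`. -/
theorem integrableOn_diffKernel {d : ℝ} (hd : -1 / 2 < d) (hd' : d < 1 / 2) {z w : ℂ}
    (hz : z ∈ cutPlane) (hw : w ∈ cutPlane) :
    IntegrableOn (fun t : ℝ => ((t ^ (-2 * d - 2) : ℝ) : ℂ) * diffKernel z w t) (Set.Ioi 0) := by
  obtain ⟨C, -, hC⟩ := exists_diffKernel_bound hz hw
  exact integrableOn_rpow_mul_of_bound 2 (by push_cast; linarith) (by linarith)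
    (continuous_diffKernel hz hw) (fun t ht => (hC t ht).1) fun t ht => (hC t ht).2

/-! ### Integral representations of `Q`. -/

theorem integrableOn_rpow_mul_geom''_add {s : ℝ} (hs : -2 < s) {z : ℂ} (hz : z ∈ cutPlane) :
    IntegrableOn (fun t : ℝ => ((t ^ (s + 1) : ℝ) : ℂ) * (geom'' z t + geom'' z⁻¹ t))
      (Set.Ioi 0) := by
  simp_rw [mul_add]
  exact (integrableOn_rpow_mul_geom'' hs hz).add
    (integrableOn_rpow_mul_geom'' hs (inv_mem_cutPlane hz))

theorem polylog_add_polylog_inv {s : ℝ} (hs : -2 < s) {z : ℂ} (hz : z ∈ cutPlane) :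
    polylog s z + polylog s z⁻¹ = ((Real.Gamma (s + 2) : ℝ) : ℂ)⁻¹ *
      ∫ t in Set.Ioi (0 : ℝ), ((t ^ (s + 1) : ℝ) : ℂ) * (geom'' z t + geom'' z⁻¹ t) := by
  simp_rw [mul_add]
  rw [integral_add (integrableOn_rpow_mul_geom'' hs hz)
    (integrableOn_rpow_mul_geom'' hs (inv_mem_cutPlane hz)), mul_add]
  rfl

/-- Since `jouk z = (1 - z)² / z`, both derivatives at `t = 0` equal `-1 / jouk z`. The value does
not depend on `z`, so it drops out of the difference for two points and gains one order of vanishing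
at `0`. -/
theorem jouk_mul_geom'_zero {z : ℂ} (hz : z ∈ cutPlane) :
    jouk z * (geom' z 0 + geom' z⁻¹ 0) = -2 := by
  have hz0 := ne_zero_of_mem_cutPlane hz
  have h1 := one_sub_mul_ne_zero hz zero_le_one
  have h2 := one_sub_mul_ne_zero (inv_mem_cutPlane hz) zero_le_one
  simp only [Complex.ofReal_one, mul_one] at h1 h2
  have h3 : z - 1 ≠ 0 := fun h => h1 (by linear_combination -h)
  simp only [geom', jouk, neg_zero, Real.exp_zero, Complex.ofReal_one, mul_one]
  field_simp
  rw [show (1 - z) ^ 2 = (z - 1) ^ 2 by ring]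
  field_simp
  ring

theorem norm_le_mul_of_hasDerivAt {M M' : ℝ → ℂ} (h : ∀ t, HasDerivAt M (M' t) t) (h0 : M 0 = 0)
    {C : ℝ} (hC : ∀ t, 0 ≤ t → ‖M' t‖ ≤ C) {t : ℝ} (ht : 0 ≤ t) : ‖M t‖ ≤ C * t := by
  have := (convex_Icc 0 t).norm_image_sub_le_of_norm_hasDerivWithin_le
    (fun x _ => (h x).hasDerivWithinAt) (fun x hx => hC x hx.1)
    (Set.left_mem_Icc.mpr ht) (Set.right_mem_Icc.mpr ht)
  simpa [h0, Real.norm_of_nonneg ht] using this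

/-- The constant in the integral representation of `fgnQ`; it has the sign of `d`. -/
noncomputable def fgnConst (d : ℝ) : ℝ :=
  2 * d * (2 * d + 1) / (4 * Real.pi * Real.Gamma (1 - 2 * d))

theorem fgnConst_pos {d : ℝ} (hd : 0 < d) (hd' : d < 1 / 2) : 0 < fgnConst d := by
  have := Real.Gamma_pos_of_pos (s := 1 - 2 * d) (by linarith)
  have := Real.pi_pos
  rw [fgnConst]
  positivity

theorem fgnConst_neg {d : ℝ} (hd : -1 / 2 < d) (hd' : d < 0) : fgnConst d < 0 := by
  have := Real.Gamma_pos_of_pos (s := 1 - 2 * d) (by linarith)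
  have := Real.pi_pos
  rw [fgnConst]
  exact div_neg_of_neg_of_pos (by nlinarith) (by positivity)

theorem fgnConst_ne_zero {d : ℝ} (hd : -1 / 2 < d) (hd' : d < 1 / 2) (hd0 : d ≠ 0) :
    fgnConst d ≠ 0 := by
  rcases hd0.lt_or_gt with h | h
  · exact (fgnConst_neg hd h).ne
  · exact (fgnConst_pos h hd').ne'

theorem fgnQ_eq_integral {d : ℝ} (hd' : d < 1 / 2) {z : ℂ} (hz : z ∈ cutPlane) :
    fgnQ d z = ((4 * Real.pi * Real.Gamma (1 - 2 * d) : ℝ) : ℂ)⁻¹ * (jouk z *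
      ∫ t in Set.Ioi (0 : ℝ), ((t ^ (-2 * d) : ℝ) : ℂ) * (geom'' z t + geom'' z⁻¹ t)) := by
  rw [fgnQ, polylog_add_polylog_inv (by linarith) hz, jouk,
    show -2 * d - 1 + 2 = 1 - 2 * d by ring, show -2 * d - 1 + 1 = -2 * d by ring]
  push_cast
  rw [mul_inv]
  ring

/-- Differences are needed because for `d ≥ 0` a single `Q(z)` cannot be integrated by parts twice:
its kernel vanishes only to first order at `0`, while `t ^ (-2d - 2) t` is not integrable there. In
the combination `M` below both `M` and `M'` vanish at `0`, and this suffices for all `d < 1/2`. -/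
theorem fgnQ_sub_fgnQ {d : ℝ} (hd : -1 / 2 < d) (hd' : d < 1 / 2) {z w : ℂ}
    (hz : z ∈ cutPlane) (hw : w ∈ cutPlane) :
    fgnQ d z - fgnQ d w = fgnConst d * ((jouk z - jouk w) *
      ∫ t in Set.Ioi (0 : ℝ), ((t ^ (-2 * d - 2) : ℝ) : ℂ) * diffKernel z w t) := by
  set v := jouk z with hv
  set u := jouk w with hu
  have hz' := inv_mem_cutPlane hz
  have hw' := inv_mem_cutPlane hw
  -- The constant `v - u` cancels the `-1` in `geom_add_geom_inv`. What remains is `2 sinh t (v / (y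
  -- - v) - u / (y - u))`, where `v / (y - v) - u / (y - u) = y (v - u) / ((y - v)(y - u))`.
  let M : ℝ → ℂ := fun t =>
    v * (geom z t + geom z⁻¹ t) - u * (geom w t + geom w⁻¹ t) + (v - u)
  let M' : ℝ → ℂ := fun t => v * (geom' z t + geom' z⁻¹ t) - u * (geom' w t + geom' w⁻¹ t)
  let M'' : ℝ → ℂ := fun t => v * (geom'' z t + geom'' z⁻¹ t) - u * (geom'' w t + geom'' w⁻¹ t)
  have hM : ∀ t, M t = (v - u) * diffKernel z w t := by
    intro t
    have n1 := yval_sub_jouk_ne_zero hz t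
    have n2 := yval_sub_jouk_ne_zero hw t
    simp only [M]
    rw [geom_add_geom_inv hz, geom_add_geom_inv hw, diffKernel, ← hv, ← hu]
    rw [← hv] at n1
    rw [← hu] at n2
    push_cast
    field_simp
    ring
  have h1 : ∀ t, HasDerivAt M (M' t) t := fun t =>
    ((((hasDerivAt_geom hz t).add (hasDerivAt_geom hz' t)).const_mul v).sub
      (((hasDerivAt_geom hw t).add (hasDerivAt_geom hw' t)).const_mul u)).add_const _
  have h2 : ∀ t, HasDerivAt M' (M'' t) t := fun t =>
    ((((hasDerivAt_geom' hz t).add (hasDerivAt_geom' hz' t)).const_mul v).sub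
      (((hasDerivAt_geom' hw t).add (hasDerivAt_geom' hw' t)).const_mul u))
  obtain ⟨C1, hC1, b1⟩ := exists_geom_bounds hz
  obtain ⟨C2, hC2, b2⟩ := exists_geom_bounds hz'
  obtain ⟨C3, hC3, b3⟩ := exists_geom_bounds hw
  obtain ⟨C4, hC4, b4⟩ := exists_geom_bounds hw'
  obtain ⟨C5, hC5, b5⟩ := exists_diffKernel_bound hz hw
  set A := ‖v‖ * (C1 + C2) + ‖u‖ * (C3 + C4) with hA
  have hA0 : 0 ≤ A := by positivity
  have comb : ∀ a b c e : ℂ, ∀ E : ℝ, ‖a‖ ≤ C1 * E → ‖b‖ ≤ C2 * E → ‖c‖ ≤ C3 * E → ‖e‖ ≤ C4 * E →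
      ‖v * (a + b) - u * (c + e)‖ ≤ A * E := by
    intro a b c e E ha hb hc he
    calc ‖v * (a + b) - u * (c + e)‖ ≤ ‖v‖ * (‖a‖ + ‖b‖) + ‖u‖ * (‖c‖ + ‖e‖) := by
          refine (norm_sub_le _ _).trans ?_
          rw [norm_mul, norm_mul]
          gcongr <;> exact norm_add_le _ _
      _ ≤ ‖v‖ * (C1 * E + C2 * E) + ‖u‖ * (C3 * E + C4 * E) := by gcongr
      _ = A * E := by rw [hA]; ring
  have hM'e : ∀ t, 0 ≤ t → ‖M' t‖ ≤ A * Real.exp (-t) := fun t ht =>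
    comb _ _ _ _ _ (b1 t ht).2.1 (b2 t ht).2.1 (b3 t ht).2.1 (b4 t ht).2.1
  have hM''e : ∀ t, 0 ≤ t → ‖M'' t‖ ≤ A * Real.exp (-t) := fun t ht =>
    comb _ _ _ _ _ (b1 t ht).2.2 (b2 t ht).2.2 (b3 t ht).2.2 (b4 t ht).2.2
  have hM'0 : ∀ t, 0 ≤ t → ‖M' t‖ ≤ A * t := by
    intro t ht
    refine norm_le_mul_of_hasDerivAt h2 ?_ (fun x hx => (hM''e x hx).trans ?_) ht
    · simp only [M']
      rw [jouk_mul_geom'_zero hz, jouk_mul_geom'_zero hw, sub_self]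
    · exact mul_le_of_le_one_right hA0 (Real.exp_le_one_iff.mpr (by linarith))
  have hint : ∀ x ∈ cutPlane, IntegrableOn (fun t : ℝ => ((t ^ (-2 * d) : ℝ) : ℂ) *
      (geom'' x t + geom'' x⁻¹ t)) (Set.Ioi 0) := by
    intro x hx
    have := integrableOn_rpow_mul_geom''_add (s := -2 * d - 1) (by linarith) hx
    rw [sub_add_cancel] at this
    exact this
  have hint'' : IntegrableOn (fun t : ℝ => ((t ^ (-2 * d - 1 + 1) : ℝ) : ℂ) * M'' t)
      (Set.Ioi 0) := by
    refine IntegrableOn.congr_fun (((hint z hz).const_mul v).sub ((hint w hw).const_mul u))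
      (fun t _ => ?_) measurableSet_Ioi
    simp only [M'', sub_add_cancel, Pi.sub_apply]
    ring
  set B := ‖v - u‖ * C5 with hB
  have hmain := integral_rpow_mul_second_deriv (s := -2 * d - 1) 1 (by push_cast; linarith)
    (by linarith) (C := max A B) h1 h2
    (fun t ht => by
      rw [hM, norm_mul]
      calc ‖v - u‖ * ‖diffKernel z w t‖ ≤ ‖v - u‖ * (C5 * t ^ 2) := by
            gcongr; exact (b5 t ht).1
        _ = B * t ^ 2 := by rw [hB]; ring
        _ ≤ _ := by gcongr; exact le_max_right _ _)
    (fun t ht => by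
      rw [hM, norm_mul]
      refine le_trans ?_ (le_max_right _ _)
      rw [hB]
      gcongr
      exact (b5 t ht).2)
    (fun t ht => by
      rw [pow_one]
      exact (hM'0 t ht).trans (by gcongr; exact le_max_left _ _))
    (fun t ht => (hM'e t ht).trans (by gcongr; exact le_max_left _ _)) hint''
  rw [fgnQ_eq_integral hd' hz, fgnQ_eq_integral hd' hw, ← hv, ← hu]
  have e1 : v * (∫ t in Set.Ioi (0 : ℝ), ((t ^ (-2 * d) : ℝ) : ℂ) *
      (geom'' z t + geom'' z⁻¹ t)) - u * (∫ t in Set.Ioi (0 : ℝ), ((t ^ (-2 * d) : ℝ) : ℂ) *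
      (geom'' w t + geom'' w⁻¹ t)) =
      ∫ t in Set.Ioi (0 : ℝ), ((t ^ (-2 * d - 1 + 1) : ℝ) : ℂ) * M'' t := by
    rw [← integral_const_mul, ← integral_const_mul, ← integral_sub
      ((hint z hz).const_mul v) ((hint w hw).const_mul u)]
    refine integral_congr_ae (Eventually.of_forall fun t => ?_)
    simp only [M'', sub_add_cancel]
    ring
  rw [← mul_sub, e1, hmain]
  simp_rw [hM]
  rw [show -2 * d - 1 - 1 = -2 * d - 2 by ring]
  have e2 : ∫ t in Set.Ioi (0 : ℝ), ((t ^ (-2 * d - 2) : ℝ) : ℂ) * ((v - u) * diffKernel z w t) =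
      (v - u) * ∫ t in Set.Ioi (0 : ℝ), ((t ^ (-2 * d - 2) : ℝ) : ℂ) * diffKernel z w t := by
    rw [← integral_const_mul]
    congr 1
    funext t
    ring
  rw [e2, fgnConst]
  push_cast
  ring

/-- For `d < 0` first-order vanishing of the kernel at `0` is enough (the case `k = 0` of the
integration by parts), so no reference point has to be subtracted and no additive constant is left
undetermined. -/
theorem fgnQ_eq_of_neg {d : ℝ} (hd : -1 / 2 < d) (hd0 : d < 0) {z : ℂ} (hz : z ∈ cutPlane) :
    fgnQ d z = fgnConst d * (jouk z * ∫ t in Set.Ioi (0 : ℝ), ((t ^ (-2 * d - 2) : ℝ) : ℂ) *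
      (2 * Real.sinh t / ((yval t : ℂ) - jouk z))) ∧
    IntegrableOn (fun t : ℝ => ((t ^ (-2 * d - 2) : ℝ) : ℂ) *
      (2 * Real.sinh t / ((yval t : ℂ) - jouk z))) (Set.Ioi 0) := by
  have hz' := inv_mem_cutPlane hz
  let M : ℝ → ℂ := fun t => 2 * Real.sinh t / ((yval t : ℂ) - jouk z)
  have hM : M = fun t => geom z t + geom z⁻¹ t + 1 := by
    funext t
    rw [geom_add_geom_inv hz]
    simp [M]
  have h1 : ∀ t, HasDerivAt M (geom' z t + geom' z⁻¹ t) t := by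
    intro t
    rw [hM]
    exact ((hasDerivAt_geom hz t).add (hasDerivAt_geom hz' t)).add_const _
  have h2 : ∀ t, HasDerivAt (fun t => geom' z t + geom' z⁻¹ t) (geom'' z t + geom'' z⁻¹ t) t :=
    fun t => (hasDerivAt_geom' hz t).add (hasDerivAt_geom' hz' t)
  obtain ⟨C1, hC1, b1⟩ := exists_geom_bounds hz
  obtain ⟨C2, hC2, b2⟩ := exists_geom_bounds hz'
  have hM'e : ∀ t, 0 ≤ t → ‖geom' z t + geom' z⁻¹ t‖ ≤ (C1 + C2 + 1) * Real.exp (-t) := by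
    intro t ht
    have := norm_add_le (geom' z t) (geom' z⁻¹ t)
    have := (b1 t ht).2.1
    have := (b2 t ht).2.1
    nlinarith [Real.exp_pos (-t)]
  have hle : ∀ t : ℝ, 0 ≤ t → Real.exp (-t) ≤ 1 := fun t ht =>
    Real.exp_le_one_iff.mpr (by linarith)
  have hM'1 : ∀ t, 0 ≤ t → ‖geom' z t + geom' z⁻¹ t‖ ≤ C1 + C2 + 1 := fun t ht =>
    (hM'e t ht).trans (mul_le_of_le_one_right (by positivity) (hle t ht))
  have hM0 : ∀ t, 0 ≤ t → ‖M t‖ ≤ (C1 + C2 + 1) * t := fun t ht =>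
    norm_le_mul_of_hasDerivAt h1 (by simp [M]) hM'1 ht
  have hMb : ∀ t, 0 ≤ t → ‖M t‖ ≤ C1 + C2 + 1 := by
    intro t ht
    rw [hM]
    refine (norm_add₃_le).trans ?_
    have := (b1 t ht).1
    have := (b2 t ht).1
    rw [norm_one]
    nlinarith [hle t ht]
  have hMc : Continuous M := continuous_iff_continuousAt.mpr fun t => (h1 t).continuousAt
  have hint := integrableOn_rpow_mul_geom''_add (s := -2 * d - 1) (by linarith) hz
  have hmain := integral_rpow_mul_second_deriv (s := -2 * d - 1) 0 (by push_cast; linarith)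
    (by linarith) h1 h2 (by simpa using hM0) hMb (by simpa using hM'1) hM'e hint
  rw [sub_add_cancel] at hmain
  rw [show -2 * d - 1 - 1 = -2 * d - 2 by ring] at hmain
  constructor
  · rw [fgnQ_eq_integral (by linarith) hz, hmain, fgnConst]
    push_cast
    simp only [M]
    push_cast
    ring
  · exact integrableOn_rpow_mul_of_bound 1 (by push_cast; linarith) (by linarith) hMc
      (fun t ht => by rw [pow_one]; exact hM0 t ht) hMb

/-! ### `Q` as a Pick function of `v`: imaginary part and growth. -/

theorem setIntegral_Ioi_pos {f : ℝ → ℝ} (hf : IntegrableOn f (Set.Ioi 0))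
    (hpos : ∀ t, 0 < t → 0 < f t) : 0 < ∫ t in Set.Ioi (0 : ℝ), f t := by
  rw [setIntegral_pos_iff_support_of_nonneg_ae _ hf]
  · have : Set.Ioi (0 : ℝ) ⊆ Function.support f ∩ Set.Ioi 0 :=
      fun t ht => ⟨(hpos t ht).ne', ht⟩
    refine lt_of_lt_of_le ?_ (measure_mono this)
    simp
  · filter_upwards [ae_restrict_mem measurableSet_Ioi] with t ht
    exact (hpos t ht).le

theorem conj_mem_cutPlane {z : ℂ} (hz : z ∈ cutPlane) : conj z ∈ cutPlane := by
  simpa [cutPlane] using hz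

theorem jouk_conj (z : ℂ) : jouk (conj z) = conj (jouk z) := by
  simp [jouk, map_ofNat (starRingEnd ℂ) 2]

theorem polylog_conj (s : ℝ) (z : ℂ) : polylog s (conj z) = conj (polylog s z) := by
  rw [polylog, polylog, map_mul, ← integral_conj, ← Complex.ofReal_inv, Complex.conj_ofReal]
  simp only [map_mul, map_div₀, map_add, map_sub, map_pow, map_one, Complex.conj_ofReal]

theorem fgnQ_conj (d : ℝ) (z : ℂ) : fgnQ d (conj z) = conj (fgnQ d z) := by
  have h2 := map_ofNat (starRingEnd ℂ) 2
  have h4 := map_ofNat (starRingEnd ℂ) 4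
  rw [fgnQ, fgnQ, ← map_inv₀, polylog_conj, polylog_conj]
  simp only [map_mul, map_div₀, map_add, map_sub, map_one, Complex.conj_ofReal, map_inv₀, h2, h4]

theorem neg_one_mem_cutPlane : (-1 : ℂ) ∈ cutPlane := by
  left; simp

theorem jouk_neg_one : jouk (-1) = ((-4 : ℝ) : ℂ) := by
  norm_num [jouk]

/-- The positive weight in the integral representations. -/
noncomputable def fgnWeight (d t : ℝ) : ℝ := t ^ (-2 * d - 2) * (2 * Real.sinh t * yval t)

theorem fgnWeight_pos (d : ℝ) {t : ℝ} (ht : 0 < t) : 0 < fgnWeight d t := by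
  have := Real.rpow_pos_of_pos ht (-2 * d - 2)
  have := Real.sinh_pos_iff.mpr ht
  have := yval_pos ht
  rw [fgnWeight]
  positivity

theorem rpow_mul_diffKernel (d : ℝ) (z w : ℂ) (t : ℝ) :
    ((t ^ (-2 * d - 2) : ℝ) : ℂ) * diffKernel z w t =
      fgnWeight d t / (((yval t : ℂ) - jouk z) * ((yval t : ℂ) - jouk w)) := by
  rw [fgnWeight, diffKernel]
  push_cast
  ring

section
variable {d : ℝ} (hd : -1 / 2 < d) (hd' : d < 1 / 2)
include hd hd'

theorem integrableOn_weight_div_real {z w : ℂ} (hz : z ∈ cutPlane) (hw : w ∈ cutPlane) {x u : ℝ}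
    (hx : jouk z = x) (hu : jouk w = u) :
    IntegrableOn (fun t => fgnWeight d t / ((yval t - x) * (yval t - u))) (Set.Ioi 0) := by
  have h := (integrableOn_diffKernel hd hd' hz hw).re
  refine IntegrableOn.congr_fun h (fun t _ => ?_) measurableSet_Ioi
  simp only [rpow_mul_diffKernel, hx, hu]
  norm_cast

theorem fgnQ_sub_fgnQ_real {z w : ℂ} (hz : z ∈ cutPlane) (hw : w ∈ cutPlane) {x u : ℝ}
    (hx : jouk z = x) (hu : jouk w = u) :
    fgnQ d z - fgnQ d w = ((fgnConst d * ((x - u) *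
      ∫ t in Set.Ioi (0 : ℝ), fgnWeight d t / ((yval t - x) * (yval t - u))) : ℝ) : ℂ) := by
  rw [fgnQ_sub_fgnQ hd hd' hz hw, hx, hu]
  push_cast
  rw [← integral_complex_ofReal]
  simp_rw [rpow_mul_diffKernel, hx, hu]
  norm_cast

theorem integrableOn_weight_div_normSq {z : ℂ} (hz : z ∈ cutPlane) :
    IntegrableOn (fun t => fgnWeight d t / ‖(yval t : ℂ) - jouk z‖ ^ 2) (Set.Ioi 0) := by
  have h := (integrableOn_diffKernel hd hd' hz (conj_mem_cutPlane hz)).norm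
  refine IntegrableOn.congr_fun h (fun t ht => ?_) measurableSet_Ioi
  have e : (yval t : ℂ) - conj (jouk z) = conj ((yval t : ℂ) - jouk z) := by simp
  simp only [rpow_mul_diffKernel, jouk_conj, e]
  rw [norm_div, norm_mul, RCLike.norm_conj, Complex.norm_real,
    Real.norm_of_nonneg (fgnWeight_pos d ht).le, sq]

/-- The difference formula with `w = conj z`: the left side is `2i Im Q(z)`, and the product of the
two denominators becomes a squared modulus. Since the weight is positive, `Im Q` has the sign of
`fgnConst d * Im v`. -/
theorem im_fgnQ {z : ℂ} (hz : z ∈ cutPlane) : (fgnQ d z).im = fgnConst d * ((jouk z).im *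
    ∫ t in Set.Ioi (0 : ℝ), fgnWeight d t / ‖(yval t : ℂ) - jouk z‖ ^ 2) := by
  have h := fgnQ_sub_fgnQ hd hd' hz (conj_mem_cutPlane hz)
  rw [fgnQ_conj, jouk_conj, Complex.sub_conj, Complex.sub_conj] at h
  have e : ∫ t in Set.Ioi (0 : ℝ), ((t ^ (-2 * d - 2) : ℝ) : ℂ) * diffKernel z (conj z) t =
      ((∫ t in Set.Ioi (0 : ℝ), fgnWeight d t / ‖(yval t : ℂ) - jouk z‖ ^ 2 : ℝ) : ℂ) := by
    rw [← integral_complex_ofReal]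
    congr 1
    funext t
    have e : (yval t : ℂ) - conj (jouk z) = conj ((yval t : ℂ) - jouk z) := by simp
    rw [rpow_mul_diffKernel, jouk_conj, e, Complex.mul_conj, Complex.normSq_eq_norm_sq]
    norm_cast
  rw [e] at h
  have := congrArg Complex.im h
  simp only [Complex.mul_im, Complex.ofReal_re, Complex.ofReal_im, Complex.I_re, Complex.I_im,
    Complex.mul_re] at this
  linarith

theorem weight_integral_pos :
    0 < ∫ t in Set.Ioi (0 : ℝ), fgnWeight d t / (yval t + 4) ^ 2 := by
  refine setIntegral_Ioi_pos ?_ fun t ht => ?_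
  · have := integrableOn_weight_div_real hd hd' neg_one_mem_cutPlane neg_one_mem_cutPlane
      jouk_neg_one jouk_neg_one
    simpa [sq] using this
  · have := fgnWeight_pos d ht
    have := yval_pos ht
    positivity

theorem integrableOn_weight : IntegrableOn (fun t => fgnWeight d t / (yval t + 4) ^ 2)
    (Set.Ioi 0) := by
  have := integrableOn_weight_div_real hd hd' neg_one_mem_cutPlane neg_one_mem_cutPlane
    jouk_neg_one jouk_neg_one
  simpa [sq] using this

omit hd hd' in
-- The reference point is `z = -1`, where `jouk` is `-4` and the denominator is `yval t + 4`. This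
-- inequality and the next compare `|y - v|` with `y + 4` uniformly in `t`, so that all integrals
-- are controlled by the single integral of `fgnWeight d t / (yval t + 4) ^ 2`.
theorem norm_yval_sub_le (z : ℂ) (t : ℝ) :
    ‖(yval t : ℂ) - jouk z‖ ≤ (yval t + 4) * (1 + ‖jouk z + 4‖ / 4) := by
  have hy := yval_nonneg t
  have h : ‖(yval t : ℂ) - jouk z‖ ≤ (yval t + 4) + ‖jouk z + 4‖ := by
    have : (yval t : ℂ) - jouk z = ((yval t + 4 : ℝ) : ℂ) - (jouk z + 4) := by push_cast; ring
    rw [this]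
    refine (norm_sub_le _ _).trans ?_
    rw [Complex.norm_real, Real.norm_of_nonneg (by linarith)]
  have := norm_nonneg (jouk z + 4)
  nlinarith

omit hd hd' in
theorem yval_add_four_le {z : ℂ} (hz : (jouk z).im ≠ 0) (t : ℝ) :
    yval t + 4 ≤ ‖(yval t : ℂ) - jouk z‖ * (1 + ‖jouk z + 4‖ / |(jouk z).im|) := by
  have h : yval t + 4 ≤ ‖(yval t : ℂ) - jouk z‖ + ‖jouk z + 4‖ := by
    have : ((yval t + 4 : ℝ) : ℂ) = ((yval t : ℂ) - jouk z) + (jouk z + 4) := by push_cast; ring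
    have h2 := norm_add_le ((yval t : ℂ) - jouk z) (jouk z + 4)
    rw [← this, Complex.norm_real] at h2
    exact (le_abs_self _).trans h2
  have hpos : 0 < |(jouk z).im| := abs_pos.mpr hz
  have him : |(jouk z).im| ≤ ‖(yval t : ℂ) - jouk z‖ := by
    have := Complex.abs_im_le_norm ((yval t : ℂ) - jouk z)
    simpa using this
  have : ‖jouk z + 4‖ ≤ ‖(yval t : ℂ) - jouk z‖ * (‖jouk z + 4‖ / |(jouk z).im|) := by
    calc ‖jouk z + 4‖ = |(jouk z).im| * (‖jouk z + 4‖ / |(jouk z).im|) := by field_simp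
      _ ≤ _ := by gcongr
  linarith

theorem le_weight_integral {z : ℂ} (hz : z ∈ cutPlane) :
    (∫ t in Set.Ioi (0 : ℝ), fgnWeight d t / (yval t + 4) ^ 2) / (1 + ‖jouk z + 4‖ / 4) ^ 2 ≤
      ∫ t in Set.Ioi (0 : ℝ), fgnWeight d t / ‖(yval t : ℂ) - jouk z‖ ^ 2 := by
  rw [← integral_div]
  refine setIntegral_mono_on ((integrableOn_weight hd hd').div_const _)
    (integrableOn_weight_div_normSq hd hd' hz) measurableSet_Ioi fun t ht => ?_
  have := (fgnWeight_pos d ht).le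
  rw [div_div, ← mul_pow]
  have h1 := norm_yval_sub_le z t
  have h2 := norm_pos_iff.mpr (yval_sub_jouk_ne_zero hz t)
  gcongr

theorem le_abs_im_fgnQ {z : ℂ} (hz : z ∈ cutPlane) :
    |fgnConst d| * (|(jouk z).im| * ((∫ t in Set.Ioi (0 : ℝ), fgnWeight d t / (yval t + 4) ^ 2) /
      (1 + ‖jouk z + 4‖ / 4) ^ 2)) ≤ |(fgnQ d z).im| := by
  rw [im_fgnQ hd hd' hz, abs_mul, abs_mul]
  have := le_weight_integral hd hd' hz
  gcongr
  exact this.trans (le_abs_self _)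

theorem norm_fgnQ_le {z : ℂ} (hz : z ∈ cutPlane) (him : (jouk z).im ≠ 0) :
    ‖fgnQ d z‖ ≤ ‖fgnQ d (-1)‖ + |fgnConst d| * (‖jouk z + 4‖ *
      ((1 + ‖jouk z + 4‖ / |(jouk z).im|) *
        ∫ t in Set.Ioi (0 : ℝ), fgnWeight d t / (yval t + 4) ^ 2)) := by
  have h := fgnQ_sub_fgnQ hd hd' hz neg_one_mem_cutPlane
  have e : fgnQ d z = fgnQ d (-1) + (fgnQ d z - fgnQ d (-1)) := by ring
  rw [e]
  refine (norm_add_le _ _).trans (add_le_add_right ?_ _)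
  rw [h, norm_mul, norm_mul, Complex.norm_real, Real.norm_eq_abs, jouk_neg_one]
  have e2 : jouk z - ((-4 : ℝ) : ℂ) = jouk z + 4 := by push_cast; ring
  rw [e2]
  gcongr
  rw [← integral_const_mul]
  refine norm_integral_le_of_norm_le ((integrableOn_weight hd hd').const_mul _) ?_
  filter_upwards [ae_restrict_mem measurableSet_Ioi] with t ht
  have hw := (fgnWeight_pos d ht).le
  have hy := yval_nonneg t
  have hn := norm_pos_iff.mpr (yval_sub_jouk_ne_zero hz t)
  have h4 : ‖(yval t : ℂ) - jouk (-1)‖ = yval t + 4 := by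
    rw [jouk_neg_one, ← Complex.ofReal_sub, Complex.norm_real, Real.norm_of_nonneg] <;> linarith
  rw [rpow_mul_diffKernel, norm_div, norm_mul, h4, Complex.norm_real, Real.norm_of_nonneg hw]
  have := yval_add_four_le him t
  rw [mul_div_assoc', div_le_div_iff₀ (by positivity) (by positivity)]
  have hp : 0 ≤ fgnWeight d t * (yval t + 4) := by positivity
  nlinarith [mul_le_mul_of_nonneg_left this hp]

theorem im_fgnQ_mul_pos {z : ℂ} (hz : z ∈ cutPlane) :
    ∃ E > 0, (fgnQ d z).im = fgnConst d * ((jouk z).im * E) := by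
  refine ⟨_, ?_, im_fgnQ hd hd' hz⟩
  have h1 := weight_integral_pos hd hd'
  have h2 := le_weight_integral hd hd' hz
  have h3 := norm_nonneg (jouk z + 4)
  refine lt_of_lt_of_le ?_ h2
  positivity

omit hd hd' in
-- Every real `x ≥ 0` is a value of `yval`, and `jouk` omits those on the cut plane.
theorem jouk_neg_of_real {z : ℂ} (hz : z ∈ cutPlane) {x : ℝ} (hx : jouk z = x) :
    x < 0 := by
  by_contra hcon
  push Not at hcon
  obtain ⟨t, ht⟩ : ∃ t : ℝ, yval t = x := by
    refine ⟨Real.arcosh (x / 2 + 1), ?_⟩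
    rw [yval, Real.cosh_arcosh] <;> linarith
  exact yval_sub_jouk_ne_zero hz t (by rw [hx, ht, sub_self])

theorem fgnQ_im_eq_zero {z : ℂ} (hz : z ∈ cutPlane) {x : ℝ} (hx : jouk z = x) :
    (fgnQ d z).im = 0 := by
  rw [im_fgnQ hd hd' hz, hx]
  simp

end

/-! ### Values of `Q` where `v` is real: unit circle and negative axis. -/

theorem jouk_ofReal (r : ℝ) : jouk (r : ℂ) = ((r⁻¹ - 2 + r : ℝ) : ℂ) := by
  rw [jouk]
  push_cast
  rfl

theorem ofReal_mem_cutPlane {r : ℝ} (hr : r < 0) : (r : ℂ) ∈ cutPlane := by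
  left
  simpa using hr

theorem mem_cutPlane_of_norm_eq_one {z : ℂ} (hz : ‖z‖ = 1) (hz1 : z ≠ 1) : z ∈ cutPlane := by
  by_contra hcon
  simp only [cutPlane, Set.mem_ofPred_eq, not_or, not_lt, not_not] at hcon
  apply hz1
  have h : z = (z.re : ℂ) := Complex.ext rfl (by simp [hcon.2])
  rw [h, Complex.norm_real, Real.norm_of_nonneg hcon.1] at hz
  rw [h, hz, Complex.ofReal_one]

theorem jouk_of_norm_eq_one {z : ℂ} (hz : ‖z‖ = 1) : jouk z = ((-‖1 - z‖ ^ 2 : ℝ) : ℂ) := by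
  have h1 : z⁻¹ = conj z := by
    rw [Complex.inv_def, Complex.normSq_eq_norm_sq, hz]
    simp
  have hzz : z * conj z = 1 := by
    rw [Complex.mul_conj, Complex.normSq_eq_norm_sq, hz]
    simp
  have h2 : ((‖1 - z‖ ^ 2 : ℝ) : ℂ) = (1 - z) * conj (1 - z) := by
    rw [Complex.mul_conj, Complex.normSq_eq_norm_sq]
  rw [Complex.ofReal_neg, h2, jouk, h1, map_sub, map_one]
  linear_combination hzz

theorem eq_or_eq_inv_of_jouk_eq {z w : ℂ} (hz : z ≠ 0) (hw : w ≠ 0) (h : jouk z = jouk w) :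
    z = w ∨ z = w⁻¹ := by
  have h' : (z - w) * (z * w - 1) = 0 := by
    simp only [jouk] at h
    have h1 : z * z⁻¹ = 1 := mul_inv_cancel₀ hz
    have h2 : w * w⁻¹ = 1 := mul_inv_cancel₀ hw
    linear_combination (z * w) * h - w * h1 + z * h2
  rcases mul_eq_zero.mp h' with h' | h'
  · exact Or.inl (sub_eq_zero.mp h')
  · right
    exact eq_inv_of_mul_eq_one_left (sub_eq_zero.mp h')

theorem fgnQ_inv (d : ℝ) (z : ℂ) : fgnQ d z⁻¹ = fgnQ d z := by
  simp only [fgnQ, inv_inv]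
  ring

theorem differentiableAt_fgnQ {d : ℝ} (hd' : d < 1 / 2) {z : ℂ} (hz : z ∈ cutPlane) :
    DifferentiableAt ℂ (fgnQ d) z := by
  have key : ∀ w ∈ cutPlane, DifferentiableAt ℂ (polylog (-2 * d - 1)) w := fun w hw =>
    differentiableAt_polylog (by linarith) (hw.elim (fun h => Or.inr (by linarith)) Or.inl)
  have hz0 := ne_zero_of_mem_cutPlane hz
  have h1 := key z hz
  have h2 : DifferentiableAt ℂ (fun z => polylog (-2 * d - 1) z⁻¹) z :=
    (key _ (inv_mem_cutPlane hz)).comp z (differentiableAt_inv hz0)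
  have h3 : DifferentiableAt ℂ (fun z : ℂ => z⁻¹) z := differentiableAt_inv hz0
  unfold fgnQ
  fun_prop

theorem fgnQ_eq_of_neg_real {d : ℝ} (hd : -1 / 2 < d) (hd0 : d < 0) {z : ℂ} (hz : z ∈ cutPlane)
    {x : ℝ} (hx : jouk z = x) :
    fgnQ d z = ((fgnConst d * (x * ∫ t in Set.Ioi (0 : ℝ), t ^ (-2 * d - 2) *
      (2 * Real.sinh t / (yval t - x))) : ℝ) : ℂ) ∧
    IntegrableOn (fun t : ℝ => t ^ (-2 * d - 2) * (2 * Real.sinh t / (yval t - x)))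
      (Set.Ioi 0) := by
  obtain ⟨h1, h2⟩ := fgnQ_eq_of_neg hd hd0 hz
  constructor
  · rw [h1, hx]
    push_cast
    rw [← integral_complex_ofReal]
    push_cast
    rfl
  · refine IntegrableOn.congr_fun h2.re (fun t _ => ?_) measurableSet_Ioi
    simp only [hx]
    norm_cast

theorem fgnQ_pos_of_neg {d : ℝ} (hd : -1 / 2 < d) (hd0 : d < 0) {z : ℂ} (hz : z ∈ cutPlane)
    {x : ℝ} (hx : jouk z = x) : 0 < (fgnQ d z).re := by
  obtain ⟨h1, h2⟩ := fgnQ_eq_of_neg_real hd hd0 hz hx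
  have hx0 := jouk_neg_of_real hz hx
  rw [h1, Complex.ofReal_re]
  refine mul_pos_of_neg_of_neg (fgnConst_neg hd hd0) (mul_neg_of_neg_of_pos hx0 ?_)
  refine setIntegral_Ioi_pos h2 fun t ht => ?_
  have := Real.rpow_pos_of_pos ht (-2 * d - 2)
  have := Real.sinh_pos_iff.mpr ht
  have : 0 < yval t - x := by linarith [yval_pos ht]
  positivity

/-- On the circle `v = -r` with `r = ‖1 - z‖² ∈ (0, 4]`. Comparing `1 / (y + r)` with its value at
`r = 4` gives `A ≤ B` and `r B ≤ 4 A`. The upper bound is then weakened by `1 ≤ 4 / r`, which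
accounts for the `16`, so that both signs of `d` share one form; only integrability of `log Q` is at
stake. -/
theorem fgnQ_circle_bounds_of_neg {d : ℝ} (hd : -1 / 2 < d) (hd0 : d < 0) :
    ∃ c > 0, ∃ C > 0, ∀ z : ℂ, ‖z‖ = 1 → z ≠ 1 →
      c * ‖1 - z‖ ^ 2 ≤ (fgnQ d z).re ∧ (fgnQ d z).re ≤ C / ‖1 - z‖ ^ 2 := by
  obtain ⟨h0, hi0⟩ := fgnQ_eq_of_neg_real hd hd0 neg_one_mem_cutPlane jouk_neg_one
  have hk := fgnConst_neg hd hd0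
  set A := ∫ t in Set.Ioi (0 : ℝ), t ^ (-2 * d - 2) * (2 * Real.sinh t / (yval t - -4)) with hA
  have hA0 : 0 < A := by
    refine setIntegral_Ioi_pos hi0 fun t ht => ?_
    have := Real.rpow_pos_of_pos ht (-2 * d - 2)
    have := Real.sinh_pos_iff.mpr ht
    have : 0 < yval t - -4 := by linarith [yval_pos ht]
    positivity
  refine ⟨-fgnConst d * A, by nlinarith, -fgnConst d * (16 * A), by nlinarith, fun z hz hz1 => ?_⟩
  have hzc := mem_cutPlane_of_norm_eq_one hz hz1
  obtain ⟨h1, hi1⟩ := fgnQ_eq_of_neg_real hd hd0 hzc (jouk_of_norm_eq_one hz)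
  have hn : 0 < ‖1 - z‖ := norm_pos_iff.mpr (sub_ne_zero.mpr (Ne.symm hz1))
  have hn2 : ‖1 - z‖ ≤ 2 := by
    refine (norm_sub_le _ _).trans ?_
    rw [hz, norm_one]; norm_num
  set r := ‖1 - z‖ ^ 2 with hr
  have hr0 : 0 < r := by positivity
  have hr4 : r ≤ 4 := by nlinarith
  set B := ∫ t in Set.Ioi (0 : ℝ), t ^ (-2 * d - 2) * (2 * Real.sinh t / (yval t - -r)) with hB
  have hAB : A ≤ B := by
    refine setIntegral_mono_on hi0 hi1 measurableSet_Ioi fun t ht => ?_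
    have := Real.rpow_pos_of_pos ht (-2 * d - 2)
    have := Real.sinh_pos_iff.mpr ht
    have : 0 < yval t - -r := by linarith [yval_pos ht]
    have : yval t - -r ≤ yval t - -4 := by linarith
    gcongr
  have hBA : r * B ≤ 4 * A := by
    rw [hA, hB, ← integral_const_mul, ← integral_const_mul]
    refine setIntegral_mono_on (hi1.const_mul _) (hi0.const_mul _) measurableSet_Ioi fun t ht => ?_
    have h1 := Real.rpow_pos_of_pos ht (-2 * d - 2)
    have h2 := Real.sinh_pos_iff.mpr ht
    have hy := yval_pos ht
    have h3 : 0 < yval t - -r := by linarith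
    have h4 : 0 < yval t - -4 := by linarith
    have : r / (yval t - -r) ≤ 4 / (yval t - -4) := by
      rw [div_le_div_iff₀ h3 h4]
      nlinarith
    calc _ = t ^ (-2 * d - 2) * (2 * Real.sinh t) * (r / (yval t - -r)) := by ring
      _ ≤ t ^ (-2 * d - 2) * (2 * Real.sinh t) * (4 / (yval t - -4)) := by gcongr
      _ = _ := by ring
  have hQ : (fgnQ d z).re = -fgnConst d * (r * B) := by
    rw [h1, Complex.ofReal_re]; ring
  rw [hQ]
  constructor
  · rw [mul_assoc]
    have : A * r ≤ r * B := by nlinarith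
    exact mul_le_mul_of_nonneg_left this (by linarith)
  · rw [mul_div_assoc]
    have : r * B ≤ 16 * A / r := by
      rw [le_div_iff₀ hr0]
      nlinarith
    exact mul_le_mul_of_nonneg_left this (by linarith)

/-- At `z = -1` the factor `jouk` is `-4` and the integrand is negative. For `d > 0` this fixes the
additive constant that the difference formula leaves open. -/
theorem fgnQ_neg_one_pos {d : ℝ} (hd' : d < 1 / 2) : 0 < (fgnQ d (-1)).re := by
  have hG := Real.Gamma_pos_of_pos (s := 1 - 2 * d) (by linarith)
  have hint := integrableOn_rpow_mul_geom''_add (s := -2 * d - 1) (by linarith)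
    neg_one_mem_cutPlane
  have e : ∀ t : ℝ, ((t ^ (-2 * d) : ℝ) : ℂ) * (geom'' (-1) t + geom'' (-1)⁻¹ t) =
      ((-(t ^ (-2 * d) * (2 * (Real.exp (-t) * (1 - Real.exp (-t)) / (1 + Real.exp (-t)) ^ 3))) :
        ℝ) : ℂ) := by
    intro t
    rw [show ((-1 : ℂ))⁻¹ = -1 by norm_num, geom'']
    push_cast
    ring
  rw [sub_add_cancel] at hint
  have h2 := fgnQ_eq_integral hd' neg_one_mem_cutPlane
  simp_rw [e] at hint h2
  rw [integral_complex_ofReal, jouk_neg_one, ← Complex.ofReal_inv, ← Complex.ofReal_mul,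
    ← Complex.ofReal_mul] at h2
  rw [h2, Complex.ofReal_re, integral_neg]
  have : 0 < ∫ t in Set.Ioi (0 : ℝ), t ^ (-2 * d) *
      (2 * (Real.exp (-t) * (1 - Real.exp (-t)) / (1 + Real.exp (-t)) ^ 3)) := by
    refine setIntegral_Ioi_pos ?_ fun t ht => ?_
    · refine IntegrableOn.congr_fun hint.re.neg (fun t _ => ?_) measurableSet_Ioi
      simp only [Pi.neg_apply, RCLike.re_to_complex, Complex.ofReal_re, neg_neg]
    · have := Real.rpow_pos_of_pos ht (-2 * d)
      have h1 := Real.exp_pos (-t)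
      have : 0 < 1 - Real.exp (-t) := sub_pos.mpr (Real.exp_lt_one_iff.mpr (by linarith))
      positivity
  have hp := Real.pi_pos
  have : 0 < (4 * Real.pi * Real.Gamma (1 - 2 * d))⁻¹ := by positivity
  nlinarith

theorem weight_div_real_pos {d : ℝ} (hd : -1 / 2 < d) (hd' : d < 1 / 2) {z w : ℂ}
    (hz : z ∈ cutPlane) (hw : w ∈ cutPlane) {x u : ℝ} (hx : jouk z = x) (hu : jouk w = u) :
    0 < ∫ t in Set.Ioi (0 : ℝ), fgnWeight d t / ((yval t - x) * (yval t - u)) := by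
  refine setIntegral_Ioi_pos (integrableOn_weight_div_real hd hd' hz hw hx hu) fun t ht => ?_
  have hx0 := jouk_neg_of_real hz hx
  have hu0 := jouk_neg_of_real hw hu
  have hy := yval_pos ht
  have := fgnWeight_pos d ht
  have : 0 < yval t - x := by linarith
  have : 0 < yval t - u := by linarith
  positivity

/-- For `d > 0`, `Q` increases with `v`, so on `v = -r ≥ -4` it is at least its value at `z = -1`;
`r ≤ 4` then gives the lower bound. The upper bound is the difference formula with `r / (y + r) ≤ 4
/ (y + 4)`. -/
theorem fgnQ_circle_bounds_of_pos {d : ℝ} (hd0 : 0 < d) (hd' : d < 1 / 2) :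
    ∃ c > 0, ∃ C > 0, ∀ z : ℂ, ‖z‖ = 1 → z ≠ 1 →
      c * ‖1 - z‖ ^ 2 ≤ (fgnQ d z).re ∧ (fgnQ d z).re ≤ C / ‖1 - z‖ ^ 2 := by
  have hd : -1 / 2 < d := by linarith
  have hq := fgnQ_neg_one_pos hd'
  have hk := fgnConst_pos hd0 hd'
  have hI := weight_integral_pos hd hd'
  set q := (fgnQ d (-1)).re with hqdef
  set I := ∫ t in Set.Ioi (0 : ℝ), fgnWeight d t / (yval t + 4) ^ 2 with hIdef
  refine ⟨q / 4, by positivity, 4 * q + 16 * (fgnConst d * I), by positivity, fun z hz hz1 => ?_⟩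
  have hzc := mem_cutPlane_of_norm_eq_one hz hz1
  have hx := jouk_of_norm_eq_one hz
  have hn : 0 < ‖1 - z‖ := norm_pos_iff.mpr (sub_ne_zero.mpr (Ne.symm hz1))
  have hn2 : ‖1 - z‖ ≤ 2 := by
    refine (norm_sub_le _ _).trans ?_
    rw [hz, norm_one]; norm_num
  have hJ := weight_div_real_pos hd hd' hzc neg_one_mem_cutPlane hx jouk_neg_one
  have h := congrArg Complex.re
    (fgnQ_sub_fgnQ_real hd hd' hzc neg_one_mem_cutPlane hx jouk_neg_one)
  have hi := integrableOn_weight_div_real hd hd' hzc neg_one_mem_cutPlane hx jouk_neg_one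
  rw [Complex.sub_re, Complex.ofReal_re] at h
  set r := ‖1 - z‖ ^ 2 with hr
  have hr0 : 0 < r := by positivity
  have hr4 : r ≤ 4 := by nlinarith
  set J := ∫ t in Set.Ioi (0 : ℝ), fgnWeight d t / ((yval t - -r) * (yval t - -4)) with hJdef
  have hJI : r * J ≤ 4 * I := by
    rw [hIdef, hJdef, ← integral_const_mul, ← integral_const_mul]
    refine setIntegral_mono_on (hi.const_mul _) ((integrableOn_weight hd hd').const_mul _)
      measurableSet_Ioi fun t ht => ?_
    have hy := yval_pos ht
    have hw := fgnWeight_pos d ht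
    have h3 : 0 < yval t - -r := by linarith
    have h4 : 0 < yval t + 4 := by linarith
    have : r / (yval t - -r) ≤ 4 / (yval t + 4) := by
      rw [div_le_div_iff₀ h3 h4]
      nlinarith
    calc _ = fgnWeight d t / (yval t + 4) * (r / (yval t - -r)) := by
          rw [sub_neg_eq_add _ (4 : ℝ)]; field_simp
      _ ≤ fgnWeight d t / (yval t + 4) * (4 / (yval t + 4)) := by gcongr
      _ = _ := by field_simp
  have h4r : 0 ≤ -r - -4 := by linarith
  constructor
  · have : 0 ≤ fgnConst d * ((-r - -4) * J) := by positivity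
    nlinarith
  · rw [le_div_iff₀ hr0]
    have e1 : (fgnQ d z).re = q + fgnConst d * ((-r - -4) * J) := by linarith
    have e2 : (-r - -4) * (r * J) ≤ 4 * (4 * I) := by
      have : 0 ≤ r * J := by positivity
      nlinarith
    have e3 := mul_le_mul_of_nonneg_left e2 hk.le
    have e4 : q * r ≤ 4 * q := by nlinarith
    rw [e1]
    linarith

theorem fgnQ_circle_bounds {d : ℝ} (hd : -1 / 2 < d) (hd' : d < 1 / 2) (hd0 : d ≠ 0) :
    ∃ c > 0, ∃ C > 0, ∀ z : ℂ, ‖z‖ = 1 → z ≠ 1 →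
      c * ‖1 - z‖ ^ 2 ≤ (fgnQ d z).re ∧ (fgnQ d z).re ≤ C / ‖1 - z‖ ^ 2 := by
  rcases hd0.lt_or_gt with h | h
  · exact fgnQ_circle_bounds_of_neg hd h
  · exact fgnQ_circle_bounds_of_pos h hd'

/-! ### Zeros of `Q`. -/

theorem two_mul_sinh_ge (t : ℝ) : 0 ≤ t → yval t ≤ 2 * Real.sinh t := by
  intro ht
  have : Real.exp (-t) ≤ 1 := Real.exp_le_one_iff.mpr (by linarith)
  rw [yval, Real.cosh_eq, Real.sinh_eq]
  linarith

/-- Let `v → -∞` along `z = -e ^ (-T)`. In the formula for `Q(z) - Q(-1)` the factor `v + 4` is of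
size `-e ^ T`, while the integral over `(T, 2T]` alone is at least of order `T⁻²`. Exponential
growth wins and drives `Q` to `-∞`. -/
theorem exists_fgnQ_neg {d : ℝ} (hd0 : 0 < d) (hd' : d < 1 / 2) :
    ∃ r : ℝ, r ∈ Set.Ioo (-1 : ℝ) 0 ∧ (fgnQ d r).re < 0 := by
  have hd : -1 / 2 < d := by linarith
  have hk := fgnConst_pos hd0 hd'
  have hlow : ∀ T : ℝ, 1 ≤ T → (fgnQ d ((-Real.exp (-T) : ℝ) : ℂ)).re ≤
      (fgnQ d (-1)).re - fgnConst d * ((Real.exp T - 2) * (1 / (240 * T ^ 2))) := by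
    intro T hT
    have hT0 : 0 < T := by linarith
    have hzc : ((-Real.exp (-T) : ℝ) : ℂ) ∈ cutPlane :=
      ofReal_mem_cutPlane (by linarith [Real.exp_pos (-T)])
    have hx : jouk ((-Real.exp (-T) : ℝ) : ℂ) = ((-(2 * Real.cosh T + 2) : ℝ) : ℂ) := by
      rw [jouk_ofReal, Real.cosh_eq, inv_neg, ← Real.exp_neg, neg_neg]
      congr 1
      ring
    have h := congrArg Complex.re
      (fgnQ_sub_fgnQ_real hd hd' hzc neg_one_mem_cutPlane hx jouk_neg_one)
    have hi := integrableOn_weight_div_real hd hd' hzc neg_one_mem_cutPlane hx jouk_neg_one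
    rw [Complex.sub_re, Complex.ofReal_re] at h
    -- Here `240 = 8 · 30`. On `(T, 2T]` one has `t ^ (-2d - 2) ≥ t⁻³ ≥ 1 / (8 T³)`, and `yval t ≥
    -- 1` together with `yval t ≥ 2 cosh T - 2` bounds the two denominators by `6 yval t` and `5
    -- yval t`. The length `T` of the interval turns `T⁻³` into `T⁻²`.
    have hJ : 1 / (240 * T ^ 2) ≤ ∫ t in Set.Ioi (0 : ℝ), fgnWeight d t /
        ((yval t - -(2 * Real.cosh T + 2)) * (yval t - -4)) := by
      have hc : ∫ t in Set.Ioc T (2 * T), (1 / (240 * T ^ 3) : ℝ) = 1 / (240 * T ^ 2) := by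
        rw [setIntegral_const, Real.volume_real_Ioc_of_le (by linarith), smul_eq_mul]
        field_simp
        ring
      rw [← hc]
      have hsub : Set.Ioc T (2 * T) ⊆ Set.Ioi (0 : ℝ) := fun t ht => hT0.trans ht.1
      refine le_trans ?_ (setIntegral_mono_set hi ?_ hsub.eventuallyLE)
      · refine setIntegral_mono_on
          (integrableOn_const measure_Ioc_lt_top.ne) (hi.mono_set hsub) measurableSet_Ioc
          fun t ht => ?_
        have ht1 : 1 ≤ t := hT.trans ht.1.le
        have ht0 : 0 < t := by linarith
        have hy : 1 ≤ yval t := by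
          have := Real.cosh_le_cosh.mpr (show |(1 : ℝ)| ≤ |t| by
            rw [abs_of_pos one_pos, abs_of_pos ht0]; exact ht1)
          have h2 := Real.quadratic_le_exp_of_nonneg (x := 1) zero_le_one
          have h3 : Real.exp 1 * Real.exp (-1) = 1 := by rw [← Real.exp_add]; simp
          have : 1.5 ≤ Real.cosh 1 := by
            rw [Real.cosh_eq]
            have := Real.exp_one_gt_d9
            have := Real.exp_pos (-1)
            nlinarith [Real.exp_one_lt_d9]
          rw [yval]
          linarith
        have hs := two_mul_sinh_ge t ht0.le
        have hcosh : 2 * Real.cosh T - 2 ≤ yval t := by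
          have := Real.cosh_le_cosh.mpr (show |T| ≤ |t| by
            rw [abs_of_pos hT0, abs_of_pos ht0]; exact ht.1.le)
          rw [yval]
          linarith
        have hcosh0 := Real.cosh_pos T
        have hpow : 1 / (8 * T ^ 3) ≤ t ^ (-2 * d - 2) := by
          have h1 : t ^ (-3 : ℝ) ≤ t ^ (-2 * d - 2) :=
            Real.rpow_le_rpow_of_exponent_le ht1 (by linarith)
          refine le_trans ?_ h1
          rw [Real.rpow_neg ht0.le, ← one_div]
          have : t ^ (3 : ℝ) = t ^ 3 := by exact_mod_cast Real.rpow_natCast t 3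
          rw [this]
          have : t ^ 3 ≤ (2 * T) ^ 3 := by gcongr; exact ht.2
          have e : (2 * T) ^ 3 = 8 * T ^ 3 := by ring
          rw [e] at this
          gcongr
        rw [fgnWeight, le_div_iff₀ (by
          have : 0 < yval t - -(2 * Real.cosh T + 2) := by linarith
          have : 0 < yval t - -4 := by linarith
          positivity)]
        have hden : (yval t - -(2 * Real.cosh T + 2)) * (yval t - -4) ≤ 30 * (yval t * yval t) := by
          have h1 : yval t - -(2 * Real.cosh T + 2) ≤ 6 * yval t := by linarith
          have h2 : yval t - -4 ≤ 5 * yval t := by linarith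
          calc _ ≤ (6 * yval t) * (5 * yval t) := by gcongr; linarith
            _ = _ := by ring
        calc 1 / (240 * T ^ 3) * ((yval t - -(2 * Real.cosh T + 2)) * (yval t - -4))
            ≤ 1 / (240 * T ^ 3) * (30 * (yval t * yval t)) := by gcongr
          _ = 1 / (8 * T ^ 3) * (yval t * yval t) := by field_simp; norm_num
          _ ≤ t ^ (-2 * d - 2) * (2 * Real.sinh t * yval t) := by gcongr
      · filter_upwards [ae_restrict_mem measurableSet_Ioi] with t ht
        have hy := yval_pos ht
        have := fgnWeight_pos d ht
        have hcosh0 := Real.cosh_pos T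
        have : 0 < yval t - -(2 * Real.cosh T + 2) := by linarith
        have : 0 < yval t - -4 := by linarith
        simp only [Pi.zero_apply]
        positivity
    have hE : Real.exp T - 2 ≤ 2 * Real.cosh T - 2 := by
      rw [Real.cosh_eq]; linarith [Real.exp_pos (-T)]
    have hE0 : 0 ≤ 2 * Real.cosh T - 2 := by linarith [Real.one_le_cosh T]
    have := mul_le_mul hE hJ (by positivity) hE0
    have := mul_le_mul_of_nonneg_left this hk.le
    linarith
  have hlim : Tendsto (fun T : ℝ => (fgnQ d (-1)).re -
      fgnConst d * ((Real.exp T - 2) * (1 / (240 * T ^ 2)))) atTop atBot := by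
    have h1 : Tendsto (fun T : ℝ => Real.exp T / T ^ 2 - 2 / T ^ 2) atTop atTop := by
      refine Tendsto.atTop_add (Real.tendsto_exp_div_pow_atTop 2) (C := 0) ?_
      have := (tendsto_pow_atTop (α := ℝ) two_ne_zero).const_div_atTop (-2)
      refine this.congr fun T => by ring
    have h2 := (tendsto_const_nhds (x := (fgnQ d (-1)).re)).add_atBot
      (tendsto_neg_atTop_atBot.comp
        (h1.const_mul_atTop (show 0 < fgnConst d / 240 by positivity)))
    refine h2.congr' ?_
    filter_upwards [eventually_gt_atTop 0] with T hT
    simp only [Function.comp_apply]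
    field_simp
    ring
  obtain ⟨T, hT1, hT⟩ := ((eventually_ge_atTop (1 : ℝ)).and (hlim.eventually_lt_atBot 0)).exists
  refine ⟨-Real.exp (-T), ⟨?_, ?_⟩, (hlow T hT1).trans_lt hT⟩
  · linarith [Real.exp_lt_one_iff.mpr (show -T < 0 by linarith)]
  · linarith [Real.exp_pos (-T)]

theorem exists_zero_fgnQ {d : ℝ} (hd0 : 0 < d) (hd' : d < 1 / 2) :
    ∃ s : ℝ, s ∈ Set.Ioo (-1 : ℝ) 0 ∧ fgnQ d s = 0 := by
  obtain ⟨r, hr, hneg⟩ := exists_fgnQ_neg hd0 hd'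
  have hcont : ContinuousOn (fun x : ℝ => (fgnQ d (x : ℂ)).re) (Set.Icc (-1) r) := by
    intro x hx
    have h := (differentiableAt_fgnQ hd' (ofReal_mem_cutPlane
      (show x < 0 by linarith [hx.2, hr.2]))).continuousAt
    exact (Complex.continuous_re.continuousAt.comp
      (ContinuousAt.comp (f := fun x : ℝ => (x : ℂ)) h
        Complex.continuous_ofReal.continuousAt)).continuousWithinAt
  have hpos : 0 < (fgnQ d ((-1 : ℝ) : ℂ)).re := by
    have := fgnQ_neg_one_pos hd'
    push_cast
    exact this
  obtain ⟨s, hs, hs0⟩ := intermediate_value_Ioo' hr.1.le hcont ⟨hneg, hpos⟩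
  refine ⟨s, ⟨hs.1, hs.2.trans hr.2⟩, Complex.ext hs0 ?_⟩
  exact fgnQ_im_eq_zero (by linarith) hd' (ofReal_mem_cutPlane (hs.2.trans hr.2)) (jouk_ofReal s)

theorem jouk_im (z : ℂ) : (jouk z).im = z.im * (1 - 1 / ‖z‖ ^ 2) := by
  simp only [jouk, Complex.add_im, Complex.sub_im, Complex.inv_im, Complex.normSq_eq_norm_sq]
  have : (2 : ℂ).im = 0 := rfl
  rw [this]
  ring

theorem jouk_eq_ofReal {z : ℂ} (h : (jouk z).im = 0) : jouk z = ((jouk z).re : ℂ) :=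
  Complex.ext rfl (by simpa using h)

theorem fgnQ_mem_slitPlane_of_neg {d : ℝ} (hd : -1 / 2 < d) (hd0 : d < 0) {z : ℂ}
    (hz : z ∈ cutPlane) : fgnQ d z ∈ Complex.slitPlane := by
  by_cases h : (jouk z).im = 0
  · exact Or.inl (fgnQ_pos_of_neg hd hd0 hz (jouk_eq_ofReal h))
  · right
    obtain ⟨E, hE, h2⟩ := im_fgnQ_mul_pos hd (by linarith) hz
    rw [h2]
    exact mul_ne_zero (fgnConst_neg hd hd0).ne (mul_ne_zero h hE.ne')

/-- By `im_fgnQ_mul_pos` a zero forces `v` to be real; for real `v` the difference formula has a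
strictly positive integral, so `v` must equal `jouk s`. Finally `jouk` identifies exactly `z` and
`z⁻¹`. -/
theorem fgnQ_eq_zero_iff {d : ℝ} (hd : -1 / 2 < d) (hd' : d < 1 / 2) (hd0 : d ≠ 0) {s : ℝ}
    (hs : s < 0) (hs0 : fgnQ d s = 0) {z : ℂ} (hz : z ∈ cutPlane) :
    fgnQ d z = 0 ↔ z = s ∨ z = (s : ℂ)⁻¹ := by
  have hk := fgnConst_ne_zero hd hd' hd0
  constructor
  · intro h
    by_cases him : (jouk z).im = 0
    · have hx := jouk_eq_ofReal him
      have hsx := jouk_ofReal s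
      have e := fgnQ_sub_fgnQ_real hd hd' hz (ofReal_mem_cutPlane hs) hx hsx
      have hJ := weight_div_real_pos hd hd' hz (ofReal_mem_cutPlane hs) hx hsx
      rw [h, hs0, sub_zero] at e
      have e2 := Complex.ofReal_eq_zero.mp e.symm
      have e3 := ((mul_eq_zero.mp e2).resolve_left hk)
      have e4 := sub_eq_zero.mp ((mul_eq_zero.mp e3).resolve_right hJ.ne')
      refine eq_or_eq_inv_of_jouk_eq (ne_zero_of_mem_cutPlane hz)
        (ne_zero_of_mem_cutPlane (ofReal_mem_cutPlane hs)) ?_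
      rw [hx, hsx, e4]
    · obtain ⟨E, hE, h2⟩ := im_fgnQ_mul_pos hd hd' hz
      rw [h, Complex.zero_im] at h2
      exact absurd h2.symm (mul_ne_zero hk (mul_ne_zero him hE.ne'))
  · rintro (rfl | rfl)
    · exact hs0
    · rw [fgnQ_inv, hs0]

/-- The difference formula based at the zero, with `jouk r - jouk s` factored to exhibit `r - s`.
The lower bound for `J` is continuous in `r`, so it survives the limit `r → s` in the derivative; it
also gives the sign of `Q / (r - s)` on the negative axis. -/
theorem fgnQ_ofReal_of_zero {d : ℝ} (hd : -1 / 2 < d) (hd' : d < 1 / 2) {s : ℝ}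
    (hs : s < 0) (hs0 : fgnQ d s = 0) {r : ℝ} (hr : r < 0) :
    ∃ J : ℝ, fgnQ d r = ((fgnConst d * ((r - s) * (1 - 1 / (r * s)) * J) : ℝ) : ℂ) ∧
      (∫ t in Set.Ioi (0 : ℝ), fgnWeight d t / (yval t + 4) ^ 2) /
        ((1 + ‖jouk r + 4‖ / 4) * (1 + ‖jouk s + 4‖ / 4)) ≤ J := by
  have hrc := ofReal_mem_cutPlane hr
  have hsc := ofReal_mem_cutPlane hs
  have e := fgnQ_sub_fgnQ_real hd hd' hrc hsc (jouk_ofReal r) (jouk_ofReal s)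
  rw [hs0, sub_zero] at e
  refine ⟨∫ t in Set.Ioi (0 : ℝ), fgnWeight d t /
    ((yval t - (r⁻¹ - 2 + r)) * (yval t - (s⁻¹ - 2 + s))), ?_, ?_⟩
  · have hr' := hr.ne
    have hs' := hs.ne
    have h : r⁻¹ - 2 + r - (s⁻¹ - 2 + s) = (r - s) * (1 - 1 / (r * s)) := by
      field_simp
      ring
    rw [e, h]
  · have hi := integrableOn_weight_div_real hd hd' hrc hsc (jouk_ofReal r) (jouk_ofReal s)
    rw [← integral_div]
    refine setIntegral_mono_on ((integrableOn_weight hd hd').div_const _) hi measurableSet_Ioi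
      fun t ht => ?_
    have hw := (fgnWeight_pos d ht).le
    have hy := yval_pos ht
    have key : ∀ x : ℝ, x < 0 → 0 < yval t - (x⁻¹ - 2 + x) ∧
        yval t - (x⁻¹ - 2 + x) ≤ (yval t + 4) * (1 + ‖jouk x + 4‖ / 4) := by
      intro x hx
      have h1 := jouk_neg_of_real (ofReal_mem_cutPlane hx) (jouk_ofReal x)
      have h2 : 0 < yval t - (x⁻¹ - 2 + x) := by linarith
      have h3 := norm_yval_sub_le (x : ℂ) t
      rw [jouk_ofReal x, ← Complex.ofReal_sub, Complex.norm_real, Real.norm_of_nonneg h2.le,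
        ← jouk_ofReal x] at h3
      exact ⟨h2, h3⟩
    obtain ⟨a1, a2⟩ := key r hr
    obtain ⟨b1, b2⟩ := key s hs
    rw [div_div]
    have : (yval t - (r⁻¹ - 2 + r)) * (yval t - (s⁻¹ - 2 + s)) ≤
        (yval t + 4) ^ 2 * ((1 + ‖jouk r + 4‖ / 4) * (1 + ‖jouk s + 4‖ / 4)) := by
      calc _ ≤ ((yval t + 4) * (1 + ‖jouk r + 4‖ / 4)) * ((yval t + 4) * (1 + ‖jouk s + 4‖ / 4)) := by
            gcongr
        _ = _ := by ring
    gcongr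

/-- The derivative is real because `Q` is real on the negative axis. The slopes at `s` are bounded
above by the continuous function `g`, and `g s < 0` because `s² < 1` makes `1 - 1 / s²` negative. -/
theorem exists_deriv_fgnQ_neg {d : ℝ} (hd0 : 0 < d) (hd' : d < 1 / 2) {s : ℝ}
    (hs : s ∈ Set.Ioo (-1 : ℝ) 0) (hs0 : fgnQ d s = 0) :
    ∃ q : ℝ, q < 0 ∧ HasDerivAt (fgnQ d) (q : ℂ) (s : ℂ) := by
  have hd : -1 / 2 < d := by linarith
  have hk := fgnConst_pos hd0 hd'
  have hI := weight_integral_pos hd hd'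
  have hD := (differentiableAt_fgnQ hd' (ofReal_mem_cutPlane hs.2)).hasDerivAt
  set D := deriv (fgnQ d) (s : ℂ) with hDdef
  have hDr : HasDerivAt (fun r : ℝ => fgnQ d (r : ℂ)) D s := hD.comp_ofReal
  have hre : HasDerivAt (fun r : ℝ => (fgnQ d (r : ℂ)).re) D.re s :=
    Complex.reCLM.hasFDerivAt.comp_hasDerivAt s hDr
  have him : HasDerivAt (fun r : ℝ => (fgnQ d (r : ℂ)).im) D.im s :=
    Complex.imCLM.hasFDerivAt.comp_hasDerivAt s hDr
  have hneg : ∀ᶠ r : ℝ in 𝓝 s, r < 0 := isOpen_Iio.mem_nhds hs.2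
  have him0 : D.im = 0 := by
    have h0 : HasDerivAt (fun r : ℝ => (fgnQ d (r : ℂ)).im) 0 s := by
      refine (hasDerivAt_const s (0 : ℝ)).congr_of_eventuallyEq ?_
      filter_upwards [hneg] with r hr
      exact fgnQ_im_eq_zero hd hd' (ofReal_mem_cutPlane hr) (jouk_ofReal r)
    exact him.unique h0
  have hDD : D = (D.re : ℂ) := Complex.ext rfl (by simpa using him0)
  refine ⟨D.re, ?_, hDD ▸ hD⟩
  set I := ∫ t in Set.Ioi (0 : ℝ), fgnWeight d t / (yval t + 4) ^ 2 with hIdef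
  let g : ℝ → ℝ := fun r => fgnConst d * ((1 - 1 / (r * s)) *
    (I / ((1 + ‖jouk r + 4‖ / 4) * (1 + ‖jouk s + 4‖ / 4))))
  have hs' : s ≠ 0 := hs.2.ne
  have hg : ContinuousAt g s := by
    have h1 : ContinuousAt (fun r : ℝ => jouk (r : ℂ)) s := by
      unfold jouk
      have : (s : ℂ) ≠ 0 := by exact_mod_cast hs'
      fun_prop (disch := assumption)
    have h2 : ContinuousAt (fun r : ℝ => 1 / (r * s)) s := by
      refine ContinuousAt.div (by fun_prop) (by fun_prop) (mul_ne_zero hs' hs')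
    have h3 : (1 + ‖jouk s + 4‖ / 4) * (1 + ‖jouk s + 4‖ / 4) ≠ 0 := by positivity
    fun_prop (disch := assumption)
  have hgs : g s < 0 := by
    have h1 : s * s < 1 := by nlinarith [hs.1, hs.2]
    have h2 : 0 < s * s := by nlinarith [hs.2]
    have h3 : 1 < 1 / (s * s) := by rwa [lt_div_iff₀ h2, one_mul]
    have h4 : 0 < I / ((1 + ‖jouk s + 4‖ / 4) * (1 + ‖jouk s + 4‖ / 4)) := by positivity
    exact mul_neg_of_pos_of_neg hk (mul_neg_of_neg_of_pos (by linarith) h4)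
  refine lt_of_le_of_lt ?_ hgs
  refine le_of_tendsto_of_tendsto (hasDerivAt_iff_tendsto_slope.mp hre)
    (hg.tendsto.mono_left nhdsWithin_le_nhds) ?_
  have hmem : ∀ᶠ r : ℝ in 𝓝[≠] s, r ∈ Set.Ioo (-1 : ℝ) 0 :=
    nhdsWithin_le_nhds (isOpen_Ioo.mem_nhds hs)
  filter_upwards [hmem, self_mem_nhdsWithin] with r hr hrs
  obtain ⟨J, hJ1, hJ2⟩ := fgnQ_ofReal_of_zero hd hd' hs.2 hs0 hr.2
  rw [slope_def_field, hJ1, hs0, Complex.ofReal_re, Complex.zero_re, sub_zero]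
  have hrs' : r - s ≠ 0 := sub_ne_zero.mpr hrs
  rw [show fgnConst d * ((r - s) * (1 - 1 / (r * s)) * J) / (r - s) =
    fgnConst d * ((1 - 1 / (r * s)) * J) by field_simp]
  have h1 : r * s < 1 := by nlinarith [hs.1, hs.2, hr.1, hr.2]
  have h2 : 0 < r * s := by nlinarith [hs.2, hr.2]
  have h3 : 1 < 1 / (r * s) := by rwa [lt_div_iff₀ h2, one_mul]
  simp only [g]
  refine mul_le_mul_of_nonneg_left ?_ hk.le
  exact mul_le_mul_of_nonpos_left hJ2 (by linarith)

/-! ### The quotient that replaces `Q` when `d > 0`. -/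

/-- `z Q(z) / (z - s)`, extended to the zero `s` of `Q`. -/
noncomputable def fgnQuot (d s : ℝ) (z : ℂ) : ℂ := z * dslope (fgnQ d) (s : ℂ) z

theorem fgnQuot_of_ne {d s : ℝ} (hs0 : fgnQ d s = 0) {z : ℂ} (hz : z ≠ s) :
    fgnQuot d s z = fgnQ d z * (z / (z - s)) := by
  rw [fgnQuot, dslope_of_ne _ hz, slope_def_field, hs0, sub_zero]
  ring

theorem fgnQuot_conj {d s : ℝ} (hd0 : 0 < d) (hd' : d < 1 / 2)
    (hs : s ∈ Set.Ioo (-1 : ℝ) 0) (hs0 : fgnQ d s = 0) (z : ℂ) :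
    fgnQuot d s (conj z) = conj (fgnQuot d s z) := by
  by_cases hz : z = s
  · obtain ⟨q, -, hq⟩ := exists_deriv_fgnQ_neg hd0 hd' hs hs0
    rw [hz, Complex.conj_ofReal, fgnQuot, dslope_same, hq.deriv]
    simp
  · have hz' : conj z ≠ (s : ℂ) := fun h => hz (by
      rw [← Complex.conj_conj z, h, Complex.conj_ofReal])
    rw [fgnQuot_of_ne hs0 hz, fgnQuot_of_ne hs0 hz', fgnQ_conj]
    simp only [map_mul, map_div₀, map_sub, Complex.conj_ofReal]

theorem differentiableAt_fgnQuot {d s : ℝ} (hd' : d < 1 / 2) (hs : s < 0) {z : ℂ}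
    (hz : z ∈ cutPlane) : DifferentiableAt ℂ (fgnQuot d s) z := by
  have h : DifferentiableOn ℂ (dslope (fgnQ d) (s : ℂ)) cutPlane :=
    (Complex.differentiableOn_dslope (isOpen_cutPlane.mem_nhds (ofReal_mem_cutPlane hs))).mpr
      fun w hw => (differentiableAt_fgnQ hd' hw).differentiableWithinAt
  exact differentiableAt_id.mul (h.differentiableAt (isOpen_cutPlane.mem_nhds hz))

theorem div_sub_im_pos {s : ℝ} (hs : s < 0) {z : ℂ} (hz : 0 < z.im) : 0 < (z / (z - s)).im := by
  have hn : z - s ≠ 0 := by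
    intro h
    have := congrArg Complex.im h
    simp at this
    linarith
  have hn' := Complex.normSq_pos.mpr hn
  have : (z / (z - s)).im = -s * z.im / Complex.normSq (z - s) := by
    rw [Complex.div_im]
    simp only [Complex.sub_re, Complex.sub_im, Complex.ofReal_re, Complex.ofReal_im]
    ring
  rw [this]
  have : 0 < -s := by linarith
  positivity

theorem conj_mem_slitPlane {z : ℂ} (hz : conj z ∈ Complex.slitPlane) : z ∈ Complex.slitPlane := by
  simpa [Complex.slitPlane] using hz

/-- In the upper half of the disk `Im v ≤ 0`, hence `Im Q ≤ 0`, whereas `z / (z - s)` has positive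
imaginary part. The arguments, in `[-π, 0]` and `(0, π)`, add up to something in `(-π, π)`. The
lower half follows by conjugation; on the negative axis the sign change of `Q` at `s` is cancelled
by that of `z - s`, and at `s` itself the sign of the derivative decides. -/
theorem fgnQuot_mem_slitPlane {d s : ℝ} (hd0 : 0 < d) (hd' : d < 1 / 2)
    (hs : s ∈ Set.Ioo (-1 : ℝ) 0) (hs0 : fgnQ d s = 0) {z : ℂ} (hz : z ∈ cutPlane)
    (hz1 : ‖z‖ ≤ 1) : fgnQuot d s z ∈ Complex.slitPlane := by
  have hd : -1 / 2 < d := by linarith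
  have hk := fgnConst_pos hd0 hd'
  have upper : ∀ w : ℂ, ‖w‖ ≤ 1 → 0 < w.im → fgnQuot d s w ∈ Complex.slitPlane := by
    intro w hw1 hw
    have hwc : w ∈ cutPlane := Or.inr hw.ne'
    have hws : w ≠ s := by rintro rfl; simp at hw
    have hws' : w ≠ (s : ℂ)⁻¹ := by
      rintro rfl
      rw [← Complex.ofReal_inv] at hw
      simp at hw
    have hQ0 : fgnQ d w ≠ 0 := fun h =>
      ((fgnQ_eq_zero_iff hd hd' hd0.ne' hs.2 hs0 hwc).mp h).elim hws hws'
    have hQim : (fgnQ d w).im ≤ 0 := by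
      obtain ⟨E, hE, h2⟩ := im_fgnQ_mul_pos hd hd' hwc
      have hj : (jouk w).im ≤ 0 := by
        rw [jouk_im]
        have hn : 0 < ‖w‖ := norm_pos_iff.mpr (ne_zero_of_mem_cutPlane hwc)
        have : 1 ≤ 1 / ‖w‖ ^ 2 := by
          rw [le_div_iff₀ (by positivity), one_mul]
          exact pow_le_one₀ hn.le hw1
        nlinarith
      rw [h2]
      exact mul_nonpos_of_nonneg_of_nonpos hk.le (mul_nonpos_of_nonpos_of_nonneg hj hE.le)
    have hW := div_sub_im_pos hs.2 hw
    rw [fgnQuot_of_ne hs0 hws]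
    set W := w / (w - s) with hWdef
    have hW0 : W ≠ 0 := by intro h; rw [h] at hW; simp at hW
    -- If the product were a real number `p ≤ 0`, then `Q = p W⁻¹` with `Im W⁻¹ < 0`. As `Q ≠ 0`,
    -- `p` is negative and `Im Q > 0`, a contradiction.
    by_contra hcon
    rw [Complex.mem_slitPlane_iff, not_or, not_lt, not_not] at hcon
    obtain ⟨hc1, hc2⟩ := hcon
    set p := (fgnQ d w * W).re with hp
    have hprod : fgnQ d w * W = (p : ℂ) := Complex.ext rfl (by simpa using hc2)
    have hQe : fgnQ d w = (p : ℂ) * W⁻¹ := by rw [← hprod, mul_inv_cancel_right₀ hW0]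
    have hp0 : p ≠ 0 := by
      intro h
      rw [h] at hQe
      simp at hQe
      exact hQ0 hQe
    have hp1 : p < 0 := lt_of_le_of_ne hc1 hp0
    have him : (fgnQ d w).im = p * (-W.im / Complex.normSq W) := by
      rw [hQe, Complex.im_ofReal_mul, Complex.inv_im]
    have hn := Complex.normSq_pos.mpr hW0
    have : 0 < p * (-W.im / Complex.normSq W) :=
      mul_pos_of_neg_of_neg hp1 (div_neg_of_neg_of_pos (by linarith) hn)
    linarith
  rcases lt_trichotomy z.im 0 with h | h | h
  · apply conj_mem_slitPlane
    rw [← fgnQuot_conj hd0 hd' hs hs0]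
    refine upper _ ?_ ?_
    · rwa [RCLike.norm_conj]
    · simpa using h
  · have hzr : z = (z.re : ℂ) := Complex.ext rfl (by simpa using h)
    have hr0 : z.re < 0 := hz.resolve_right (by simpa using h)
    left
    by_cases hzs : z = s
    · obtain ⟨q, hq0, hq⟩ := exists_deriv_fgnQ_neg hd0 hd' hs hs0
      rw [hzs, fgnQuot, dslope_same, hq.deriv, ← Complex.ofReal_mul, Complex.ofReal_re]
      exact mul_pos_of_neg_of_neg hs.2 hq0
    · rw [fgnQuot_of_ne hs0 hzs]
      rw [hzr] at hzs hz1 ⊢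
      set r := z.re with hr
      rw [Complex.norm_real, Real.norm_of_nonpos hr0.le] at hz1
      have hrs : r ≠ s := fun h => hzs (by rw [h])
      obtain ⟨J, hJ1, hJ2⟩ := fgnQ_ofReal_of_zero hd hd' hs.2 hs0 hr0
      have hI := weight_integral_pos hd hd'
      have hJ : 0 < J := lt_of_lt_of_le (by positivity) hJ2
      rw [hJ1, ← Complex.ofReal_sub, ← Complex.ofReal_div, ← Complex.ofReal_mul,
        Complex.ofReal_re]
      have hrs' : r - s ≠ 0 := sub_ne_zero.mpr hrs
      rw [show fgnConst d * ((r - s) * (1 - 1 / (r * s)) * J) * (r / (r - s)) =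
        fgnConst d * (((1 - 1 / (r * s)) * r) * J) by field_simp]
      have h1 : r * s < 1 := by nlinarith [hs.1, hs.2]
      have h2 : 0 < r * s := by nlinarith [hs.2]
      have h3 : 1 < 1 / (r * s) := by rwa [lt_div_iff₀ h2, one_mul]
      have h4 : 0 < (1 - 1 / (r * s)) * r := mul_pos_of_neg_of_neg (by linarith) hr0
      positivity
  · exact upper z hz1 h

/-! ### Boundary values of `Q` on the slit. -/

theorem continuousAt_integral_kernel {μ : Measure ℝ} {g e : ℝ → ℂ} (hg : AEStronglyMeasurable g μ)
    (he : AEStronglyMeasurable e μ) (hint : Integrable (fun t => ‖g t‖ * ‖e t‖) μ)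
    (he1 : ∀ᵐ t ∂μ, ‖e t‖ ≤ 1) {u₀ : ℂ} {c : ℝ} (hc : 0 < c)
    (h : ∀ᶠ u in 𝓝 u₀, ∀ᵐ t ∂μ, c ≤ ‖1 - u * e t‖) :
    ContinuousAt (fun u : ℂ => ∫ t, g t * ((u * e t) * (1 + u * e t) / (1 - u * e t) ^ 3) ∂μ)
      u₀ := by
  set M := ‖u₀‖ + 1 with hM
  have hM0 : 0 ≤ M := by positivity
  refine continuousAt_of_dominated (bound := fun t => M * (1 + M) / c ^ 3 * (‖g t‖ * ‖e t‖))
    (Eventually.of_forall fun u => ?_) ?_ (hint.const_mul _) ?_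
  · have hm : AEMeasurable (fun t => u * e t) μ := he.aemeasurable.const_mul u
    have hm2 := ((hm.mul (hm.const_add 1)).div ((hm.const_sub 1).pow_const 3)).aestronglyMeasurable
    exact hg.mul hm2
  · have hball : ∀ᶠ u in 𝓝 u₀, ‖u‖ ≤ M := by
      have := (continuous_norm.tendsto u₀).eventually_le_const (show ‖u₀‖ < M by rw [hM]; linarith)
      exact this
    filter_upwards [h, hball] with u hu huM
    filter_upwards [hu, he1] with t ht het
    rw [norm_mul, norm_div, norm_mul, norm_pow, norm_mul]
    have h1 : ‖1 + u * e t‖ ≤ 1 + M := by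
      refine (norm_add_le _ _).trans ?_
      rw [norm_one, norm_mul]
      have := mul_le_mul huM het (norm_nonneg _) hM0
      linarith
    calc ‖g t‖ * (‖u‖ * ‖e t‖ * ‖1 + u * e t‖ / ‖1 - u * e t‖ ^ 3)
        ≤ ‖g t‖ * (M * ‖e t‖ * (1 + M) / c ^ 3) := by gcongr
      _ = _ := by ring
  · filter_upwards [h.self_of_nhds] with t ht
    have hne : 1 - u₀ * e t ≠ 0 := norm_pos_iff.mp (hc.trans_le ht)
    have hne3 : (1 - u₀ * e t) ^ 3 ≠ 0 := pow_ne_zero 3 hne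
    fun_prop (disch := assumption)

/-- The integrand of `polylog`, as a function of a complex integration variable. -/
noncomputable def polylogIntegrand (s : ℝ) (u τ : ℂ) : ℂ :=
  τ ^ ((s + 1 : ℝ) : ℂ) * ((u * Complex.exp (-τ)) * (1 + u * Complex.exp (-τ)) /
    (1 - u * Complex.exp (-τ)) ^ 3)

theorem polylogIntegrand_ofReal (s : ℝ) (u : ℂ) {t : ℝ} (ht : 0 ≤ t) :
    polylogIntegrand s u t = ((t ^ (s + 1) : ℝ) : ℂ) * geom'' u t := by
  rw [polylogIntegrand, geom'', Complex.ofReal_cpow ht, Complex.ofReal_exp, Complex.ofReal_neg]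

theorem continuousAt_integral_path {s : ℝ} {γ : ℝ → ℂ} (hγ : Continuous γ) {p q : ℝ} (hpq : p ≤ q)
    (hpos : ∀ x ∈ Set.Icc p q, 0 < (γ x).re) {u₀ : ℂ} {c : ℝ} (hc : 0 < c)
    (h : ∀ᶠ u in 𝓝 u₀, ∀ x ∈ Set.Icc p q, c ≤ ‖1 - u * Complex.exp (-γ x)‖) :
    ContinuousAt (fun u => ∫ x in p..q, polylogIntegrand s u (γ x)) u₀ := by
  simp_rw [intervalIntegral.integral_of_le hpq]
  have hg : ContinuousOn (fun x => γ x ^ ((s + 1 : ℝ) : ℂ)) (Set.Icc p q) :=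
    hγ.continuousOn.cpow_const fun x hx => Or.inl (hpos x hx)
  have he : Continuous fun x => Complex.exp (-γ x) := by fun_prop
  refine continuousAt_integral_kernel
    ((hg.mono Set.Ioc_subset_Icc_self).aestronglyMeasurable measurableSet_Ioc)
    he.aestronglyMeasurable ?_ ?_ hc ?_
  · have : ContinuousOn (fun x => ‖γ x ^ ((s + 1 : ℝ) : ℂ)‖ * ‖Complex.exp (-γ x)‖)
        (Set.Icc p q) := hg.norm.mul he.norm.continuousOn
    exact this.integrableOn_Icc.mono_set Set.Ioc_subset_Icc_self
  · filter_upwards [ae_restrict_mem measurableSet_Ioc] with x hx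
    rw [Complex.norm_exp, Complex.neg_re, Real.exp_le_one_iff]
    linarith [hpos x (Set.Ioc_subset_Icc_self hx)]
  · filter_upwards [h] with u hu
    filter_upwards [ae_restrict_mem measurableSet_Ioc] with x hx
    exact hu x (Set.Ioc_subset_Icc_self hx)

theorem continuousAt_integral_ray {s : ℝ} (hs : -2 < s) {S : Set ℝ} (hS : MeasurableSet S)
    (hSpos : S ⊆ Set.Ioi 0) {u₀ : ℂ} {c : ℝ} (hc : 0 < c)
    (h : ∀ᶠ u in 𝓝 u₀, ∀ t ∈ S, c ≤ ‖1 - u * Complex.exp (-(t : ℂ))‖) :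
    ContinuousAt (fun u => ∫ t in S, ((t ^ (s + 1) : ℝ) : ℂ) * geom'' u t) u₀ := by
  unfold geom''
  refine continuousAt_integral_kernel ?_ ?_ ?_ ?_ hc ?_
  · exact Measurable.aestronglyMeasurable (by fun_prop)
  · exact Measurable.aestronglyMeasurable (by fun_prop)
  · refine IntegrableOn.congr_fun ((integrableOn_rpow_mul_exp_neg (a := s + 1)
      (by linarith)).mono_set hSpos) (fun t ht => ?_) hS
    have ht0 : 0 < t := hSpos ht
    simp only [Complex.norm_real]
    rw [Real.norm_of_nonneg (Real.rpow_nonneg ht0.le _), Real.norm_of_nonneg (Real.exp_pos _).le]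
  · filter_upwards [ae_restrict_mem hS] with t ht
    have ht0 : 0 < t := hSpos ht
    rw [Complex.norm_real, Real.norm_of_nonneg (Real.exp_pos _).le, Real.exp_le_one_iff]
    linarith
  · filter_upwards [h] with u hu
    filter_upwards [ae_restrict_mem hS] with t ht
    simpa using hu t ht

/-- One-sided limits of the polylogarithm on its branch cut. -/
theorem exists_tendsto_polylog {s : ℝ} (hs : -2 < s) {x₀ : ℝ} (hx₀ : 1 < x₀) :
    ∃ ℓ, Tendsto (polylog s) (𝓝[{w : ℂ | w.im < 0}] (x₀ : ℂ)) (𝓝 ℓ) := by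
  have hx0 : 0 < x₀ := by linarith
  -- For `u` near `x₀` the integrand can only be singular on the ray near `log x₀`, which lies
  -- strictly between `a` and `b`. The segment `[a, b]` is replaced by the other three sides of the
  -- rectangle of height `π` above it. There the denominators stay away from zero for all `u` near
  -- `x₀`: by modulus on the vertical sides, and on the top because `e ^ (-τ)` is negative. The
  -- deformed integral is thus continuous at `x₀`.
  obtain ⟨a, ha0, ha⟩ : ∃ a, 0 < a ∧ a < Real.log x₀ :=
    exists_between (Real.log_pos hx₀)
  set b := Real.log x₀ + 1 with hb
  have hab : a ≤ b := by linarith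
  have hb0 : 0 < b := by linarith
  have hea : 1 < x₀ * Real.exp (-a) := by
    rw [← Real.exp_log hx0, ← Real.exp_add, Real.one_lt_exp_iff]
    linarith
  have heb : x₀ * Real.exp (-b) < 1 := by
    rw [← Real.exp_log hx0, ← Real.exp_add, Real.exp_lt_one_iff, hb]
    linarith
  obtain ⟨A, hA1, hA2⟩ := exists_between hea
  obtain ⟨B, hB1, hB2⟩ := exists_between heb
  have hnorm : Tendsto (fun u : ℂ => ‖u‖) (𝓝 (x₀ : ℂ)) (𝓝 x₀) := by
    have := continuous_norm.tendsto (x₀ : ℂ)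
    rwa [Complex.norm_real, Real.norm_of_nonneg hx0.le] at this
  have hevA : ∀ᶠ u : ℂ in 𝓝 (x₀ : ℂ), A < ‖u‖ * Real.exp (-a) :=
    (hnorm.mul_const _).eventually_const_lt hA2
  have hevB : ∀ᶠ u : ℂ in 𝓝 (x₀ : ℂ), ‖u‖ * Real.exp (-b) < B :=
    (hnorm.mul_const _).eventually_lt_const hB1
  have hevRe : ∀ᶠ u : ℂ in 𝓝 (x₀ : ℂ), 0 < u.re :=
    (Complex.continuous_re.tendsto (x₀ : ℂ)).eventually_const_lt (by simpa using hx0)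
  have hlowA : ∀ u τ : ℂ, A < ‖u‖ * Real.exp (-a) → τ.re ≤ a →
      A - 1 ≤ ‖1 - u * Complex.exp (-τ)‖ := by
    intro u τ hu hτ
    have h1 := norm_sub_norm_le (u * Complex.exp (-τ)) 1
    rw [norm_sub_rev, norm_one, norm_mul, Complex.norm_exp, Complex.neg_re] at h1
    have : ‖u‖ * Real.exp (-a) ≤ ‖u‖ * Real.exp (-τ.re) := by gcongr
    linarith
  have hlowB : ∀ u τ : ℂ, ‖u‖ * Real.exp (-b) < B → b ≤ τ.re →
      1 - B ≤ ‖1 - u * Complex.exp (-τ)‖ := by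
    intro u τ hu hτ
    have h1 := norm_sub_norm_le 1 (u * Complex.exp (-τ))
    rw [norm_one, norm_mul, Complex.norm_exp, Complex.neg_re] at h1
    have : ‖u‖ * Real.exp (-τ.re) ≤ ‖u‖ * Real.exp (-b) := by gcongr
    linarith
  have hpi := Real.pi_pos
  have cLow : ContinuousAt (fun u => ∫ t in Set.Ioc 0 a, ((t ^ (s + 1) : ℝ) : ℂ) * geom'' u t)
      (x₀ : ℂ) := by
    refine continuousAt_integral_ray hs measurableSet_Ioc (fun t ht => ht.1)
      (show 0 < A - 1 by linarith) ?_
    filter_upwards [hevA] with u hu t ht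
    exact hlowA u t hu (by simpa using ht.2)
  have cHigh : ContinuousAt (fun u => ∫ t in Set.Ioi b, ((t ^ (s + 1) : ℝ) : ℂ) * geom'' u t)
      (x₀ : ℂ) := by
    refine continuousAt_integral_ray hs measurableSet_Ioi (fun t ht => hb0.trans ht)
      (show 0 < 1 - B by linarith) ?_
    filter_upwards [hevB] with u hu t ht
    exact hlowB u t hu (by simpa using (Set.mem_Ioi.mp ht).le)
  have cTop : ContinuousAt (fun u => ∫ x in a..b, polylogIntegrand s u (x + Real.pi * Complex.I))
      (x₀ : ℂ) := by
    refine continuousAt_integral_path (γ := fun x => x + Real.pi * Complex.I) (by fun_prop) hab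
      (fun x hx => by simpa using ha0.trans_le hx.1) zero_lt_one ?_
    filter_upwards [hevRe] with u hu x hx
    have e : Complex.exp (-((x : ℂ) + Real.pi * Complex.I)) = -(Real.exp (-x) : ℂ) := by
      rw [neg_add, Complex.exp_add, Complex.exp_neg (Real.pi * Complex.I), Complex.exp_pi_mul_I]
      push_cast
      norm_num
    rw [e]
    refine le_trans ?_ (Complex.re_le_norm _)
    have := mul_pos hu (Real.exp_pos (-x))
    simp only [mul_neg, sub_neg_eq_add, Complex.add_re, Complex.one_re, Complex.re_mul_ofReal]
    linarith
  have cLeft : ContinuousAt (fun u => ∫ y in (0 : ℝ)..Real.pi,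
      polylogIntegrand s u (a + y * Complex.I)) (x₀ : ℂ) := by
    refine continuousAt_integral_path (γ := fun y => a + y * Complex.I) (by fun_prop) hpi.le
      (fun x hx => by simpa using ha0) (show 0 < A - 1 by linarith) ?_
    filter_upwards [hevA] with u hu y hy
    exact hlowA u _ hu (by simp)
  have cRight : ContinuousAt (fun u => ∫ y in (0 : ℝ)..Real.pi,
      polylogIntegrand s u (b + y * Complex.I)) (x₀ : ℂ) := by
    refine continuousAt_integral_path (γ := fun y => b + y * Complex.I) (by fun_prop) hpi.le
      (fun x hx => by simpa using hb0) (show 0 < 1 - B by linarith) ?_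
    filter_upwards [hevB] with u hu y hy
    exact hlowB u _ hu (by simp)
  have hcont := (((cLow.add ((cTop.sub (continuousAt_const (y := Complex.I) |>.mul cRight)).add
    (continuousAt_const (y := Complex.I) |>.mul cLeft))).add cHigh).const_mul
    ((Real.Gamma (s + 2) : ℝ) : ℂ)⁻¹)
  refine ⟨_, (hcont.tendsto.mono_left nhdsWithin_le_nhds).congr' ?_⟩
  filter_upwards [self_mem_nhdsWithin] with u hu
  have hu' : u.im < 0 := hu
  have huc : u ∈ cutPlane := Or.inr hu'.ne
  have hint := integrableOn_rpow_mul_geom'' hs huc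
  -- A pole inside would satisfy `e ^ τ = u`, but `0 ≤ Im τ ≤ π` gives `Im e ^ τ ≥ 0`, while `Im u <
  -- 0`. This is the only place where the side of approach enters.
  have hrect := Complex.integral_boundary_rect_eq_zero_of_differentiableOn
    (polylogIntegrand s u) (a : ℂ) (b + Real.pi * Complex.I) ?_
  · simp only [Complex.ofReal_re, Complex.ofReal_im, Complex.add_re, Complex.add_im,
      Complex.mul_re, Complex.mul_im, Complex.I_re, Complex.I_im, mul_zero, mul_one, sub_zero,
      add_zero, zero_add, Complex.ofReal_zero, zero_mul, smul_eq_mul] at hrect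
    have hmid : ∫ x in a..b, polylogIntegrand s u x =
        ∫ t in Set.Ioc a b, ((t ^ (s + 1) : ℝ) : ℂ) * geom'' u t := by
      rw [intervalIntegral.integral_of_le hab]
      exact setIntegral_congr_fun measurableSet_Ioc fun t ht =>
        polylogIntegrand_ofReal s u (ha0.trans ht.1).le
    have hsplit : ∫ t in Set.Ioi (0 : ℝ), ((t ^ (s + 1) : ℝ) : ℂ) * geom'' u t =
        (∫ t in Set.Ioc 0 a, ((t ^ (s + 1) : ℝ) : ℂ) * geom'' u t) +
        (∫ t in Set.Ioc a b, ((t ^ (s + 1) : ℝ) : ℂ) * geom'' u t) +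
        ∫ t in Set.Ioi b, ((t ^ (s + 1) : ℝ) : ℂ) * geom'' u t := by
      rw [← setIntegral_union (Set.Ioc_disjoint_Ioc_of_le le_rfl) measurableSet_Ioc
        (hint.mono_set fun t ht => ht.1) (hint.mono_set fun t ht => ha0.trans ht.1),
        Set.Ioc_union_Ioc_eq_Ioc ha0.le hab, ← setIntegral_union
        (Set.Ioc_disjoint_Ioi le_rfl) measurableSet_Ioi
        (hint.mono_set fun t ht => ht.1) (hint.mono_set fun t ht => hb0.trans ht),
        Set.Ioc_union_Ioi_eq_Ioi hb0.le]
    have hpoly : polylog s u = ((Real.Gamma (s + 2) : ℝ) : ℂ)⁻¹ *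
      ∫ t in Set.Ioi (0 : ℝ), ((t ^ (s + 1) : ℝ) : ℂ) * geom'' u t := rfl
    rw [hpoly, hsplit, ← hmid]
    simp only [Pi.add_apply, Pi.sub_apply, Pi.mul_apply]
    congr 1
    linear_combination -hrect
  · intro τ hτ
    have hre : τ.re ∈ Set.Icc a b := by
      have := hτ.1
      simpa [Set.uIcc_of_le hab] using this
    have him : τ.im ∈ Set.Icc 0 Real.pi := by
      have := hτ.2
      simpa [Set.uIcc_of_le hpi.le] using this
    have hsl : τ ∈ Complex.slitPlane := Or.inl (ha0.trans_le hre.1)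
    have hne : 1 - u * Complex.exp (-τ) ≠ 0 := by
      intro h0
      have h1 : Complex.exp τ = u := by
        have h2 : Complex.exp (-τ) * Complex.exp τ = 1 := by rw [← Complex.exp_add]; simp
        linear_combination Complex.exp τ * h0 + u * h2
      have h3 := congrArg Complex.im h1
      rw [Complex.exp_im] at h3
      have := mul_nonneg (Real.exp_pos τ.re).le (Real.sin_nonneg_of_mem_Icc him)
      linarith
    have hne3 : (1 - u * Complex.exp (-τ)) ^ 3 ≠ 0 := pow_ne_zero 3 hne
    have h1 : DifferentiableAt ℂ (fun τ : ℂ => τ ^ ((s + 1 : ℝ) : ℂ)) τ :=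
      differentiableAt_id.cpow_const hsl
    unfold polylogIntegrand
    refine (h1.mul ?_).differentiableWithinAt
    fun_prop (disch := assumption)

theorem tendsto_fgnQ_upper {d : ℝ} (hd' : d < 1 / 2) {t : ℝ} (ht : t ∈ Set.Ioo (0 : ℝ) 1) :
    ∃ ℓ, Tendsto (fgnQ d) (𝓝[{z : ℂ | 0 < z.im}] (t : ℂ)) (𝓝 ℓ) := by
  have ht0 : (t : ℂ) ≠ 0 := by exact_mod_cast ht.1.ne'
  obtain ⟨ℓ, hℓ⟩ := exists_tendsto_polylog (s := -2 * d - 1) (by linarith)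
    ((one_lt_inv₀ ht.1).mpr ht.2)
  have hinv : Tendsto (fun z : ℂ => z⁻¹) (𝓝[{z : ℂ | 0 < z.im}] (t : ℂ))
      (𝓝[{w : ℂ | w.im < 0}] ((t⁻¹ : ℝ) : ℂ)) := by
    refine tendsto_nhdsWithin_iff.mpr ⟨?_, ?_⟩
    · rw [Complex.ofReal_inv]
      exact (continuousAt_inv₀ ht0).tendsto.mono_left nhdsWithin_le_nhds
    · filter_upwards [self_mem_nhdsWithin] with z hz
      have hz' : 0 < z.im := hz
      have hz0 : z ≠ 0 := by rintro rfl; simp at hz'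
      change z⁻¹.im < 0
      rw [Complex.inv_im]
      exact div_neg_of_neg_of_pos (by linarith) (Complex.normSq_pos.mpr hz0)
  have h1 : ContinuousAt (polylog (-2 * d - 1)) (t : ℂ) :=
    (differentiableAt_polylog (by linarith) (Or.inr (by simpa using ht.2))).continuousAt
  have h2 : ContinuousAt (fun z : ℂ => 1 / (4 * (Real.pi : ℂ)) * (z⁻¹ - 2 + z)) (t : ℂ) := by
    fun_prop (disch := assumption)
  exact ⟨_, (h2.tendsto.mono_left nhdsWithin_le_nhds).mul
    ((h1.tendsto.mono_left nhdsWithin_le_nhds).add (hℓ.comp hinv))⟩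

theorem tendsto_fgnQPlus {d : ℝ} (hd' : d < 1 / 2) {t : ℝ} (ht : t ∈ Set.Ioo (0 : ℝ) 1) :
    Tendsto (fgnQ d) (𝓝[{z : ℂ | 0 < z.im}] (t : ℂ)) (𝓝 (fgnQPlus d t)) :=
  tendsto_nhds_limUnder (tendsto_fgnQ_upper hd' ht)

theorem fgnWeight_continuousOn (d : ℝ) : ContinuousOn (fgnWeight d) (Set.Ioi 0) := by
  intro x hx
  have hx' : x ≠ 0 := (Set.mem_Ioi.mp hx).ne'
  have := continuous_yval
  unfold fgnWeight
  exact ((Real.continuousAt_rpow_const x _ (Or.inl hx')).mul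
    (by fun_prop)).continuousWithinAt

/-- A Poisson-kernel estimate. At `z = t e ^ (iφ)` the imaginary part of `v` is of order `φ`, and
`v` is within `O(φ)` of `yval x` for all `x` in an interval of length `φ` starting at `τ = -log t`.
There the integrand is at least of order `φ⁻²`, so the integral is at least of order `φ⁻¹`, and the
two factors balance as `φ → 0`. -/
theorem exists_le_abs_im_fgnQ_arc {d : ℝ} (hd : -1 / 2 < d) (hd' : d < 1 / 2) (hd0 : d ≠ 0) {t : ℝ}
    (ht : t ∈ Set.Ioo (0 : ℝ) 1) : ∃ c > 0, ∀ φ : ℝ, 0 < φ → φ ≤ 1 →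
      c ≤ |(fgnQ d (t * Complex.exp (φ * Complex.I))).im| := by
  have ht0 := ht.1
  set τ := -Real.log t with hτ
  have hτ0 : 0 < τ := by
    have := Real.log_neg ht.1 ht.2
    linarith
  obtain ⟨x₁, hx₁, hmin⟩ := (isCompact_Icc (a := τ) (b := τ + 1)).exists_isMinOn
    ⟨τ, by simp⟩ ((fgnWeight_continuousOn d).mono fun x hx => hτ0.trans_le hx.1)
  have hw := fgnWeight_pos d (hτ0.trans_le hx₁.1)
  set w₀ := fgnWeight d x₁ with hw₀
  -- The first summand bounds the derivative of `yval` on `[τ, τ + 1]`; the second bounds `‖jouk t -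
  -- jouk (t e ^ (iφ))‖ / φ`. The factor `2 / π` in the constant below is Jordan's inequality for
  -- the sine.
  set L := 2 * Real.sinh (τ + 1) + (t + t⁻¹) with hL
  have hsinh : 0 < Real.sinh (τ + 1) := Real.sinh_pos_iff.mpr (by linarith)
  have hL0 : 0 < L := by positivity
  have hk := abs_pos.mpr (fgnConst_ne_zero hd hd' hd0)
  have htt : 0 < t⁻¹ - t := by
    have := (one_lt_inv₀ ht.1).mpr ht.2
    linarith [ht.2]
  have hpi := Real.pi_pos
  refine ⟨|fgnConst d| * ((t⁻¹ - t) * (2 / Real.pi) * (w₀ / L ^ 2)), by positivity,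
    fun φ hφ hφ1 => ?_⟩
  set z : ℂ := t * Complex.exp (φ * Complex.I) with hz
  have hsin : 2 / Real.pi * φ ≤ Real.sin φ :=
    Real.mul_le_sin hφ.le (hφ1.trans (by linarith [Real.pi_gt_three]))
  have hsin0 : 0 < Real.sin φ := lt_of_lt_of_le (by positivity) hsin
  have hzim : z.im = t * Real.sin φ := by
    rw [hz, Complex.im_ofReal_mul, Complex.exp_ofReal_mul_I_im]
  have hzn : ‖z‖ = t := by
    rw [hz, norm_mul, Complex.norm_exp_ofReal_mul_I, mul_one, Complex.norm_real,
      Real.norm_of_nonneg ht0.le]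
  have hzc : z ∈ cutPlane := Or.inr (by rw [hzim]; positivity)
  have him : (jouk z).im = -((t⁻¹ - t) * Real.sin φ) := by
    rw [jouk_im, hzim, hzn]
    field_simp
    ring
  have hexpt : t = Real.exp (-τ) := by rw [hτ, neg_neg, Real.exp_log ht0]
  have hyτ : (yval τ : ℂ) = jouk t := by
    rw [jouk_ofReal, yval, Real.cosh_eq]
    congr 1
    rw [hexpt, ← Real.exp_neg, neg_neg]
    ring
  have hdist : ∀ x ∈ Set.Icc τ (τ + φ), ‖(yval x : ℂ) - jouk z‖ ≤ L * φ := by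
    intro x hx
    have h1 : |yval x - yval τ| ≤ 2 * Real.sinh (τ + 1) * φ := by
      have hder : ∀ x ∈ Set.Icc τ (τ + 1), HasDerivWithinAt yval (2 * Real.sinh x)
          (Set.Icc τ (τ + 1)) x := fun x _ =>
        (((Real.hasDerivAt_cosh x).const_mul 2).sub_const 2).hasDerivWithinAt
      have := (convex_Icc τ (τ + 1)).norm_image_sub_le_of_norm_hasDerivWithin_le hder
        (C := 2 * Real.sinh (τ + 1)) (fun x hx => by
          have h0 : 0 ≤ Real.sinh x := Real.sinh_nonneg_iff.mpr (hτ0.le.trans hx.1)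
          rw [Real.norm_of_nonneg (by positivity)]
          have := Real.sinh_le_sinh.mpr hx.2
          linarith) (Set.left_mem_Icc.mpr (by linarith))
        (show x ∈ Set.Icc τ (τ + 1) from ⟨hx.1, by linarith [hx.2]⟩)
      rw [Real.norm_eq_abs, Real.norm_eq_abs, abs_of_nonneg (a := x - τ) (by linarith [hx.1])] at this
      refine this.trans ?_
      gcongr
      linarith [hx.2]
    have key : ∀ ψ : ℝ, |ψ| = φ → ‖(1 : ℂ) - Complex.exp (ψ * Complex.I)‖ ≤ φ := by
      intro ψ hψ
      have := Real.norm_exp_I_mul_ofReal_sub_one_le (x := ψ)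
      rw [norm_sub_rev, mul_comm, ← hψ]
      exact this
    have h2 : ‖jouk t - jouk z‖ ≤ (t + t⁻¹) * φ := by
      have e : jouk t - jouk z = (t : ℂ) * (1 - Complex.exp ((φ : ℝ) * Complex.I)) +
          ((t⁻¹ : ℝ) : ℂ) * (1 - Complex.exp ((-φ : ℝ) * Complex.I)) := by
        rw [jouk, jouk, hz, mul_inv, ← Complex.exp_neg]
        push_cast
        rw [neg_mul]
        ring
      rw [e]
      refine (norm_add_le _ _).trans ?_
      rw [norm_mul, norm_mul, Complex.norm_real, Complex.norm_real, Real.norm_of_nonneg ht0.le,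
        Real.norm_of_nonneg (inv_pos.mpr ht0).le, add_mul]
      have k1 := key φ (abs_of_pos hφ)
      have k2 := key (-φ) (by rw [abs_neg, abs_of_pos hφ])
      have := inv_pos.mpr ht0
      gcongr
    have e : (yval x : ℂ) - jouk z = ((yval x - yval τ : ℝ) : ℂ) + (jouk t - jouk z) := by
      rw [← hyτ]; push_cast; ring
    rw [e]
    refine (norm_add_le _ _).trans ?_
    rw [Complex.norm_real, Real.norm_eq_abs, hL, add_mul]
    exact add_le_add h1 h2
  have hint := integrableOn_weight_div_normSq hd hd' hzc
  have hE : w₀ / L ^ 2 / φ ≤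
      ∫ x in Set.Ioi (0 : ℝ), fgnWeight d x / ‖(yval x : ℂ) - jouk z‖ ^ 2 := by
    have hsub : Set.Ioc τ (τ + φ) ⊆ Set.Ioi (0 : ℝ) := fun x hx => hτ0.trans hx.1
    have hc : ∫ x in Set.Ioc τ (τ + φ), (w₀ / (L * φ) ^ 2 : ℝ) = w₀ / L ^ 2 / φ := by
      rw [setIntegral_const, Real.volume_real_Ioc_of_le (by linarith), smul_eq_mul]
      field_simp
      ring
    rw [← hc]
    refine le_trans ?_ (setIntegral_mono_set hint ?_ hsub.eventuallyLE)
    · refine setIntegral_mono_on (integrableOn_const measure_Ioc_lt_top.ne) (hint.mono_set hsub)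
        measurableSet_Ioc fun x hx => ?_
      have h1 : w₀ ≤ fgnWeight d x := hmin ⟨hx.1.le, by linarith [hx.2]⟩
      have h2 := hdist x ⟨hx.1.le, hx.2⟩
      have h3 := norm_pos_iff.mpr (yval_sub_jouk_ne_zero hzc x)
      have h4 := (fgnWeight_pos d (hsub hx)).le
      gcongr
    · filter_upwards [ae_restrict_mem measurableSet_Ioi] with x hx
      have := (fgnWeight_pos d hx).le
      simp only [Pi.zero_apply]
      positivity
  rw [im_fgnQ hd hd' hzc, abs_mul, abs_mul, him, abs_neg,
    abs_of_pos (mul_pos htt hsin0)]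
  have hfin : (t⁻¹ - t) * (2 / Real.pi) * (w₀ / L ^ 2) ≤ (t⁻¹ - t) * Real.sin φ *
      |∫ x in Set.Ioi (0 : ℝ), fgnWeight d x / ‖(yval x : ℂ) - jouk z‖ ^ 2| := by
    calc (t⁻¹ - t) * (2 / Real.pi) * (w₀ / L ^ 2)
        = (t⁻¹ - t) * (2 / Real.pi * φ) * (w₀ / L ^ 2 / φ) := by field_simp
      _ ≤ _ := by
          have := hE.trans (le_abs_self _)
          gcongr
  exact mul_le_mul_of_nonneg_left hfin hk.le

theorem tendsto_mul_exp_I {t : ℝ} (ht : 0 < t) :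
    Tendsto (fun φ : ℝ => (t : ℂ) * Complex.exp (φ * Complex.I)) (𝓝[>] 0)
      (𝓝[{z : ℂ | 0 < z.im}] (t : ℂ)) := by
  refine tendsto_nhdsWithin_iff.mpr ⟨?_, ?_⟩
  · have : Continuous fun φ : ℝ => (t : ℂ) * Complex.exp (φ * Complex.I) := by fun_prop
    have h := this.tendsto 0
    simp only [Complex.ofReal_zero, zero_mul, Complex.exp_zero, mul_one] at h
    exact h.mono_left nhdsWithin_le_nhds
  · filter_upwards [Ioo_mem_nhdsGT Real.pi_pos] with φ hφ
    rw [Complex.im_ofReal_mul, Complex.exp_ofReal_mul_I_im]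
    exact mul_pos ht (Real.sin_pos_of_mem_Ioo hφ)

theorem fgnQPlus_im_ne_zero {d : ℝ} (hd : -1 / 2 < d) (hd' : d < 1 / 2) (hd0 : d ≠ 0) {t : ℝ}
    (ht : t ∈ Set.Ioo (0 : ℝ) 1) : (fgnQPlus d t).im ≠ 0 := by
  obtain ⟨c, hc, h⟩ := exists_le_abs_im_fgnQ_arc hd hd' hd0 ht
  have hlim := (tendsto_fgnQPlus hd' ht).comp (tendsto_mul_exp_I ht.1)
  have h2 := (Complex.continuous_im.tendsto _).comp hlim
  have h3 : c ≤ |(fgnQPlus d t).im| := by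
    refine ge_of_tendsto h2.abs ?_
    filter_upwards [Ioo_mem_nhdsGT zero_lt_one] with φ hφ
    exact h φ hφ.1 hφ.2.le
  exact abs_pos.mp (hc.trans_le h3)

/-! ### Cauchy's formula in the slit disk. -/

theorem tendsto_integral_shrink {E : Type*} [NormedAddCommGroup E] [NormedSpace ℝ E] {h : ℝ → E}
    {T : ℝ} (hT : 0 < T) (hh : IntervalIntegrable h volume 0 T) :
    Tendsto (fun ε : ℝ => ∫ y in ε..(T - ε), h y) (𝓝[>] 0) (𝓝 (∫ y in (0 : ℝ)..T, h y)) := by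
  have hcont := intervalIntegral.continuousOn_primitive_interval' hh (Set.left_mem_uIcc)
  rw [Set.uIcc_of_le hT.le] at hcont
  have hmem : ∀ᶠ ε : ℝ in 𝓝[>] 0, ε ∈ Set.Ioo 0 T := Ioo_mem_nhdsGT hT
  have h1 : Tendsto (fun ε : ℝ => ∫ y in (0 : ℝ)..ε, h y) (𝓝[>] 0) (𝓝 0) := by
    have h0 := (hcont 0 (Set.left_mem_Icc.mpr hT.le)).tendsto
    simp only [intervalIntegral.integral_same] at h0
    refine h0.comp (tendsto_nhdsWithin_iff.mpr ⟨tendsto_id.mono_left nhdsWithin_le_nhds, ?_⟩)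
    filter_upwards [hmem] with ε hε using ⟨hε.1.le, hε.2.le⟩
  have h2 : Tendsto (fun ε : ℝ => ∫ y in (0 : ℝ)..(T - ε), h y) (𝓝[>] 0)
      (𝓝 (∫ y in (0 : ℝ)..T, h y)) := by
    have h0 := (hcont T (Set.right_mem_Icc.mpr hT.le)).tendsto
    refine h0.comp (tendsto_nhdsWithin_iff.mpr ⟨?_, ?_⟩)
    · have : Continuous fun ε : ℝ => T - ε := by fun_prop
      have := this.tendsto 0
      rw [sub_zero] at this
      exact this.mono_left nhdsWithin_le_nhds
    · filter_upwards [hmem] with ε hε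
      exact ⟨by linarith [hε.2], by linarith [hε.1]⟩
  have h3 := h2.sub h1
  rw [sub_zero] at h3
  refine h3.congr' ?_
  filter_upwards [hmem] with ε hε
  have hsub : ∀ x ∈ Set.Icc 0 T, IntervalIntegrable h volume 0 x := fun x hx =>
    hh.mono_set (by
      rw [Set.uIcc_of_le hx.1, Set.uIcc_of_le hT.le]
      exact Set.Icc_subset_Icc_right hx.2)
  exact intervalIntegral.integral_interval_sub_left
    (hsub _ ⟨by linarith [hε.2], by linarith [hε.1]⟩) (hsub _ ⟨hε.1.le, hε.2.le⟩)

theorem exp_mem_cutPlane {ζ : ℂ} (h0 : 0 < ζ.im) (h1 : ζ.im < 2 * Real.pi) :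
    Complex.exp ζ ∈ cutPlane := by
  by_cases hs : Real.sin ζ.im = 0
  · left
    have hpi : ζ.im = Real.pi := by
      by_contra hne
      rcases lt_or_gt_of_ne hne with h | h
      · exact (Real.sin_pos_of_pos_of_lt_pi h0 h).ne' hs
      · have := Real.sin_pos_of_pos_of_lt_pi (x := ζ.im - Real.pi) (by linarith) (by linarith)
        rw [Real.sin_sub_pi, hs] at this
        simp at this
    rw [Complex.exp_re, hpi, Real.cos_pi]
    linarith [Real.exp_pos ζ.re]
  · right
    rw [Complex.exp_im]
    exact mul_ne_zero (Real.exp_pos _).ne' hs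

theorem mul_exp_mem_cutPlane {t ε : ℝ} (ht : 0 < t) (h0 : 0 < ε) (h1 : ε < 2 * Real.pi) :
    (t : ℂ) * Complex.exp (ε * Complex.I) ∈ cutPlane := by
  have : (t : ℂ) * Complex.exp (ε * Complex.I) = Complex.exp (Real.log t + ε * Complex.I) := by
    rw [Complex.exp_add, ← Complex.ofReal_exp, Real.exp_log ht]
  rw [this]
  apply exp_mem_cutPlane <;> simpa

theorem norm_mul_exp_I {t : ℝ} (ht : 0 ≤ t) (ε : ℝ) : ‖(t : ℂ) * Complex.exp (ε * Complex.I)‖ = t := by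
  rw [norm_mul, Complex.norm_exp_ofReal_mul_I, mul_one, Complex.norm_real, Real.norm_of_nonneg ht]

section
variable {f : ℂ → ℂ}

theorem continuousOn_ray (hf : ContinuousOn f {z | z ∈ cutPlane ∧ ‖z‖ ≤ 1}) {ε : ℝ} (h0 : 0 < ε)
    (h1 : ε < 2 * Real.pi) : ContinuousOn
      (fun t : ℝ => f (t * Complex.exp (ε * Complex.I)) * Complex.exp (ε * Complex.I))
      (Set.Ioc 0 1) := by
  refine ContinuousOn.mul (hf.comp (by fun_prop) fun t ht => ?_) continuousOn_const
  exact ⟨mul_exp_mem_cutPlane ht.1 h0 h1, by rw [norm_mul_exp_I ht.1.le]; exact ht.2⟩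

theorem integral_ray_log (hf : ContinuousOn f {z | z ∈ cutPlane ∧ ‖z‖ ≤ 1}) {ε : ℝ} (h0 : 0 < ε)
    (h1 : ε < 2 * Real.pi) {r : ℝ} (hr0 : 0 < r) (hr1 : r ≤ 1) :
    ∫ x in (Real.log r)..0, f (Complex.exp (x + ε * Complex.I)) * Complex.exp (x + ε * Complex.I) =
      ∫ t in r..1, f (t * Complex.exp (ε * Complex.I)) * Complex.exp (ε * Complex.I) := by
  have hlog : Real.log r ≤ 0 := Real.log_nonpos hr0.le hr1
  have himg : Real.exp '' Set.uIcc (Real.log r) 0 ⊆ Set.Ioc 0 1 := by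
    rintro _ ⟨x, hx, rfl⟩
    rw [Set.uIcc_of_le hlog] at hx
    exact ⟨Real.exp_pos x, Real.exp_le_one_iff.mpr hx.2⟩
  have h := intervalIntegral.integral_deriv_smul_comp'' (a := Real.log r) (b := 0)
    (f := Real.exp) (f' := Real.exp)
    (g := fun t : ℝ => f (t * Complex.exp (ε * Complex.I)) * Complex.exp (ε * Complex.I))
    Real.continuous_exp.continuousOn (fun x _ => (Real.hasDerivAt_exp x).hasDerivWithinAt)
    Real.continuous_exp.continuousOn ((continuousOn_ray hf h0 h1).mono himg)
  rw [Real.exp_log hr0, Real.exp_zero] at h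
  rw [← h]
  refine intervalIntegral.integral_congr fun x _ => ?_
  simp only [Function.comp_apply, Complex.exp_add, Complex.real_smul, Complex.ofReal_exp]
  ring

theorem circleIntegral_eq_integral_exp (R : ℝ) : ∮ ζ in C(0, R), f ζ =
    Complex.I * ∫ y in (0 : ℝ)..(2 * Real.pi),
      f (R * Complex.exp (y * Complex.I)) * (R * Complex.exp (y * Complex.I)) := by
  rw [circleIntegral, ← intervalIntegral.integral_const_mul]
  refine intervalIntegral.integral_congr fun y _ => ?_
  simp only [deriv_circleMap, circleMap, zero_add, smul_eq_mul]
  ring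

/-- The exponential maps the rectangle `[log r, 0] × [ε, 2π - ε]` onto the annulus with a sector
around the slit removed, so this is Cauchy's theorem on a rectangle for `f (e ^ ζ) e ^ ζ`. The side
at angle `2π - ε` is rewritten with angle `-ε`. -/
theorem slit_annulus_rect (hf : DifferentiableOn ℂ f {z | z ∈ cutPlane ∧ ‖z‖ ≤ 1}) {ε : ℝ}
    (h0 : 0 < ε) (h1 : ε < Real.pi) {r : ℝ} (hr0 : 0 < r) (hr1 : r ≤ 1) :
    (∫ t in r..1, (f (t * Complex.exp (ε * Complex.I)) * Complex.exp (ε * Complex.I) -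
      f (t * Complex.exp ((-ε : ℝ) * Complex.I)) * Complex.exp ((-ε : ℝ) * Complex.I))) +
    Complex.I * (∫ y in ε..(2 * Real.pi - ε),
      f ((1 : ℝ) * Complex.exp (y * Complex.I)) * ((1 : ℝ) * Complex.exp (y * Complex.I))) -
    Complex.I * (∫ y in ε..(2 * Real.pi - ε),
      f (r * Complex.exp (y * Complex.I)) * (r * Complex.exp (y * Complex.I))) = 0 := by
  have hlog : Real.log r ≤ 0 := Real.log_nonpos hr0.le hr1
  have hpi := Real.pi_pos
  have hrect := Complex.integral_boundary_rect_eq_zero_of_differentiableOn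
    (fun ζ => f (Complex.exp ζ) * Complex.exp ζ) (Real.log r + ε * Complex.I)
    ((0 : ℝ) + (2 * Real.pi - ε : ℝ) * Complex.I) ?_
  · simp only [Complex.ofReal_re, Complex.ofReal_im, Complex.add_re, Complex.add_im,
      Complex.mul_re, Complex.mul_im, Complex.I_re, Complex.I_im, mul_zero, mul_one, sub_zero,
      add_zero, zero_add, smul_eq_mul] at hrect
    rw [integral_ray_log hf.continuousOn h0 (by linarith) hr0 hr1,
      integral_ray_log hf.continuousOn (by linarith : 0 < 2 * Real.pi - ε) (by linarith) hr0 hr1]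
      at hrect
    have hexp : Complex.exp ((2 * Real.pi - ε : ℝ) * Complex.I) =
        Complex.exp ((-ε : ℝ) * Complex.I) := by
      rw [show ((2 * Real.pi - ε : ℝ) : ℂ) * Complex.I =
        (-ε : ℝ) * Complex.I + 2 * Real.pi * Complex.I by push_cast; ring, Complex.exp_add,
        Complex.exp_two_pi_mul_I, mul_one]
    have hsub : Set.uIcc r 1 ⊆ Set.Ioc 0 1 := by
      rw [Set.uIcc_of_le hr1]
      exact fun t ht => ⟨hr0.trans_le ht.1, ht.2⟩
    have i1 := ((continuousOn_ray hf.continuousOn h0 (by linarith)).mono hsub).intervalIntegrable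
      (μ := volume)
    have i2 := ((continuousOn_ray hf.continuousOn (by linarith : 0 < 2 * Real.pi - ε)
      (by linarith)).mono hsub).intervalIntegrable
      (μ := volume)
    rw [hexp] at hrect i2
    rw [intervalIntegral.integral_sub i1 i2]
    have e1 : ∀ R : ℝ, 0 < R → ∀ y : ℝ, Complex.exp (Real.log R + y * Complex.I) =
        R * Complex.exp (y * Complex.I) := by
      intro R hR y
      rw [Complex.exp_add, ← Complex.ofReal_exp, Real.exp_log hR]
    have e2 := e1 1 one_pos
    rw [Real.log_one] at e2
    simp_rw [e1 r hr0, e2] at hrect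
    exact hrect
  · have hmaps : Set.MapsTo Complex.exp (Set.uIcc
        ((Real.log r : ℂ) + ε * Complex.I).re (((0 : ℝ) : ℂ) + (2 * Real.pi - ε : ℝ) * Complex.I).re
        ×ℂ Set.uIcc ((Real.log r : ℂ) + ε * Complex.I).im
        (((0 : ℝ) : ℂ) + (2 * Real.pi - ε : ℝ) * Complex.I).im)
        {z | z ∈ cutPlane ∧ ‖z‖ ≤ 1} := by
      intro ζ hζ
      have hre := hζ.1
      have him := hζ.2
      simp only [Complex.ofReal_re, Complex.ofReal_im, Complex.add_re, Complex.add_im,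
        Complex.mul_re, Complex.mul_im, Complex.I_re, Complex.I_im, mul_zero, mul_one, sub_zero,
        add_zero, zero_add, Set.mem_preimage] at hre him
      rw [Set.uIcc_of_le hlog] at hre
      rw [Set.uIcc_of_le (by linarith)] at him
      refine ⟨exp_mem_cutPlane (h0.trans_le him.1) (by linarith [him.2]), ?_⟩
      rw [Complex.norm_exp, Real.exp_le_one_iff]
      exact hre.2
    exact (hf.comp Complex.differentiable_exp.differentiableOn hmaps).mul
      Complex.differentiable_exp.differentiableOn

end

theorem intervalIntegrable_abs_log (a b : ℝ) :
    IntervalIntegrable (fun t => |Real.log t|) volume a b :=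
  intervalIntegral.intervalIntegrable_log'.abs

theorem intervalIntegrable_abs_log_one_sub (a b : ℝ) :
    IntervalIntegrable (fun t => |Real.log (1 - t)|) volume a b := by
  have h := (intervalIntegrable_abs_log (1 - a) (1 - b)).comp_sub_left 1
  simpa using h

theorem intervalIntegrable_abs_log_sin (a b : ℝ) :
    IntervalIntegrable (fun t => |Real.log (Real.sin t)|) volume a b :=
  intervalIntegrable_log_sin.abs

/-- From `sin ε ≥ 2 ε / π` and `log x ≥ 1 - 1 / x`. It shows that a gain of one factor `ε` absorbs
the logarithmic growth of `Re L` near the slit. -/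
theorem mul_abs_log_sin_le {ε : ℝ} (h0 : 0 < ε) (h1 : ε ≤ 1) : ε * |Real.log (Real.sin ε)| ≤ 2 := by
  have hpi := Real.pi_pos
  have hsin : 2 / Real.pi * ε ≤ Real.sin ε :=
    Real.mul_le_sin h0.le (h1.trans (by linarith [Real.pi_gt_three]))
  have hpos : 0 < 2 / Real.pi * ε := by positivity
  have hlog : Real.log (Real.sin ε) ≤ 0 :=
    Real.log_nonpos (hpos.le.trans hsin) (Real.sin_le_one ε)
  rw [abs_of_nonpos hlog]
  have h2 : Real.log (2 / Real.pi * ε) ≤ Real.log (Real.sin ε) := Real.log_le_log hpos hsin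
  have h3 := Real.one_sub_inv_le_log_of_pos hpos
  have h4 : ε * (2 / Real.pi * ε)⁻¹ = Real.pi / 2 := by field_simp
  have h5 : ε * -Real.log (Real.sin ε) ≤ ε * ((2 / Real.pi * ε)⁻¹ - 1) := by
    gcongr
    linarith
  rw [mul_sub, h4] at h5
  linarith [Real.pi_lt_four]

/-- The difference of the Cauchy kernels on the two sides of the slit is small. -/
theorem norm_cauchy_kernel_bounds {z₀ : ℂ} (hz₀ : ‖z₀‖ < 1) {δ : ℝ} (hδ : 0 < δ) {ε t : ℝ}
    (hε : 0 < ε) (h1 : δ ≤ ‖(t : ℂ) * Complex.exp (ε * Complex.I) - z₀‖)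
    (h2 : δ ≤ ‖(t : ℂ) * Complex.exp ((-ε : ℝ) * Complex.I) - z₀‖) :
    ‖Complex.exp (ε * Complex.I) / (t * Complex.exp (ε * Complex.I) - z₀)‖ ≤ 1 / δ ∧
    ‖Complex.exp (ε * Complex.I) / (t * Complex.exp (ε * Complex.I) - z₀) -
      Complex.exp ((-ε : ℝ) * Complex.I) / (t * Complex.exp ((-ε : ℝ) * Complex.I) - z₀)‖ ≤
        2 * ε / δ ^ 2 := by
  have n1 := norm_pos_iff.mp (hδ.trans_le h1)
  have n2 := norm_pos_iff.mp (hδ.trans_le h2)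
  constructor
  · rw [norm_div, Complex.norm_exp_ofReal_mul_I]
    gcongr
  · have e : Complex.exp (ε * Complex.I) / (t * Complex.exp (ε * Complex.I) - z₀) -
      Complex.exp ((-ε : ℝ) * Complex.I) / (t * Complex.exp ((-ε : ℝ) * Complex.I) - z₀) =
      -z₀ * (Complex.exp (ε * Complex.I) - Complex.exp ((-ε : ℝ) * Complex.I)) /
        ((t * Complex.exp (ε * Complex.I) - z₀) *
          (t * Complex.exp ((-ε : ℝ) * Complex.I) - z₀)) := by
      rw [div_sub_div _ _ n1 n2]
      congr 1
      ring
    have key : ∀ ψ : ℝ, |ψ| = ε → ‖Complex.exp (ψ * Complex.I) - 1‖ ≤ ε := by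
      intro ψ hψ
      have := Real.norm_exp_I_mul_ofReal_sub_one_le (x := ψ)
      rw [mul_comm, ← hψ]
      exact this
    have k1 := key ε (abs_of_pos hε)
    have k2 := key (-ε) (by rw [abs_neg, abs_of_pos hε])
    have k3 : ‖Complex.exp (ε * Complex.I) - Complex.exp ((-ε : ℝ) * Complex.I)‖ ≤ 2 * ε := by
      have := norm_sub_le (Complex.exp (ε * Complex.I) - 1)
        (Complex.exp ((-ε : ℝ) * Complex.I) - 1)
      rw [sub_sub_sub_cancel_right] at this
      linarith
    rw [e, norm_div, norm_mul, norm_neg, norm_mul, sq]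
    have : ‖z₀‖ * ‖Complex.exp (ε * Complex.I) - Complex.exp ((-ε : ℝ) * Complex.I)‖ ≤ 1 * (2 * ε) := by
      gcongr
    rw [one_mul] at this
    gcongr

/-- Half the distance from `z₀` to `[0, 1]` works, since rotation by `ε` moves a point of `[0, 1]`
by at most `|ε|`. -/
theorem exists_dist_slit {z₀ : ℂ} (hz₀ : z₀ ∈ cutPlane) : ∃ δ > 0, ∀ t ∈ Set.Icc (0 : ℝ) 1,
    ∀ ε : ℝ, |ε| ≤ δ → δ ≤ ‖(t : ℂ) * Complex.exp (ε * Complex.I) - z₀‖ := by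
  have hcont : ContinuousOn (fun x : ℝ => ‖(x : ℂ) - z₀‖) (Set.Icc 0 1) := by fun_prop
  obtain ⟨x, hx, hmin⟩ := isCompact_Icc.exists_isMinOn ⟨(0 : ℝ), by simp⟩ hcont
  have hpos : 0 < ‖(x : ℂ) - z₀‖ := by
    refine norm_pos_iff.mpr fun h => ?_
    rw [← sub_eq_zero.mp h] at hz₀
    rcases hz₀ with h | h
    · simp only [Complex.ofReal_re] at h
      linarith [hx.1]
    · simp at h
  refine ⟨‖(x : ℂ) - z₀‖ / 2, by positivity, fun t ht ε hε => ?_⟩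
  have h1 : ‖(x : ℂ) - z₀‖ ≤ ‖(t : ℂ) - z₀‖ := hmin ht
  have h2 : ‖(t : ℂ) - (t : ℂ) * Complex.exp (ε * Complex.I)‖ ≤ |ε| := by
    have h3 := Real.norm_exp_I_mul_ofReal_sub_one_le (x := ε)
    rw [mul_comm] at h3
    have e : (t : ℂ) - (t : ℂ) * Complex.exp (ε * Complex.I) =
      (t : ℂ) * -(Complex.exp (ε * Complex.I) - 1) := by ring
    rw [e, norm_mul, norm_neg, Complex.norm_real, Real.norm_of_nonneg ht.1]
    have := mul_le_mul ht.2 h3 (norm_nonneg _) zero_le_one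
    rwa [one_mul] at this
  have h4 := norm_add_le ((t : ℂ) - (t : ℂ) * Complex.exp (ε * Complex.I))
    ((t : ℂ) * Complex.exp (ε * Complex.I) - z₀)
  rw [sub_add_sub_cancel] at h4
  linarith

section
variable {L : ℂ → ℂ} {z₀ : ℂ} (hz₀ : z₀ ∈ cutPlane) (hz₀1 : ‖z₀‖ < 1)
  (hdiff : ∀ z ∈ cutPlane, ‖z‖ ≤ 1 → DifferentiableAt ℂ L z)
  (hconj : ∀ z ∈ cutPlane, ‖z‖ ≤ 1 → L (conj z) = conj (L z))
  {B C : ℝ} (hC : 0 ≤ C) (him : ∀ z, |(L z).im| ≤ B)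
  (hre : ∀ z : ℂ, z.im ≠ 0 → ‖z‖ < 1 → |(L z).re| ≤
    C * (1 + |Real.log ‖z‖| + |Real.log z.im| + |Real.log (1 - ‖z‖)|))
include hz₀ hz₀1

omit hz₀1 in
include hdiff in
-- Working with `dslope L z₀` instead of `L / (z - z₀)` removes the pole at `z₀`, so Cauchy's
-- theorem applies without excising that point.
theorem differentiableOn_dslope_slitDisc (hz₀1 : ‖z₀‖ < 1) :
    DifferentiableOn ℂ (dslope L z₀) {z | z ∈ cutPlane ∧ ‖z‖ ≤ 1} := by
  refine (Complex.differentiableOn_dslope ?_).mpr fun z hz =>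
    (hdiff z hz.1 hz.2).differentiableWithinAt
  filter_upwards [isOpen_cutPlane.mem_nhds hz₀,
    (isOpen_lt continuous_norm continuous_const).mem_nhds hz₀1] with z h1 h2
  exact ⟨h1, le_of_lt h2⟩

include hdiff hconj hC him hre in
-- With `K±` the Cauchy kernels on the two sides, the symmetry of `L` gives `2i (Im L) K₊ + (conj L
-- - L z₀) (K₊ - K₋)` as in `hform`. The first term has bounded `Im L` and tends to the claimed
-- integrand. In the second the kernel difference is `O(ε)`, which beats the logarithmic growth of
-- `Re L`. Dominated convergence then applies.
theorem tendsto_integral_slit {ℓ : ℝ → ℂ} (hlim : ∀ t ∈ Set.Ioo (0 : ℝ) 1,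
      Tendsto (fun φ : ℝ => L (t * Complex.exp (φ * Complex.I))) (𝓝[>] 0) (𝓝 (ℓ t)))
    {r : ℝ} (hr0 : 0 < r) (hr1 : r ≤ 1) :
    Tendsto (fun ε : ℝ => ∫ t in r..1,
      (dslope L z₀ (t * Complex.exp (ε * Complex.I)) * Complex.exp (ε * Complex.I) -
        dslope L z₀ (t * Complex.exp ((-ε : ℝ) * Complex.I)) * Complex.exp ((-ε : ℝ) * Complex.I)))
      (𝓝[>] 0) (𝓝 (∫ t in r..1, 2 * Complex.I * (((ℓ t).im : ℂ) / (t - z₀)))) := by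
  obtain ⟨δ, hδ, hdist⟩ := exists_dist_slit hz₀
  have hpi := Real.pi_gt_three
  have hf := differentiableOn_dslope_slitDisc hz₀ hdiff hz₀1
  have hsmall : ∀ᶠ ε : ℝ in 𝓝[>] 0, 0 < ε ∧ ε ≤ 1 ∧ ε ≤ δ := by
    filter_upwards [Ioo_mem_nhdsGT zero_lt_one, Ioo_mem_nhdsGT hδ] with ε h1 h2
    exact ⟨h1.1, h1.2.le, h2.2.le⟩
  have hIoc : Set.uIoc r 1 = Set.Ioc r 1 := Set.uIoc_of_le hr1
  have hB : 0 ≤ B := (abs_nonneg _).trans (him 0)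
  have hform : ∀ ε t : ℝ, 0 < ε → ε ≤ 1 → ε ≤ δ → t ∈ Set.Ioc r 1 →
      dslope L z₀ (t * Complex.exp (ε * Complex.I)) * Complex.exp (ε * Complex.I) -
        dslope L z₀ (t * Complex.exp ((-ε : ℝ) * Complex.I)) * Complex.exp ((-ε : ℝ) * Complex.I) =
      2 * Complex.I * ((L (t * Complex.exp (ε * Complex.I))).im *
        (Complex.exp (ε * Complex.I) / (t * Complex.exp (ε * Complex.I) - z₀))) +
      (conj (L (t * Complex.exp (ε * Complex.I))) - L z₀) *
        (Complex.exp (ε * Complex.I) / (t * Complex.exp (ε * Complex.I) - z₀) -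
          Complex.exp ((-ε : ℝ) * Complex.I) / (t * Complex.exp ((-ε : ℝ) * Complex.I) - z₀)) := by
    intro ε t hε0 hε1 hεδ ht
    have ht0 : 0 < t := hr0.trans ht.1
    have htI : t ∈ Set.Icc (0 : ℝ) 1 := ⟨ht0.le, ht.2⟩
    have d1 := hdist t htI ε (by rwa [abs_of_pos hε0])
    have d2 := hdist t htI (-ε) (by rwa [abs_neg, abs_of_pos hε0])
    have n1 := norm_pos_iff.mp (hδ.trans_le d1)
    have n2 := norm_pos_iff.mp (hδ.trans_le d2)
    have hcz : (t : ℂ) * Complex.exp ((-ε : ℝ) * Complex.I) =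
        conj ((t : ℂ) * Complex.exp (ε * Complex.I)) := by
      rw [map_mul, Complex.conj_ofReal, ← Complex.exp_conj, map_mul, Complex.conj_ofReal,
        Complex.conj_I]
      push_cast
      ring_nf
    have hL := hconj _ (mul_exp_mem_cutPlane ht0 hε0 (by linarith))
      (by rw [norm_mul_exp_I ht0.le]; exact ht.2)
    rw [dslope_of_ne _ (sub_ne_zero.mp n1), dslope_of_ne _ (sub_ne_zero.mp n2), slope_def_field,
      slope_def_field, hcz, hL]
    have h2i := Complex.sub_conj (L (t * Complex.exp (ε * Complex.I)))
    push_cast at h2i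
    rw [← hcz]
    linear_combination
      (Complex.exp (ε * Complex.I) / (t * Complex.exp (ε * Complex.I) - z₀)) * h2i
  refine intervalIntegral.tendsto_integral_filter_of_dominated_convergence
    -- `2 * B / δ` dominates the term with `Im L`. In the other one, `|log t|` occurs twice because
    -- `Im z = t sin ε` contributes it besides `|z| = t`, and `3 = 1 + 2` with the `2` from
    -- `mul_abs_log_sin_le`.
    (fun t => 2 * B / δ + (C * (3 + 2 * |Real.log t| + |Real.log (1 - t)|) + B + ‖L z₀‖) *
      (2 / δ ^ 2)) ?_ ?_ ?_ ?_
  · filter_upwards [hsmall] with ε hε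
    have hsub : Set.Ioc r 1 ⊆ Set.Ioc 0 1 := Set.Ioc_subset_Ioc_left hr0.le
    have hexp : Complex.exp ((2 * Real.pi - ε : ℝ) * Complex.I) =
        Complex.exp ((-ε : ℝ) * Complex.I) := by
      rw [show ((2 * Real.pi - ε : ℝ) : ℂ) * Complex.I =
        (-ε : ℝ) * Complex.I + 2 * Real.pi * Complex.I by push_cast; ring, Complex.exp_add,
        Complex.exp_two_pi_mul_I, mul_one]
    have c1 := continuousOn_ray hf.continuousOn hε.1 (by linarith [hε.2.1])
    have c2 := continuousOn_ray hf.continuousOn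
      (show 0 < 2 * Real.pi - ε by linarith [hε.2.1]) (by linarith [hε.1])
    rw [hexp] at c2
    rw [hIoc]
    exact ((c1.sub c2).mono hsub).aestronglyMeasurable measurableSet_Ioc
  · filter_upwards [hsmall] with ε hε
    have hne : ∀ᵐ t : ℝ, t ≠ 1 := by simp [ae_iff]
    filter_upwards [hne] with t ht1 ht
    rw [hIoc] at ht
    obtain ⟨hε0, hε1, hεδ⟩ := hε
    have ht0 : 0 < t := hr0.trans ht.1
    have htI : t ∈ Set.Icc (0 : ℝ) 1 := ⟨ht0.le, ht.2⟩
    have htlt : t < 1 := lt_of_le_of_ne ht.2 ht1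
    obtain ⟨b1, b2⟩ := norm_cauchy_kernel_bounds hz₀1 hδ hε0
      (hdist t htI ε (by rwa [abs_of_pos hε0])) (hdist t htI (-ε) (by rwa [abs_neg, abs_of_pos hε0]))
    rw [hform ε t hε0 hε1 hεδ ht]
    set z := (t : ℂ) * Complex.exp (ε * Complex.I) with hz
    have hsin0 : 0 < Real.sin ε := Real.sin_pos_of_pos_of_lt_pi hε0 (by linarith)
    have hzim : z.im = t * Real.sin ε := by
      rw [hz, Complex.im_ofReal_mul, Complex.exp_ofReal_mul_I_im]
    have hzn : ‖z‖ = t := norm_mul_exp_I ht0.le ε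
    have hreb := hre z (by rw [hzim]; positivity) (by rwa [hzn])
    have hlogmul : |Real.log z.im| ≤ |Real.log t| + |Real.log (Real.sin ε)| := by
      rw [hzim, Real.log_mul ht0.ne' hsin0.ne']
      exact abs_add_le _ _
    rw [hzn] at hreb
    have hReps : ε * |(L z).re| ≤ C * (3 + 2 * |Real.log t| + |Real.log (1 - t)|) := by
      have hs := mul_abs_log_sin_le hε0 hε1
      calc ε * |(L z).re| ≤ ε * (C * (1 + |Real.log t| + (|Real.log t| + |Real.log (Real.sin ε)|) +
            |Real.log (1 - t)|)) := by
            refine mul_le_mul_of_nonneg_left (hreb.trans ?_) hε0.le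
            gcongr
        _ = C * (ε * (1 + 2 * |Real.log t| + |Real.log (1 - t)|) +
              ε * |Real.log (Real.sin ε)|) := by ring
        _ ≤ C * (1 * (1 + 2 * |Real.log t| + |Real.log (1 - t)|) + 2) := by gcongr
        _ = _ := by ring
    have hLn : ε * ‖conj (L z) - L z₀‖ ≤
        C * (3 + 2 * |Real.log t| + |Real.log (1 - t)|) + B + ‖L z₀‖ := by
      have h1 := norm_sub_le (conj (L z)) (L z₀)
      rw [RCLike.norm_conj] at h1
      have h2 := Complex.norm_le_abs_re_add_abs_im (L z)
      have h3 := him z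
      have h4 : ε * (B + ‖L z₀‖) ≤ B + ‖L z₀‖ :=
        mul_le_of_le_one_left (by positivity) hε1
      have h5 := mul_le_mul_of_nonneg_left (h1.trans (add_le_add_left (h2.trans
        (add_le_add_right h3 _)) _)) hε0.le
      linarith
    refine (norm_add_le _ _).trans (add_le_add ?_ ?_)
    · have h1 : ‖(2 : ℂ) * Complex.I‖ = 2 := by simp
      rw [norm_mul (2 * Complex.I), h1, norm_mul, Complex.norm_real, Real.norm_eq_abs]
      calc 2 * (|(L z).im| * _) ≤ 2 * (B * (1 / δ)) := by
            have := him z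
            gcongr
        _ = _ := by ring
    · rw [norm_mul]
      calc _ ≤ ‖conj (L z) - L z₀‖ * (2 * ε / δ ^ 2) := by gcongr
        _ = (ε * ‖conj (L z) - L z₀‖) * (2 / δ ^ 2) := by ring
        _ ≤ _ := by gcongr
  · have i1 := intervalIntegrable_abs_log r 1
    have i2 := intervalIntegrable_abs_log_one_sub r 1
    have i0 : ∀ c : ℝ, IntervalIntegrable (fun _ : ℝ => c) volume r 1 := fun c =>
      intervalIntegrable_const
    exact (i0 _).add ((((((i0 3).add (i1.const_mul 2)).add i2).const_mul C).add (i0 B)).add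
      (i0 ‖L z₀‖) |>.mul_const _)
  · have hne : ∀ᵐ t : ℝ, t ≠ 1 := by simp [ae_iff]
    filter_upwards [hne] with t ht1 ht
    rw [hIoc] at ht
    have ht0 : 0 < t := hr0.trans ht.1
    have htlt : t < 1 := lt_of_le_of_ne ht.2 ht1
    have hl := hlim t ⟨ht0, htlt⟩
    have htz : (t : ℂ) - z₀ ≠ 0 := by
      have := hdist t ⟨ht0.le, ht.2⟩ 0 (by simpa using hδ.le)
      simp only [Complex.ofReal_zero, zero_mul, Complex.exp_zero, mul_one] at this
      exact norm_pos_iff.mp (hδ.trans_le this)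
    have hk : ∀ σ : ℝ, Tendsto (fun ε : ℝ => Complex.exp ((σ * ε : ℝ) * Complex.I) /
        (t * Complex.exp ((σ * ε : ℝ) * Complex.I) - z₀)) (𝓝[>] 0) (𝓝 (1 / (t - z₀))) := by
      intro σ
      have hc : ContinuousAt (fun ε : ℝ => Complex.exp ((σ * ε : ℝ) * Complex.I) /
          (t * Complex.exp ((σ * ε : ℝ) * Complex.I) - z₀)) 0 := by
        refine ContinuousAt.div (by fun_prop) (by fun_prop) ?_
        simpa using htz
      have := hc.tendsto.mono_left (nhdsWithin_le_nhds (s := Set.Ioi 0))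
      simpa using this
    have k1 := hk 1
    have k2 := hk (-1)
    simp only [one_mul, neg_one_mul] at k1 k2
    have him' := (Complex.continuous_ofReal.tendsto _).comp
      ((Complex.continuous_im.tendsto _).comp hl)
    have hcj := (Complex.continuous_conj.tendsto _).comp hl
    have hall := ((him'.mul k1).const_mul (2 * Complex.I)).add
      ((hcj.sub_const (L z₀)).mul (k1.sub k2))
    rw [sub_self, mul_zero, add_zero, mul_one_div] at hall
    refine hall.congr' ?_
    filter_upwards [hsmall] with ε hε
    exact (hform ε t hε.1 hε.2.1 hε.2.2 ht).symm

end

theorem ae_sin_ne_zero : ∀ᵐ y : ℝ, Real.sin y ≠ 0 := by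
  have h : {y : ℝ | ¬ Real.sin y ≠ 0} ⊆ Set.range fun n : ℤ => (n : ℝ) * Real.pi := by
    intro y hy
    simp only [Set.mem_ofPred_eq, not_not] at hy
    exact Real.sin_eq_zero_iff.mp hy
  exact measure_mono_null h ((Set.countable_range _).measure_zero volume)

theorem tendsto_mul_abs_log_zero : Tendsto (fun r : ℝ => r * |Real.log r|) (𝓝[>] 0) (𝓝 0) := by
  have h := (Real.continuous_mul_log.tendsto 0).abs.mono_left (nhdsWithin_le_nhds (s := Set.Ioi 0))
  rw [zero_mul, abs_zero] at h
  refine h.congr' ?_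
  filter_upwards [self_mem_nhdsWithin] with r hr
  rw [abs_mul, abs_of_pos (Set.mem_Ioi.mp hr)]

theorem dslope_mul_eq {L : ℂ → ℂ} {z₀ z : ℂ} (h : z ≠ z₀) :
    dslope L z₀ z * z = (L z - L z₀) * (z / (z - z₀)) := by
  rw [dslope_of_ne _ h, slope_def_field]
  ring

theorem intervalIntegrable_dslope_circle {L : ℂ → ℂ} {z₀ : ℂ} {R : ℝ} (hR : 0 ≤ R)
    (hRz : ‖z₀‖ ≠ R) (hL : CircleIntegrable L 0 R) : IntervalIntegrable (fun y : ℝ =>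
      dslope L z₀ (R * Complex.exp (y * Complex.I)) * (R * Complex.exp (y * Complex.I)))
      volume 0 (2 * Real.pi) := by
  have hne : ∀ y : ℝ, (R : ℂ) * Complex.exp (y * Complex.I) ≠ z₀ := by
    intro y h
    apply hRz
    rw [← h, norm_mul_exp_I hR]
  have hc : Continuous fun y : ℝ => (R : ℂ) * Complex.exp (y * Complex.I) /
      (R * Complex.exp (y * Complex.I) - z₀) :=
    Continuous.div (by fun_prop) (by fun_prop) fun y => sub_ne_zero.mpr (hne y)
  have hL' : IntervalIntegrable (fun y : ℝ => L (R * Complex.exp (y * Complex.I)) - L z₀)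
      volume 0 (2 * Real.pi) := by
    refine IntervalIntegrable.sub ?_ intervalIntegrable_const
    have : IntervalIntegrable (fun y : ℝ => L (circleMap 0 R y)) volume 0 (2 * Real.pi) := hL
    simpa only [circleMap, zero_add] using this
  refine (hL'.mul_continuousOn hc.continuousOn).congr fun y _ => ?_
  exact (dslope_mul_eq (hne y)).symm

section
variable {L : ℂ → ℂ} {z₀ : ℂ} (hz₀ : z₀ ∈ cutPlane) (hz₀1 : ‖z₀‖ < 1)
  (hdiff : ∀ z ∈ cutPlane, ‖z‖ ≤ 1 → DifferentiableAt ℂ L z)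
  (hconj : ∀ z ∈ cutPlane, ‖z‖ ≤ 1 → L (conj z) = conj (L z))
  {B C : ℝ} (hC : 0 ≤ C) (him : ∀ z, |(L z).im| ≤ B)
  (hre : ∀ z : ℂ, z.im ≠ 0 → ‖z‖ < 1 → |(L z).re| ≤
    C * (1 + |Real.log ‖z‖| + |Real.log z.im| + |Real.log (1 - ‖z‖)|))

include hC him hre in
-- `Real.log` of a negative number is the logarithm of its absolute value, so one bound serves both
-- half-planes and `log z.im` splits as `log r + log (sin y)` even when the sine is negative.
theorem norm_le_on_circle {r : ℝ} (hr0 : 0 < r) (hr1 : r < 1) {y : ℝ} (hy : Real.sin y ≠ 0) :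
    ‖L (r * Complex.exp (y * Complex.I))‖ ≤
      C * (1 + 2 * |Real.log r| + |Real.log (1 - r)|) + B + C * |Real.log (Real.sin y)| := by
  have hzim : ((r : ℂ) * Complex.exp (y * Complex.I)).im = r * Real.sin y := by
    rw [Complex.im_ofReal_mul, Complex.exp_ofReal_mul_I_im]
  have hn := norm_mul_exp_I hr0.le y
  have h1 := hre (r * Complex.exp (y * Complex.I)) (by rw [hzim]; exact mul_ne_zero hr0.ne' hy)
    (by rwa [hn])
  rw [hn, hzim, Real.log_mul hr0.ne' hy] at h1
  have h2 := him (r * Complex.exp (y * Complex.I))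
  have h3 := mul_le_mul_of_nonneg_left (abs_add_le (Real.log r) (Real.log (Real.sin y))) hC
  have h4 := Complex.norm_le_abs_re_add_abs_im (L (r * Complex.exp (y * Complex.I)))
  linarith

include hdiff hC him hre in
theorem circleIntegrable_of_log_bound {r : ℝ} (hr0 : 0 < r) (hr1 : r < 1) :
    CircleIntegrable L 0 r := by
  have hpi := Real.pi_pos
  have hgoal : IntervalIntegrable (fun y : ℝ => L (r * Complex.exp (y * Complex.I))) volume 0
      (2 * Real.pi) := by
    refine IntervalIntegrable.mono_fun' (g := fun y => C * (1 + 2 * |Real.log r| +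
      |Real.log (1 - r)|) + B + C * |Real.log (Real.sin y)|) ?_ ?_ ?_
    · exact intervalIntegrable_const.add ((intervalIntegrable_abs_log_sin _ _).const_mul C)
    · rw [Set.uIoc_of_le (by positivity), Measure.restrict_congr_set Ioo_ae_eq_Ioc.symm]
      refine ContinuousOn.aestronglyMeasurable ?_ measurableSet_Ioo
      intro y hy
      have hz := mul_exp_mem_cutPlane hr0 hy.1 hy.2
      have hL := (hdiff _ hz (by rw [norm_mul_exp_I hr0.le]; exact hr1.le)).continuousAt
      exact (ContinuousAt.comp (f := fun y : ℝ => (r : ℂ) * Complex.exp (y * Complex.I)) hL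
        (by fun_prop)).continuousWithinAt
    · filter_upwards [ae_restrict_of_ae ae_sin_ne_zero] with y hy
      exact norm_le_on_circle hC him hre hr0 hr1 hy
  simpa only [CircleIntegrable, circleMap, zero_add] using hgoal

include hz₀ hz₀1 hdiff hconj hC him hre in
-- The limit of `slit_annulus_rect` as the opening `ε` closes, for fixed `r`. The condition `r <
-- ‖z₀‖` keeps `z₀` off the inner circle.
theorem slit_annulus_integral {ℓ : ℝ → ℂ} (hlim : ∀ t ∈ Set.Ioo (0 : ℝ) 1,
      Tendsto (fun φ : ℝ => L (t * Complex.exp (φ * Complex.I))) (𝓝[>] 0) (𝓝 (ℓ t)))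
    (hcirc : CircleIntegrable L 0 1) {r : ℝ} (hr0 : 0 < r) (hr1 : r < ‖z₀‖) :
    (∫ t in r..1, 2 * Complex.I * (((ℓ t).im : ℂ) / (t - z₀))) +
      (∮ ζ in C(0, 1), dslope L z₀ ζ) - (∮ ζ in C(0, r), dslope L z₀ ζ) = 0 := by
  have hpi := Real.pi_pos
  have hr1' : r ≤ 1 := hr1.le.trans hz₀1.le
  have hf := differentiableOn_dslope_slitDisc hz₀ hdiff hz₀1
  have i1 := intervalIntegrable_dslope_circle zero_le_one hz₀1.ne hcirc
  have i2 := intervalIntegrable_dslope_circle hr0.le hr1.ne'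
    (circleIntegrable_of_log_bound hdiff hC him hre hr0 (hr1.trans hz₀1))
  have t0 := tendsto_integral_slit hz₀ hz₀1 hdiff hconj hC him hre hlim hr0 hr1'
  have t1 := (tendsto_integral_shrink (by positivity) i1).const_mul Complex.I
  have t2 := (tendsto_integral_shrink (by positivity) i2).const_mul Complex.I
  rw [circleIntegral_eq_integral_exp, circleIntegral_eq_integral_exp]
  refine tendsto_nhds_unique ((t0.add t1).sub t2) ?_
  refine tendsto_const_nhds.congr' ?_
  filter_upwards [Ioo_mem_nhdsGT hpi] with ε hε
  exact (slit_annulus_rect hf hε.1 hε.2 hr0 hr1').symm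

include hz₀ hz₀1 hC him hre in
-- On the circle of radius `r` the integrand grows at most like `|log r|` up to an integrable
-- function of the angle, the denominator stays above `‖z₀‖ / 2`, and the length contributes `r`;
-- thus `r |log r| → 0` decides.
theorem tendsto_small_circle :
    Tendsto (fun r : ℝ => ∮ ζ in C(0, r), dslope L z₀ ζ) (𝓝[>] 0) (𝓝 0) := by
  have hpi := Real.pi_pos
  have hz0 : 0 < ‖z₀‖ := norm_pos_iff.mpr (ne_zero_of_mem_cutPlane hz₀)
  set S := ∫ y in (0 : ℝ)..(2 * Real.pi), |Real.log (Real.sin y)| with hS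
  refine squeeze_zero_norm' (a := fun r => 2 / ‖z₀‖ * (2 * Real.pi * (C * (r + 2 * (r * |Real.log r|) +
    r * |Real.log (1 - r)|) + r * (B + ‖L z₀‖)) + r * (C * S))) ?_ ?_
  · filter_upwards [Ioo_mem_nhdsGT (half_pos hz0)] with r hr
    have hr0 := hr.1
    have hr2 : r < ‖z₀‖ := by linarith [hr.2]
    have hr1 : r < 1 := hr2.trans hz₀1
    rw [circleIntegral_eq_integral_exp, norm_mul, Complex.norm_I, one_mul]
    have hbi : IntervalIntegrable (fun y => r * (2 / ‖z₀‖) * (C * (1 + 2 * |Real.log r| +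
        |Real.log (1 - r)|) + B + ‖L z₀‖ + C * |Real.log (Real.sin y)|)) volume 0 (2 * Real.pi) :=
      (intervalIntegrable_const.add ((intervalIntegrable_abs_log_sin _ _).const_mul C)).const_mul _
    refine (intervalIntegral.norm_integral_le_of_norm_le (by positivity) ?_ hbi).trans (le_of_eq ?_)
    · filter_upwards [ae_sin_ne_zero] with y hy _
      have hn := norm_mul_exp_I hr0.le y
      have hne : (r : ℂ) * Complex.exp (y * Complex.I) ≠ z₀ := by
        intro h
        rw [h] at hn
        exact hr2.ne' hn
      have hb := norm_le_on_circle hC him hre hr0 hr1 hy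
      rw [dslope_mul_eq hne, norm_mul, norm_div, hn]
      have hden : ‖z₀‖ / 2 ≤ ‖(r : ℂ) * Complex.exp (y * Complex.I) - z₀‖ := by
        have := norm_sub_norm_le z₀ ((r : ℂ) * Complex.exp (y * Complex.I))
        rw [norm_sub_rev, hn] at this
        linarith [hr.2]
      have hnum := (norm_sub_le (L (r * Complex.exp (y * Complex.I))) (L z₀)).trans
        (add_le_add_left hb _)
      have hnum0 := (norm_nonneg _).trans hnum
      calc _ ≤ (C * (1 + 2 * |Real.log r| + |Real.log (1 - r)|) + B +
            C * |Real.log (Real.sin y)| + ‖L z₀‖) * (r / (‖z₀‖ / 2)) := by gcongr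
        _ = _ := by field_simp; ring
    · rw [intervalIntegral.integral_const_mul, intervalIntegral.integral_add intervalIntegrable_const
        ((intervalIntegrable_abs_log_sin _ _).const_mul C), intervalIntegral.integral_const,
        intervalIntegral.integral_const_mul, ← hS, smul_eq_mul]
      ring
  · have t1 : Tendsto (fun r : ℝ => r) (𝓝[>] 0) (𝓝 0) := tendsto_id.mono_left nhdsWithin_le_nhds
    have t2 := tendsto_mul_abs_log_zero
    have t3 : Tendsto (fun r : ℝ => r * |Real.log (1 - r)|) (𝓝[>] 0) (𝓝 0) := by
      have : ContinuousAt (fun r : ℝ => r * |Real.log (1 - r)|) 0 := by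
        have : (1 : ℝ) - 0 ≠ 0 := by norm_num
        fun_prop (disch := assumption)
      have h := this.tendsto
      rw [zero_mul] at h
      exact h.mono_left nhdsWithin_le_nhds
    have := ((((((t1.add (t2.const_mul 2)).add t3).const_mul C).add
      (t1.mul_const (B + ‖L z₀‖))).const_mul (2 * Real.pi)).add
      (t1.mul_const (C * S))).const_mul (2 / ‖z₀‖)
    simpa using this

include hz₀ hz₀1 hdiff hconj hC him hre in
/-- Cauchy's formula in the disk slit along `[0, 1)`, for a function with logarithmic growth which
is symmetric with respect to the slit. -/
theorem slit_disc_cauchy {ℓ : ℝ → ℂ} (hlim : ∀ t ∈ Set.Ioo (0 : ℝ) 1,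
      Tendsto (fun φ : ℝ => L (t * Complex.exp (φ * Complex.I))) (𝓝[>] 0) (𝓝 (ℓ t)))
    (hcirc : CircleIntegrable L 0 1)
    (hℓ : IntervalIntegrable (fun τ : ℝ => ((ℓ τ).im : ℂ) / ((τ : ℂ) - z₀)) volume 0 1) :
    L z₀ = 1 / (2 * Real.pi * Complex.I) * (∮ ζ in C(0, 1), L ζ / (ζ - z₀)) +
      1 / Real.pi * ∫ τ in (0 : ℝ)..1, ((ℓ τ).im : ℂ) / ((τ : ℂ) - z₀) := by
  have hz0 : 0 < ‖z₀‖ := norm_pos_iff.mpr (ne_zero_of_mem_cutPlane hz₀)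
  have hpi : (Real.pi : ℂ) ≠ 0 := by exact_mod_cast Real.pi_pos.ne'
  have t0 : Tendsto (fun r : ℝ => ∫ t in r..1, 2 * Complex.I * (((ℓ t).im : ℂ) / (t - z₀)))
      (𝓝[>] 0) (𝓝 (∫ t in (0 : ℝ)..1, 2 * Complex.I * (((ℓ t).im : ℂ) / (t - z₀)))) := by
    have hi := (intervalIntegrable_iff_integrableOn_Icc_of_le zero_le_one).mp
      (hℓ.const_mul (2 * Complex.I))
    rw [← Set.uIcc_of_le zero_le_one] at hi
    have hc := intervalIntegral.continuousOn_primitive_interval_left hi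
    rw [Set.uIcc_of_le zero_le_one] at hc
    refine (hc 0 (Set.left_mem_Icc.mpr zero_le_one)).tendsto.comp
      (tendsto_nhdsWithin_iff.mpr ⟨tendsto_id.mono_left nhdsWithin_le_nhds, ?_⟩)
    filter_upwards [Ioo_mem_nhdsGT zero_lt_one] with r hr using ⟨hr.1.le, hr.2.le⟩
  have t1 := (t0.add_const (∮ ζ in C(0, 1), dslope L z₀ ζ)).sub
    (tendsto_small_circle hz₀ hz₀1 hC him hre)
  have hzero := tendsto_nhds_unique t1 (tendsto_const_nhds.congr' (by
    filter_upwards [Ioo_mem_nhdsGT hz0] with r hr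
    exact (slit_annulus_integral hz₀ hz₀1 hdiff hconj hC him hre hlim hcirc hr.1 hr.2).symm))
  have hzs : ∀ ζ ∈ Metric.sphere (0 : ℂ) 1, ζ - z₀ ≠ 0 := by
    intro ζ hζ h
    rw [mem_sphere_zero_iff_norm, sub_eq_zero.mp h] at hζ
    exact hz₀1.ne hζ
  have hci : CircleIntegrable (fun ζ => L ζ / (ζ - z₀)) 0 1 := by
    have hc : Continuous fun y : ℝ => (circleMap 0 1 y - z₀)⁻¹ :=
      Continuous.inv₀ (by fun_prop) fun y => hzs _ (circleMap_mem_sphere 0 zero_le_one y)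
    exact IntervalIntegrable.mul_continuousOn hcirc hc.continuousOn
  have hci2 : CircleIntegrable (fun ζ => L z₀ * (ζ - z₀)⁻¹) 0 1 := by
    refine ContinuousOn.circleIntegrable zero_le_one ?_
    exact continuousOn_const.mul (ContinuousOn.inv₀ (by fun_prop) hzs)
  -- Only on the outer circle is `dslope` split into the Cauchy integral of `L` and the constant
  -- part; the latter produces the term `2πi L z₀`.
  have hd : ∮ ζ in C(0, 1), dslope L z₀ ζ =
      (∮ ζ in C(0, 1), L ζ / (ζ - z₀)) - L z₀ * (2 * Real.pi * Complex.I) := by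
    rw [← circleIntegral.integral_sub_inv_of_mem_ball (c := 0) (R := 1) (w := z₀) (by simpa using hz₀1),
      ← circleIntegral.integral_const_mul, ← circleIntegral.integral_sub hci hci2]
    refine circleIntegral.integral_congr zero_le_one fun ζ hζ => ?_
    have hne := sub_ne_zero.mp (hzs ζ hζ)
    simp only [dslope_of_ne _ hne, slope_def_field]
    ring
  rw [hd, intervalIntegral.integral_const_mul, sub_zero] at hzero
  field_simp
  linear_combination (-1 : ℂ) * hzero

end

/-! ### Logarithmic bounds for `Q` in the disk and on the circle. -/

theorem abs_log_le_of_bounds {a₁ a₂ n x m q : ℝ} (ha₁ : 0 < a₁) (ha₂ : 0 < a₂) (hn : 0 < n)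
    (hx : 0 < x) (hm : 0 < m) (h1 : a₁ * (n ^ 2 * x * m) ≤ q) (h2 : q ≤ a₂ / (n ^ 2 * x * m)) :
    |Real.log q| ≤ (|Real.log a₁| + |Real.log a₂| + 2) *
      (1 + |Real.log n| + |Real.log x| + |Real.log m|) := by
  have hp : 0 < n ^ 2 * x * m := by positivity
  have hq : 0 < q := lt_of_lt_of_le (by positivity) h1
  have hlp : Real.log (n ^ 2 * x * m) = 2 * Real.log n + Real.log x + Real.log m := by
    rw [Real.log_mul (by positivity) hm.ne', Real.log_mul (by positivity) hx.ne', Real.log_pow]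
    push_cast
    ring
  have e1 := Real.log_le_log (by positivity) h1
  have e2 := Real.log_le_log hq h2
  rw [Real.log_mul ha₁.ne' hp.ne', hlp] at e1
  rw [Real.log_div ha₂.ne' hp.ne', hlp] at e2
  have p0 := abs_nonneg (Real.log a₁)
  have p1 := abs_nonneg (Real.log a₂)
  have p2 := abs_nonneg (Real.log n)
  have p3 := abs_nonneg (Real.log x)
  have p4 := abs_nonneg (Real.log m)
  have key : |Real.log q| ≤ |Real.log a₁| + |Real.log a₂| + 2 * |Real.log n| + |Real.log x| +
      |Real.log m| := by
    rw [abs_le]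
    constructor
    · linarith [neg_abs_le (Real.log a₁), neg_abs_le (Real.log n), neg_abs_le (Real.log x),
        neg_abs_le (Real.log m)]
    · linarith [le_abs_self (Real.log a₂), neg_abs_le (Real.log n), neg_abs_le (Real.log x),
        neg_abs_le (Real.log m)]
  refine key.trans ?_
  have := mul_nonneg (add_nonneg p0 p1) (add_nonneg (add_nonneg p2 p3) p4)
  nlinarith

/-- From below `|Q|` is bounded by `|Im Q|`, from above by the difference with `Q(-1)`. In both,
`|Im v| ≥ |Im z| (1 - ‖z‖)` and `‖v + 4‖ ≤ 4 / ‖z‖` turn the estimates in `v` into powers of `‖z‖`,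
`|Im z|` and `1 - ‖z‖`. -/
theorem exists_log_norm_fgnQ_bound {d : ℝ} (hd : -1 / 2 < d) (hd' : d < 1 / 2) (hd0 : d ≠ 0) :
    ∃ C, 0 ≤ C ∧ ∀ z : ℂ, z.im ≠ 0 → ‖z‖ < 1 → |Real.log ‖fgnQ d z‖| ≤
      C * (1 + |Real.log ‖z‖| + |Real.log z.im| + |Real.log (1 - ‖z‖)|) := by
  have hk := abs_pos.mpr (fgnConst_ne_zero hd hd' hd0)
  have hI := weight_integral_pos hd hd'
  set k := |fgnConst d| with hkdef
  set I := ∫ t in Set.Ioi (0 : ℝ), fgnWeight d t / (yval t + 4) ^ 2 with hIdef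
  set q₀ := ‖fgnQ d (-1)‖ with hq₀
  have hq₀0 : 0 ≤ q₀ := norm_nonneg _
  -- `4` comes from `1 + ‖v + 4‖ / 4 ≤ 2 / ‖z‖` squared, and `20 = 4 + 16` from multiplying out the
  -- upper bound with `‖v + 4‖ ≤ 4 / ‖z‖`; the `+ 1` ensures room for the remaining inequalities.
  refine ⟨|Real.log (k * I / 4)| + |Real.log (q₀ + 20 * (k * I) + 1)| + 2, by positivity,
    fun z him hz1 => ?_⟩
  · have hzc : z ∈ cutPlane := Or.inr him
    have hn : 0 < ‖z‖ := norm_pos_iff.mpr (ne_zero_of_mem_cutPlane hzc)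
    rw [← Real.log_abs z.im]
    have hx : 0 < |z.im| := abs_pos.mpr him
    have hxn : |z.im| ≤ ‖z‖ := Complex.abs_im_le_norm z
    have hm : 0 < 1 - ‖z‖ := by linarith
    have hJ : |(jouk z).im| = |z.im| * ((1 - ‖z‖) * (1 + ‖z‖) / ‖z‖ ^ 2) := by
      have e : (jouk z).im = -(z.im * ((1 - ‖z‖) * (1 + ‖z‖) / ‖z‖ ^ 2)) := by
        rw [jouk_im]
        field_simp
        ring
      rw [e, abs_neg, abs_mul, abs_of_pos (a := (1 - ‖z‖) * (1 + ‖z‖) / ‖z‖ ^ 2) (by positivity)]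
    have hJ0 : |z.im| * (1 - ‖z‖) ≤ |(jouk z).im| := by
      rw [hJ]
      refine mul_le_mul_of_nonneg_left ?_ hx.le
      rw [le_div_iff₀ (by positivity)]
      have : ‖z‖ ^ 2 ≤ 1 + ‖z‖ := by nlinarith
      gcongr
    have hJpos : 0 < |(jouk z).im| := lt_of_lt_of_le (by positivity) hJ0
    have hw : ‖jouk z + 4‖ ≤ 4 / ‖z‖ := by
      have e : jouk z + 4 = z⁻¹ + 2 + z := by rw [jouk]; ring
      rw [e]
      refine (norm_add₃_le).trans ?_
      rw [norm_inv, le_div_iff₀ hn]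
      have : ‖(2 : ℂ)‖ = 2 := by simp
      rw [this]
      have h1 : ‖z‖⁻¹ * ‖z‖ = 1 := inv_mul_cancel₀ hn.ne'
      nlinarith
    refine abs_log_le_of_bounds (a₁ := k * I / 4) (a₂ := q₀ + 20 * (k * I) + 1) (by positivity)
      (by positivity) hn hx hm ?_ ?_
    · have h := (le_abs_im_fgnQ hd hd' hzc).trans (Complex.abs_im_le_norm _)
      refine le_trans ?_ h
      have h1 : 1 + ‖jouk z + 4‖ / 4 ≤ 2 / ‖z‖ := by
        have : 1 ≤ 1 / ‖z‖ := by rw [le_div_iff₀ hn]; linarith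
        calc 1 + ‖jouk z + 4‖ / 4 ≤ 1 / ‖z‖ + 4 / ‖z‖ / 4 := by gcongr
          _ = 2 / ‖z‖ := by ring
      calc k * I / 4 * (‖z‖ ^ 2 * |z.im| * (1 - ‖z‖))
          = k * ((|z.im| * (1 - ‖z‖)) * (I / (2 / ‖z‖) ^ 2)) := by field_simp; norm_num
        _ ≤ _ := by gcongr
    · refine (norm_fgnQ_le hd hd' hzc (abs_pos.mp hJpos)).trans ?_
      rw [le_div_iff₀ (by positivity)]
      have hp1 : ‖z‖ ^ 2 * |z.im| * (1 - ‖z‖) ≤ 1 := by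
        have a1 : ‖z‖ ^ 2 ≤ 1 := pow_le_one₀ hn.le hz1.le
        have a2 : |z.im| ≤ 1 := hxn.trans hz1.le
        have a3 : 1 - ‖z‖ ≤ 1 := by linarith
        calc ‖z‖ ^ 2 * |z.im| * (1 - ‖z‖) ≤ 1 * 1 * 1 := by gcongr
          _ = 1 := by norm_num
      have hb : ‖jouk z + 4‖ * ((1 + ‖jouk z + 4‖ / |(jouk z).im|) * I) ≤
          (4 / ‖z‖) * ((1 + (4 / ‖z‖) / (|z.im| * (1 - ‖z‖))) * I) := by
        gcongr
      have hc : (4 / ‖z‖) * ((1 + (4 / ‖z‖) / (|z.im| * (1 - ‖z‖))) * I) *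
          (‖z‖ ^ 2 * |z.im| * (1 - ‖z‖)) ≤ 20 * I := by
        have e : (4 / ‖z‖) * ((1 + (4 / ‖z‖) / (|z.im| * (1 - ‖z‖))) * I) *
          (‖z‖ ^ 2 * |z.im| * (1 - ‖z‖)) = (4 * (‖z‖ * |z.im| * (1 - ‖z‖)) + 16) * I := by
          field_simp
          ring
        rw [e]
        have a2 : |z.im| ≤ 1 := hxn.trans hz1.le
        have a3 : 1 - ‖z‖ ≤ 1 := by linarith
        have : ‖z‖ * |z.im| * (1 - ‖z‖) ≤ 1 * 1 * 1 := by gcongr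
        have : 4 * (‖z‖ * |z.im| * (1 - ‖z‖)) + 16 ≤ 20 := by linarith
        gcongr
      have hp0 : 0 < ‖z‖ ^ 2 * |z.im| * (1 - ‖z‖) := by positivity
      have h3 := mul_le_mul_of_nonneg_right hb hp0.le
      have h4 := mul_le_mul_of_nonneg_left (h3.trans hc) hk.le
      have h5 : q₀ * (‖z‖ ^ 2 * |z.im| * (1 - ‖z‖)) ≤ q₀ := mul_le_of_le_one_right hq₀0 hp1
      nlinarith

theorem fgnQ_circle_ofReal {d : ℝ} (hd : -1 / 2 < d) (hd' : d < 1 / 2) {z : ℂ} (hz : ‖z‖ = 1)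
    (hz1 : z ≠ 1) : fgnQ d z = ((fgnQ d z).re : ℂ) :=
  Complex.ext rfl (by
    simpa using fgnQ_im_eq_zero hd hd' (mem_cutPlane_of_norm_eq_one hz hz1) (jouk_of_norm_eq_one hz))

theorem circleMap_mem_cutPlane {y : ℝ} (hy : y ∈ Set.Ioo 0 (2 * Real.pi)) :
    circleMap 0 1 y ∈ cutPlane := by
  have := mul_exp_mem_cutPlane one_pos hy.1 hy.2
  simpa [circleMap] using this

theorem cutPlane_ne_one {z : ℂ} (hz : z ∈ cutPlane) : z ≠ 1 := by
  rintro rfl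
  rcases hz with h | h <;> norm_num at h

theorem ae_circleMap_mem_cutPlane :
    ∀ᵐ y ∂(volume.restrict (Set.uIoc 0 (2 * Real.pi))), circleMap 0 1 y ∈ cutPlane := by
  have hpi := Real.pi_pos
  rw [Set.uIoc_of_le (by positivity), Measure.restrict_congr_set Ioo_ae_eq_Ioc.symm]
  filter_upwards [ae_restrict_mem measurableSet_Ioo] with y hy using circleMap_mem_cutPlane hy

/-- Off `ζ = 1`, `Q` is positive on the circle and lies between multiples of `‖1 - ζ‖²` and `‖1 -
ζ‖⁻²`, so its logarithm is real and dominated by `|log ‖ζ - 1‖|` plus a constant. -/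
theorem circleIntegrable_log_fgnQ {d : ℝ} (hd : -1 / 2 < d) (hd' : d < 1 / 2) (hd0 : d ≠ 0) :
    CircleIntegrable (fun ζ => Complex.log (fgnQ d ζ)) 0 1 := by
  have hpi := Real.pi_pos
  obtain ⟨c, hc, C, hC, hb⟩ := fgnQ_circle_bounds hd hd' hd0
  have hlog : CircleIntegrable (fun ζ : ℂ => Real.log ‖ζ - 1‖) 0 1 :=
    circleIntegrable_log_norm_sub_const 1
  have hq : ∀ y ∈ Set.Ioo 0 (2 * Real.pi), 0 < (fgnQ d (circleMap 0 1 y)).re ∧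
      fgnQ d (circleMap 0 1 y) = ((fgnQ d (circleMap 0 1 y)).re : ℂ) ∧
      |Real.log (fgnQ d (circleMap 0 1 y)).re| ≤
        |Real.log c| + |Real.log C| + 2 * |Real.log ‖circleMap 0 1 y - 1‖| := by
    intro y hy
    have h1 := cutPlane_ne_one (circleMap_mem_cutPlane hy)
    have hn : ‖circleMap 0 1 y‖ = 1 := by simp
    obtain ⟨b1, b2⟩ := hb _ hn h1
    have hr : 0 < ‖1 - circleMap 0 1 y‖ := norm_pos_iff.mpr (sub_ne_zero.mpr h1.symm)
    have hpos := lt_of_lt_of_le (by positivity) b1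
    refine ⟨hpos, fgnQ_circle_ofReal hd hd' hn h1, ?_⟩
    rw [norm_sub_rev (circleMap 0 1 y)]
    have e1 := Real.log_le_log (by positivity) b1
    have e2 := Real.log_le_log hpos b2
    rw [Real.log_mul hc.ne' (by positivity), Real.log_pow] at e1
    rw [Real.log_div hC.ne' (by positivity), Real.log_pow] at e2
    push_cast at e1 e2
    have := abs_nonneg (Real.log c)
    have := abs_nonneg (Real.log C)
    rw [abs_le]
    constructor
    · linarith [neg_abs_le (Real.log c), neg_abs_le (Real.log ‖1 - circleMap 0 1 y‖)]
    · linarith [le_abs_self (Real.log C), neg_abs_le (Real.log ‖1 - circleMap 0 1 y‖)]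
  refine IntervalIntegrable.mono_fun' (g := fun y => |Real.log c| + |Real.log C| +
    2 * |Real.log ‖circleMap 0 1 y - 1‖|) ?_ ?_ ?_
  · have h : IntervalIntegrable (fun y => Real.log ‖circleMap 0 1 y - 1‖) volume 0 (2 * Real.pi) :=
      hlog
    exact intervalIntegrable_const.add (h.abs.const_mul 2)
  · rw [Set.uIoc_of_le (by positivity), Measure.restrict_congr_set Ioo_ae_eq_Ioc.symm]
    refine ContinuousOn.aestronglyMeasurable ?_ measurableSet_Ioo
    intro y hy
    have hQ := (differentiableAt_fgnQ hd' (circleMap_mem_cutPlane hy)).continuousAt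
    have hQ2 : ContinuousAt (fun y => fgnQ d (circleMap 0 1 y)) y :=
      ContinuousAt.comp (f := circleMap 0 1) hQ (continuous_circleMap 0 1).continuousAt
    exact (hQ2.clog (Or.inl (hq y hy).1)).continuousWithinAt
  · rw [Set.uIoc_of_le (by positivity), Measure.restrict_congr_set Ioo_ae_eq_Ioc.symm]
    filter_upwards [ae_restrict_mem measurableSet_Ioo] with y hy
    obtain ⟨h1, h2, h3⟩ := hq y hy
    rw [h2, ← Complex.ofReal_log h1.le, Complex.norm_real, Real.norm_eq_abs]
    exact h3

theorem circleIntegrable_div_sub {g : ℂ → ℂ} (hg : CircleIntegrable g 0 1) {z : ℂ} (hz : ‖z‖ ≠ 1) :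
    CircleIntegrable (fun ζ => g ζ / (ζ - z)) 0 1 := by
  have hc : Continuous fun y : ℝ => (circleMap 0 1 y - z)⁻¹ := by
    refine Continuous.inv₀ (by fun_prop) fun y h => hz ?_
    rw [← sub_eq_zero.mp h]
    simp
  exact IntervalIntegrable.mul_continuousOn hg hc.continuousOn

/-! ### The function `X₀` and the factorisation. -/

theorem tendsto_fgnQ_arc {d : ℝ} (hd' : d < 1 / 2) {t : ℝ} (ht : t ∈ Set.Ioo (0 : ℝ) 1) :
    Tendsto (fun φ : ℝ => fgnQ d (t * Complex.exp (φ * Complex.I))) (𝓝[>] 0)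
      (𝓝 (fgnQPlus d t)) :=
  (tendsto_fgnQPlus hd' ht).comp (tendsto_mul_exp_I ht.1)

/-- `Q⁺` is the pointwise limit of the continuous functions `t ↦ Q(t e ^ (iφ))` along the angles `φ
= 1 / (n + 1)`. -/
theorem aemeasurable_fgnQPlus {d : ℝ} (hd' : d < 1 / 2) :
    AEMeasurable (fgnQPlus d) (volume.restrict (Set.Ioo 0 1)) := by
  have hseq : Tendsto (fun n : ℕ => 1 / ((n : ℝ) + 1)) atTop (𝓝[>] 0) :=
    tendsto_nhdsWithin_iff.mpr ⟨tendsto_one_div_add_atTop_nhds_zero_nat,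
      Eventually.of_forall fun n => by
        have : (0 : ℝ) < 1 / ((n : ℝ) + 1) := by positivity
        exact this⟩
  refine (aestronglyMeasurable_of_tendsto_ae atTop (f := fun (n : ℕ) (t : ℝ) =>
    fgnQ d (t * Complex.exp ((1 / ((n : ℝ) + 1) : ℝ) * Complex.I))) (fun n => ?_) ?_).aemeasurable
  · refine ContinuousOn.aestronglyMeasurable ?_ measurableSet_Ioo
    intro t ht
    have h0 : (0 : ℝ) < 1 / ((n : ℝ) + 1) := by positivity
    have h1 : 1 / ((n : ℝ) + 1) ≤ 1 := by
      rw [div_le_one (by positivity)]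
      linarith [(Nat.cast_nonneg n : (0 : ℝ) ≤ n)]
    have hz := mul_exp_mem_cutPlane ht.1 h0 (by linarith [Real.pi_gt_three])
    exact (ContinuousAt.comp (f := fun t : ℝ =>
      (t : ℂ) * Complex.exp ((1 / ((n : ℝ) + 1) : ℝ) * Complex.I))
      (differentiableAt_fgnQ hd' hz).continuousAt (by fun_prop)).continuousWithinAt
  · filter_upwards [ae_restrict_mem measurableSet_Ioo] with t ht
    exact (tendsto_fgnQ_arc hd' ht).comp hseq

theorem aestronglyMeasurable_arg_fgnQPlus {d : ℝ} (hd' : d < 1 / 2) :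
    AEStronglyMeasurable (fun τ => ((fgnQPlus d τ).arg : ℂ)) (volume.restrict (Set.uIoc 0 1)) := by
  rw [Set.uIoc_of_le zero_le_one, Measure.restrict_congr_set Ioo_ae_eq_Ioc.symm]
  exact (Complex.measurable_ofReal.comp_aemeasurable
    (Complex.measurable_arg.comp_aemeasurable (aemeasurable_fgnQPlus hd'))).aestronglyMeasurable

theorem intervalIntegrable_arg_fgnQPlus {d : ℝ} (hd' : d < 1 / 2) :
    IntervalIntegrable (fun τ => ((fgnQPlus d τ).arg : ℂ)) volume 0 1 := by
  refine IntervalIntegrable.mono_fun' (g := fun _ => Real.pi) intervalIntegrable_const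
    (aestronglyMeasurable_arg_fgnQPlus hd') (Eventually.of_forall fun τ => ?_)
  change ‖((fgnQPlus d τ).arg : ℂ)‖ ≤ Real.pi
  rw [Complex.norm_real, Real.norm_eq_abs]
  exact Complex.abs_arg_le_pi _

theorem intervalIntegrable_arg_div {d : ℝ} (hd' : d < 1 / 2) {z : ℂ}
    (hz : ∀ x ∈ Set.Icc (0 : ℝ) 1, z ≠ x) :
    IntervalIntegrable (fun τ : ℝ => ((fgnQPlus d τ).arg : ℂ) / ((τ : ℂ) - z)) volume 0 1 := by
  have hc : ContinuousOn (fun τ : ℝ => ((τ : ℂ) - z)⁻¹) (Set.uIcc 0 1) := by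
    rw [Set.uIcc_of_le zero_le_one]
    exact ContinuousOn.inv₀ (by fun_prop) fun x hx => sub_ne_zero.mpr (hz x hx).symm
  exact (intervalIntegrable_arg_fgnQPlus hd').mul_continuousOn hc

theorem cutPlane_ne_Icc {z : ℂ} (hz : z ∈ cutPlane) : ∀ x ∈ Set.Icc (0 : ℝ) 1, z ≠ x := by
  rintro x hx rfl
  rcases hz with h | h
  · simp only [Complex.ofReal_re] at h
    linarith [hx.1]
  · simp at h

/-- Dominated convergence, with `|arg| ≤ π` and a positive distance to the slit. Continuity at `s₀`
identifies the limit of the right-hand side there. -/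
theorem continuousAt_fgnX0 {d : ℝ} (hd' : d < 1 / 2) {z : ℂ} (hz : z ∈ cutPlane) :
    ContinuousAt (fgnX0 d) z := by
  have hint : ContinuousAt (fun z : ℂ => ∫ τ in (0 : ℝ)..1,
      ((fgnQPlus d τ).arg : ℂ) / ((τ : ℂ) - z)) z := by
    obtain ⟨δ, hδ, hdist⟩ := exists_dist_slit hz
    refine intervalIntegral.continuousAt_of_dominated_interval
      (bound := fun _ => Real.pi / (δ / 2)) ?_ ?_ intervalIntegrable_const ?_
    · filter_upwards [isOpen_cutPlane.mem_nhds hz] with w hw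
      exact (intervalIntegrable_arg_div hd' (cutPlane_ne_Icc hw)).def'.aestronglyMeasurable
    · filter_upwards [Metric.ball_mem_nhds z (half_pos hδ)] with w hw
      refine Eventually.of_forall fun τ hτ => ?_
      rw [Set.uIoc_of_le zero_le_one] at hτ
      have h1 := hdist τ ⟨hτ.1.le, hτ.2⟩ 0 (by simpa using hδ.le)
      simp only [Complex.ofReal_zero, zero_mul, Complex.exp_zero, mul_one] at h1
      have h2 : ‖w - z‖ < δ / 2 := by simpa [dist_eq_norm] using hw
      have h3 : δ / 2 ≤ ‖(τ : ℂ) - w‖ := by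
        have := norm_add_le ((τ : ℂ) - w) (w - z)
        rw [sub_add_sub_cancel] at this
        linarith
      rw [norm_div, Complex.norm_real, Real.norm_eq_abs]
      have := Complex.abs_arg_le_pi (fgnQPlus d τ)
      gcongr
    · refine Eventually.of_forall fun τ hτ => ?_
      rw [Set.uIoc_of_le zero_le_one] at hτ
      have hne : (τ : ℂ) - z ≠ 0 := sub_ne_zero.mpr (cutPlane_ne_Icc hz τ ⟨hτ.1.le, hτ.2⟩).symm
      fun_prop (disch := assumption)
  unfold fgnX0
  fun_prop

/-- Cauchy's formula for `log N` writes it as minus the exponent of `ψ` plus the exponent of `X₀`,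
once the circle integral for `N` is known to agree with that for `Q`. -/
theorem fgnX0_eq_of_cauchy {d : ℝ} {N : ℂ → ℂ} {z : ℂ} (hN : N z ≠ 0)
    (hcirc : ∮ ζ in C(0, 1), Complex.log (N ζ) / (ζ - z) =
      ∮ ζ in C(0, 1), Complex.log (fgnQ d ζ) / (ζ - z))
    (h : Complex.log (N z) = 1 / (2 * Real.pi * Complex.I) *
      (∮ ζ in C(0, 1), Complex.log (N ζ) / (ζ - z)) +
      1 / Real.pi * ∫ τ in (0 : ℝ)..1, ((fgnQPlus d τ).arg : ℂ) / ((τ : ℂ) - z)) :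
    fgnX0 d z = fgnPsi d z * N z := by
  rw [fgnX0, fgnPsi]
  conv_rhs => rw [← Complex.exp_log hN, ← Complex.exp_add, h, hcirc]
  congr 1
  ring

theorem fgnX0_eq_of_neg {d : ℝ} (hd : -1 / 2 < d) (hd0 : d < 0) {z : ℂ} (hz : z ∈ cutPlane)
    (hz1 : ‖z‖ < 1) : fgnX0 d z = fgnPsi d z * fgnQ d z := by
  have hd' : d < 1 / 2 := by linarith
  have hsl : ∀ w ∈ cutPlane, fgnQ d w ∈ Complex.slitPlane := fun w hw =>
    fgnQ_mem_slitPlane_of_neg hd hd0 hw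
  obtain ⟨C, hC, hCb⟩ := exists_log_norm_fgnQ_bound hd hd' hd0.ne
  refine fgnX0_eq_of_cauchy (Complex.slitPlane_ne_zero (hsl z hz)) rfl ?_
  have hcauchy := slit_disc_cauchy (L := fun w => Complex.log (fgnQ d w)) hz hz1
    (fun w hw _ => (differentiableAt_fgnQ hd' hw).clog (hsl w hw))
    (fun w hw _ => by
      simp only [fgnQ_conj]
      exact Complex.log_conj _ (Complex.slitPlane_arg_ne_pi (hsl w hw)))
    hC (B := Real.pi) (fun w => by simpa only [Complex.log_im] using Complex.abs_arg_le_pi _)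
    (fun w hw hw1 => by simpa only [Complex.log_re] using hCb w hw hw1)
    (ℓ := fun t => Complex.log (fgnQPlus d t))
    (fun t ht => (tendsto_fgnQ_arc hd' ht).clog (Or.inr (fgnQPlus_im_ne_zero hd hd' hd0.ne ht)))
    (circleIntegrable_log_fgnQ hd hd' hd0.ne)
    (by simpa only [Complex.log_im] using intervalIntegrable_arg_div hd' (cutPlane_ne_Icc hz))
  simpa only [Complex.log_im] using hcauchy

theorem one_sub_mul_mem_slitPlane {s : ℝ} (hs : s ∈ Set.Ioo (-1 : ℝ) 0) {w : ℂ} (hw : ‖w‖ ≤ 1) :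
    1 - s * w ∈ Complex.slitPlane := by
  left
  have h1 : |w.re| ≤ 1 := (Complex.abs_re_le_norm w).trans hw
  have h2 := neg_le_of_abs_le h1
  simp only [Complex.sub_re, Complex.one_re, Complex.re_ofReal_mul]
  nlinarith [hs.1, hs.2]

theorem div_sub_eq_inv {s : ℝ} {ζ : ℂ} (hζ : ζ ≠ 0) : ζ / (ζ - s) = (1 - s * ζ⁻¹)⁻¹ := by
  rw [show ζ - s = ζ * (1 - s * ζ⁻¹) by field_simp, ← div_div, div_self hζ, one_div]

theorem inv_mem_slitPlane {w : ℂ} (hw : w ∈ Complex.slitPlane) : w⁻¹ ∈ Complex.slitPlane := by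
  have hn := Complex.normSq_pos.mpr (Complex.slitPlane_ne_zero hw)
  rcases hw with h | h
  · left
    rw [Complex.inv_re]
    positivity
  · right
    rw [Complex.inv_im]
    exact div_ne_zero (neg_ne_zero.mpr h) hn.ne'

/-- `log (ζ / (ζ - s))` is holomorphic outside the disk and vanishes at infinity. The inversion `w =
ζ⁻¹`, under which circle averages are invariant, turns the claim into the mean value property of a
function `h` holomorphic on the closed disk with `h 0 = 0`. -/
theorem circleIntegral_log_div_sub {s : ℝ} (hs : s ∈ Set.Ioo (-1 : ℝ) 0) {z : ℂ} (hz : ‖z‖ < 1) :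
    ∮ ζ in C(0, 1), Complex.log (ζ / (ζ - s)) / (ζ - z) = 0 := by
  have hpi : (2 * Real.pi * Complex.I : ℂ) ≠ 0 := Complex.two_pi_I_ne_zero
  let h : ℂ → ℂ := fun w => Complex.log (1 - s * w)⁻¹ / (1 - z * w)
  have hne : ∀ w : ℂ, ‖w‖ ≤ 1 → 1 - z * w ≠ 0 := by
    intro w hw h0
    have h1 : ‖z * w‖ = 1 := by rw [← sub_eq_zero.mp h0, norm_one]
    rw [norm_mul] at h1
    nlinarith [norm_nonneg z, norm_nonneg w]
  have hd : ∀ w : ℂ, ‖w‖ ≤ 1 → DifferentiableAt ℂ h w := by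
    intro w hw
    have h1 := one_sub_mul_mem_slitPlane hs hw
    have h2 : DifferentiableAt ℂ (fun w : ℂ => (1 - s * w)⁻¹) w :=
      DifferentiableAt.inv (by fun_prop) (Complex.slitPlane_ne_zero h1)
    exact (h2.clog (inv_mem_slitPlane h1)).div (by fun_prop) (hne w hw)
  have hav : Real.circleAverage h 0 1 = 0 := by
    have hdc : DiffContOnCl ℂ h (Metric.ball 0 |1|) := by
      refine DifferentiableOn.diffContOnCl fun w hw => ?_
      rw [abs_one, closure_ball 0 one_ne_zero, mem_closedBall_zero_iff] at hw
      exact (hd w hw).differentiableWithinAt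
    rw [hdc.circleAverage]
    simp [h]
  have hav2 : Real.circleAverage (fun ζ => ζ * (Complex.log (ζ / (ζ - s)) / (ζ - z))) 0 1 = 0 := by
    refine Eq.trans ?_ (Real.circleAverage_zero_one_congr_inv.trans hav)
    refine Real.circleAverage_congr_sphere fun w hw => ?_
    have hw1 : ‖w‖ = 1 := by simpa using hw
    have hw0 : w ≠ 0 := norm_pos_iff.mp (by rw [hw1]; exact one_pos)
    have hzw := hne w⁻¹ (by rw [norm_inv, hw1, inv_one])
    simp only [h]
    rw [div_sub_eq_inv hw0, show w - z = w * (1 - z * w⁻¹) by field_simp, ← mul_div_assoc,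
      mul_div_mul_left _ _ hw0]
  rw [Real.circleAverage_eq_circleIntegral one_ne_zero] at hav2
  have h3 := (smul_eq_zero.mp hav2).resolve_left (inv_ne_zero hpi)
  refine Eq.trans ?_ h3
  refine circleIntegral.integral_congr zero_le_one fun ζ hζ => ?_
  have hζ0 : ζ ≠ 0 := norm_pos_iff.mp (by
    rw [mem_sphere_zero_iff_norm.mp hζ]; exact one_pos)
  simp only [sub_zero, smul_eq_mul]
  field_simp

theorem abs_log_norm_sub_le {s : ℝ} (hs : s ∈ Set.Ioo (-1 : ℝ) 0) {z : ℂ} (him : z.im ≠ 0)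
    (hz1 : ‖z‖ < 1) : |Real.log ‖z - s‖| ≤ |Real.log z.im| + 1 := by
  have hx : 0 < |z.im| := abs_pos.mpr him
  have h1 : |z.im| ≤ ‖z - s‖ := by simpa using Complex.abs_im_le_norm (z - s)
  have h2 : ‖z - s‖ ≤ 2 := by
    refine (norm_sub_le _ _).trans ?_
    rw [Complex.norm_real, Real.norm_eq_abs, abs_of_neg hs.2]
    linarith [hs.1]
  have h3 := Real.log_le_log hx h1
  have h4 := Real.log_le_log (hx.trans_le h1) h2
  have h5 := Real.log_two_lt_d9
  rw [Real.log_abs] at h3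
  rw [abs_le]
  constructor
  · linarith [neg_abs_le (Real.log z.im)]
  · linarith [abs_nonneg (Real.log z.im)]

theorem exists_log_norm_fgnQuot_bound {d s : ℝ} (hd0 : 0 < d) (hd' : d < 1 / 2)
    (hs : s ∈ Set.Ioo (-1 : ℝ) 0) (hs0 : fgnQ d s = 0) :
    ∃ C, 0 ≤ C ∧ ∀ z : ℂ, z.im ≠ 0 → ‖z‖ < 1 → |Real.log ‖fgnQuot d s z‖| ≤
      C * (1 + |Real.log ‖z‖| + |Real.log z.im| + |Real.log (1 - ‖z‖)|) := by
  obtain ⟨C, hC, hCb⟩ := exists_log_norm_fgnQ_bound (by linarith) hd' hd0.ne'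
  refine ⟨C + 1, by positivity, fun z him hz1 => ?_⟩
  have hne : z ≠ s := by
    rintro rfl
    simp at him
  have hN := Complex.slitPlane_ne_zero (fgnQuot_mem_slitPlane hd0 hd' hs hs0 (Or.inr him) hz1.le)
  have hz0 := ne_zero_of_mem_cutPlane (Or.inr him)
  rw [fgnQuot_of_ne hs0 hne] at hN ⊢
  have h1 := hCb z him hz1
  have h2 := abs_log_norm_sub_le hs him hz1
  rw [norm_mul, norm_div, Real.log_mul (norm_ne_zero_iff.mpr (left_ne_zero_of_mul hN))
    (div_ne_zero (norm_ne_zero_iff.mpr hz0) (norm_ne_zero_iff.mpr (sub_ne_zero.mpr hne))),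
    Real.log_div (norm_ne_zero_iff.mpr hz0) (norm_ne_zero_iff.mpr (sub_ne_zero.mpr hne))]
  have h3 := abs_add_le (Real.log ‖fgnQ d z‖) (Real.log ‖z‖ - Real.log ‖z - s‖)
  have h4 := abs_sub (Real.log ‖z‖) (Real.log ‖z - s‖)
  have h5 := abs_nonneg (Real.log (1 - ‖z‖))
  linarith

/-- On the slit the extra factor tends to the positive number `t / (t - s)`, which changes only the
real part of the logarithm; the jump is still governed by `arg Q⁺`. -/
theorem tendsto_log_fgnQuot_arc {d s : ℝ} (hd0 : 0 < d) (hd' : d < 1 / 2)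
    (hs : s ∈ Set.Ioo (-1 : ℝ) 0) (hs0 : fgnQ d s = 0) {t : ℝ} (ht : t ∈ Set.Ioo (0 : ℝ) 1) :
    Tendsto (fun φ : ℝ => Complex.log (fgnQuot d s (t * Complex.exp (φ * Complex.I)))) (𝓝[>] 0)
      (𝓝 (Real.log (t / (t - s)) + Complex.log (fgnQPlus d t))) := by
  have him := fgnQPlus_im_ne_zero (by linarith) hd' hd0.ne' ht
  have hts : 0 < t - s := by linarith [ht.1, hs.2]
  have hr : 0 < t / (t - s) := div_pos ht.1 hts
  have hts' : (t : ℂ) - s ≠ 0 := by exact_mod_cast hts.ne'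
  have hw : Tendsto (fun φ : ℝ => (t : ℂ) * Complex.exp (φ * Complex.I)) (𝓝[>] 0) (𝓝 t) :=
    (tendsto_mul_exp_I ht.1).mono_right nhdsWithin_le_nhds
  have hQ0 : fgnQPlus d t ≠ 0 := fun h => him (by rw [h, Complex.zero_im])
  have hlim := (tendsto_fgnQ_arc hd' ht).mul (hw.div (hw.sub_const (s : ℂ)) hts')
  rw [← Complex.log_mul_ofReal _ hr _ hQ0]
  push_cast
  refine Tendsto.clog (Tendsto.congr' ?_ hlim) (Or.inr ?_)
  · filter_upwards [hw.eventually_ne (sub_ne_zero.mp hts')] with φ hφ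
    rw [fgnQuot_of_ne hs0 hφ]
    rfl
  · rw [← Complex.ofReal_sub, ← Complex.ofReal_div, Complex.im_mul_ofReal]
    exact mul_ne_zero him hr.ne'

/-- The principal logarithm is additive here because `Q` is a positive real on the circle. -/
theorem log_fgnQuot_circle {d s : ℝ} (hd0 : 0 < d) (hd' : d < 1 / 2)
    (hs : s ∈ Set.Ioo (-1 : ℝ) 0) (hs0 : fgnQ d s = 0) {ζ : ℂ} (hζ : ‖ζ‖ = 1) (hζ1 : ζ ≠ 1) :
    Complex.log (fgnQuot d s ζ) = Complex.log (fgnQ d ζ) + Complex.log (ζ / (ζ - s)) := by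
  have hd : -1 / 2 < d := by linarith
  obtain ⟨c, hc, C, hC, hb⟩ := fgnQ_circle_bounds hd hd' hd0.ne'
  have h1 : 0 < ‖1 - ζ‖ := norm_pos_iff.mpr (sub_ne_zero.mpr hζ1.symm)
  have hpos : 0 < (fgnQ d ζ).re := lt_of_lt_of_le (by positivity) (hb ζ hζ hζ1).1
  have hζ0 : ζ ≠ 0 := ne_zero_of_norm_ne_zero (by rw [hζ]; exact one_ne_zero)
  have hne : ζ ≠ s := by
    rintro rfl
    rw [Complex.norm_real, Real.norm_eq_abs, abs_of_neg hs.2] at hζ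
    linarith [hs.1]
  rw [fgnQuot_of_ne hs0 hne, fgnQ_circle_ofReal hd hd' hζ hζ1,
    Complex.log_ofReal_mul hpos (div_ne_zero hζ0 (sub_ne_zero.mpr hne)), Complex.ofReal_log hpos.le]

theorem continuousOn_log_div_sub {s : ℝ} (hs : s ∈ Set.Ioo (-1 : ℝ) 0) :
    ContinuousOn (fun ζ : ℂ => Complex.log (ζ / (ζ - s))) (Metric.sphere 0 1) := by
  intro ζ hζ
  have hζ1 : ‖ζ‖ = 1 := mem_sphere_zero_iff_norm.mp hζ
  have hζ0 : ζ ≠ 0 := ne_zero_of_norm_ne_zero (by rw [hζ1]; exact one_ne_zero)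
  have hm : ζ / (ζ - s) ∈ Complex.slitPlane := by
    rw [div_sub_eq_inv hζ0]
    exact inv_mem_slitPlane (one_sub_mul_mem_slitPlane hs (by rw [norm_inv, hζ1, inv_one]))
  have hne : ζ - s ≠ 0 := (div_ne_zero_iff.mp (Complex.slitPlane_ne_zero hm)).2
  have hc : ContinuousAt (fun ζ : ℂ => ζ / (ζ - s)) ζ := by fun_prop (disch := exact hne)
  exact (hc.clog hm).continuousWithinAt

theorem circleIntegrable_log_fgnQuot {d s : ℝ} (hd0 : 0 < d) (hd' : d < 1 / 2)
    (hs : s ∈ Set.Ioo (-1 : ℝ) 0) (hs0 : fgnQ d s = 0) :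
    CircleIntegrable (fun ζ => Complex.log (fgnQuot d s ζ)) 0 1 := by
  have h : CircleIntegrable
      ((fun ζ => Complex.log (fgnQ d ζ)) + fun ζ => Complex.log (ζ / (ζ - s))) 0 1 :=
    (circleIntegrable_log_fgnQ (by linarith) hd' hd0.ne').add
      ((continuousOn_log_div_sub hs).circleIntegrable zero_le_one)
  refine IntervalIntegrable.congr_ae h ?_
  filter_upwards [ae_circleMap_mem_cutPlane] with y hy
  exact (log_fgnQuot_circle hd0 hd' hs hs0 (by simp) (cutPlane_ne_one hy)).symm

theorem circleIntegral_log_fgnQuot {d s : ℝ} (hd0 : 0 < d) (hd' : d < 1 / 2)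
    (hs : s ∈ Set.Ioo (-1 : ℝ) 0) (hs0 : fgnQ d s = 0) {z : ℂ} (hz : ‖z‖ < 1) :
    ∮ ζ in C(0, 1), Complex.log (fgnQuot d s ζ) / (ζ - z) =
      ∮ ζ in C(0, 1), Complex.log (fgnQ d ζ) / (ζ - z) := by
  have h := circleIntegral.integral_add
    (circleIntegrable_div_sub
      (circleIntegrable_log_fgnQ (by linarith : -1 / 2 < d) hd' hd0.ne') hz.ne)
    (circleIntegrable_div_sub
      ((continuousOn_log_div_sub hs).circleIntegrable zero_le_one) hz.ne)
  rw [circleIntegral_log_div_sub hs hz, add_zero] at h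
  rw [← h]
  refine intervalIntegral.integral_congr_ae_restrict ?_
  filter_upwards [ae_circleMap_mem_cutPlane] with y hy
  rw [log_fgnQuot_circle hd0 hd' hs hs0 (by simp) (cutPlane_ne_one hy), add_div]

theorem fgnX0_eq_of_pos {d s : ℝ} (hd0 : 0 < d) (hd' : d < 1 / 2)
    (hs : s ∈ Set.Ioo (-1 : ℝ) 0) (hs0 : fgnQ d s = 0) {z : ℂ} (hz : z ∈ cutPlane)
    (hz1 : ‖z‖ < 1) : fgnX0 d z = fgnPsi d z * fgnQuot d s z := by
  have hsl : ∀ w ∈ cutPlane, ‖w‖ ≤ 1 → fgnQuot d s w ∈ Complex.slitPlane := fun w hw hw1 =>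
    fgnQuot_mem_slitPlane hd0 hd' hs hs0 hw hw1
  have him : ∀ τ, (Real.log (τ / (τ - s)) + Complex.log (fgnQPlus d τ)).im =
      (fgnQPlus d τ).arg := fun τ => by
    rw [Complex.add_im, Complex.ofReal_im, zero_add, Complex.log_im]
  obtain ⟨C, hC, hCb⟩ := exists_log_norm_fgnQuot_bound hd0 hd' hs hs0
  refine fgnX0_eq_of_cauchy (Complex.slitPlane_ne_zero (hsl z hz hz1.le))
    (circleIntegral_log_fgnQuot hd0 hd' hs hs0 hz1) ?_
  have hcauchy := slit_disc_cauchy (L := fun w => Complex.log (fgnQuot d s w)) hz hz1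
    (fun w hw hw1 => (differentiableAt_fgnQuot hd' hs.2 hw).clog (hsl w hw hw1))
    (fun w hw hw1 => by
      simp only [fgnQuot_conj hd0 hd' hs hs0]
      exact Complex.log_conj _ (Complex.slitPlane_arg_ne_pi (hsl w hw hw1)))
    hC (B := Real.pi) (fun w => by simpa only [Complex.log_im] using Complex.abs_arg_le_pi _)
    (fun w hw hw1 => by simpa only [Complex.log_re] using hCb w hw hw1)
    (ℓ := fun t => Real.log (t / (t - s)) + Complex.log (fgnQPlus d t))
    (fun t ht => tendsto_log_fgnQuot_arc hd0 hd' hs hs0 ht)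
    (circleIntegrable_log_fgnQuot hd0 hd' hs hs0)
    (by simpa only [him] using intervalIntegrable_arg_div hd' (cutPlane_ne_Icc hz))
  simpa only [him] using hcauchy

theorem analyticOrderAt_fgnQ_eq_one {d s : ℝ} (hd0 : 0 < d) (hd' : d < 1 / 2)
    (hs : s ∈ Set.Ioo (-1 : ℝ) 0) (hs0 : fgnQ d s = 0) :
    analyticOrderAt (fgnQ d) (s : ℂ) = 1 := by
  obtain ⟨q, hq, hder⟩ := exists_deriv_fgnQ_neg hd0 hd' hs hs0
  have han : AnalyticAt ℂ (fgnQ d) s :=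
    DifferentiableOn.analyticAt (s := cutPlane)
      (fun w hw => (differentiableAt_fgnQ hd' hw).differentiableWithinAt)
      (isOpen_cutPlane.mem_nhds (ofReal_mem_cutPlane hs.2))
  refine han.analyticOrderAt_eq_one_of_zero_deriv_ne_zero hs0 ?_
  rw [hder.deriv]
  exact_mod_cast hq.ne

theorem fgnX0_eq_of_pos_of_ne {d s : ℝ} (hd0 : 0 < d) (hd' : d < 1 / 2)
    (hs : s ∈ Set.Ioo (-1 : ℝ) 0) (hs0 : fgnQ d s = 0) {z : ℂ} (hz : z ∈ cutPlane)
    (hz1 : ‖z‖ < 1) (hne : z ≠ s) :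
    fgnX0 d z = fgnPsi d z * fgnQ d z * (z / (z - s)) := by
  rw [fgnX0_eq_of_pos hd0 hd' hs hs0 hz hz1, fgnQuot_of_ne hs0 hne, mul_assoc]

theorem tendsto_fgnX0_zero {d s : ℝ} (hd0 : 0 < d) (hd' : d < 1 / 2)
    (hs : s ∈ Set.Ioo (-1 : ℝ) 0) (hs0 : fgnQ d s = 0) :
    Tendsto (fun z : ℂ => fgnPsi d z * fgnQ d z * (z / (z - s))) (𝓝[≠] (s : ℂ))
      (𝓝 (fgnX0 d s)) := by
  have hsc := ofReal_mem_cutPlane hs.2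
  have hnorm : ‖(s : ℂ)‖ < 1 := by
    rw [Complex.norm_real, Real.norm_eq_abs, abs_of_neg hs.2]
    linarith [hs.1]
  refine Tendsto.congr' ?_ ((continuousAt_fgnX0 hd' hsc).tendsto.mono_left nhdsWithin_le_nhds)
  filter_upwards [self_mem_nhdsWithin, mem_nhdsWithin_of_mem_nhds (isOpen_cutPlane.mem_nhds hsc),
    mem_nhdsWithin_of_mem_nhds
      ((isOpen_lt continuous_norm continuous_const).mem_nhds hnorm)] with w hne hw hw1
  exact fgnX0_eq_of_pos_of_ne hd0 hd' hs hs0 hw hw1 hne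

theorem lemma3p3 (d : ℝ) (hd : -1 / 2 < d) (hd' : d < 1 / 2) (hd0 : d ≠ 0) :
    -- the objects in the definitions of `X₀` and `ψ` are well defined
    ((∀ t ∈ Set.Ioo (0 : ℝ) 1, fgnQPlus d t ≠ 0 ∧
        Tendsto (fgnQ d) (𝓝[{z : ℂ | 0 < z.im}] (t : ℂ)) (𝓝 (fgnQPlus d t))) ∧
      (∀ z : ℂ, (∀ x ∈ Set.Icc (0 : ℝ) 1, z ≠ (x : ℂ)) →
        IntervalIntegrable (fun τ : ℝ => ((fgnQPlus d τ).arg : ℂ) / ((τ : ℂ) - z)) volume 0 1) ∧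
      (∀ z : ℂ, ‖z‖ ≠ 1 →
        CircleIntegrable (fun ζ : ℂ => Complex.log (fgnQ d ζ) / (ζ - z)) 0 1)) ∧
    -- the case of positive `d`
    (0 < d → ∃ s₀ : ℝ, s₀ ∈ Set.Ioo (-1 : ℝ) 0 ∧
      (∀ z ∈ cutPlane, fgnQ d z = 0 ↔ z = (s₀ : ℂ) ∨ z = (s₀ : ℂ)⁻¹) ∧
      analyticOrderAt (fgnQ d) (s₀ : ℂ) = 1 ∧
      (∀ z ∈ cutPlane, ‖z‖ < 1 → z ≠ (s₀ : ℂ) →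
        fgnX0 d z = fgnPsi d z * fgnQ d z * (z / (z - (s₀ : ℂ)))) ∧
      -- at `z = s₀` the right hand side is understood as its limit
      Tendsto (fun z : ℂ => fgnPsi d z * fgnQ d z * (z / (z - (s₀ : ℂ))))
        (𝓝[≠] (s₀ : ℂ)) (𝓝 (fgnX0 d (s₀ : ℂ)))) ∧
    -- the case of negative `d`
    (d < 0 →
      (∀ z ∈ cutPlane, fgnQ d z ≠ 0) ∧
      (∀ z ∈ cutPlane, ‖z‖ < 1 → fgnX0 d z = fgnPsi d z * fgnQ d z)) := by
  refine ⟨⟨fun t ht => ⟨fun h => ?_, tendsto_fgnQPlus hd' ht⟩,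
    fun z hz => intervalIntegrable_arg_div hd' hz,
    fun z hz => circleIntegrable_div_sub (circleIntegrable_log_fgnQ hd hd' hd0) hz⟩,
    fun hpos => ?_, fun hneg => ?_⟩
  · exact fgnQPlus_im_ne_zero hd hd' hd0 ht (by rw [h, Complex.zero_im])
  · obtain ⟨s, hs, hs0⟩ := exists_zero_fgnQ hpos hd'
    exact ⟨s, hs, fun z hz => fgnQ_eq_zero_iff hd hd' hd0 hs.2 hs0 hz,
      analyticOrderAt_fgnQ_eq_one hpos hd' hs hs0,
      fun z hz hz1 hne => fgnX0_eq_of_pos_of_ne hpos hd' hs hs0 hz hz1 hne,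
      tendsto_fgnX0_zero hpos hd' hs hs0⟩
  · exact ⟨fun z hz => Complex.slitPlane_ne_zero (fgnQ_mem_slitPlane_of_neg hd hneg hz),
      fun z hz hz1 => fgnX0_eq_of_neg hd hneg hz hz1⟩
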